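/- **Setting.** Let $H,U$ be Hilbert spaces over $\mathbb K\in\{\mathbb R,\mathbb C\}$ and let $\theta>0$. For Banach spaces $E,G$, $L(E,G)$ denotes the bounded linear operators with the operator norm, and a map $F$ into $L(E,G)$ is called strongly continuous if $F(\cdot)x$ is continuous for each $x\in E$. Let $\Sigma^+(H)$ be the set of self-adjoint nonnegative $P\in L(H)$, and let $C([a,b];\Sigma^+(H))$ be the set of strongly continuous maps $[a,b]\to\Sigma^+(H)$. Let $A(t)$, $t\in\mathbb R$, be linear, possibly unbounded operators in $H$, densely defined, with $A(t+\theta)=A(t)$, generating an evolution system $U_A(t,s)\in L(H)$, $0\le s\le t$. That is, $(t,s)\mapsto U_A(t,s)x$ is continuous for each $x\in H$; $U_A(s,s)=I$; $U_A(t,r)U_A(r,s)=U_A(t,s)$ for $0\le s\le r\le t$; and for $x\in D(A(s))$ and $t\ge s\ge 0$, $U_A(t,s)x\in D(A(t))$ and $\frac{\partial}{\partial t}U_A(t,s)x=A(t)U_A(t,s)x$ (right derivative at $t=s$). Let $B:\mathbb R\to L(U,H)$, $C:\mathbb R\to\Sigma^+(H)$, $Q:\mathbb R\to\Sigma^+(U)$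 be strongly continuous and $\theta$-periodic, with $Q(t)\ge\varepsilon I$ for all $t$ and some $\varepsilon>0$. For $F:\mathbb R\to L(H)$ strongly continuous, the equation $\dot y=(A(t)+F(t))y$ is called exponentially stable if it has a strongly continuous evolution operator $V(t,s)$, $0\le s\le t$, i.e. $V(t,s)x=U_A(t,s)x+\int_s^tU_A(t,r)F(r)V(r,s)x\,dr$ for all $x\in H$, with $\|V(t,s)\|\le M_0e^{-\rho(t-s)}$ for all $0\le s\le t$ and some $M_0,\rho>0$. Assume that * $(A,B)$ is exponentially $\theta$-periodic stabilizable: $\dot y=(A(t)+B(t)K_1(t))y$ is exponentially stable for some strongly continuous $\theta$-periodic $K_1:\mathbb R\to L(H,U)$; * $(A,C)$ is exponentially $\theta$-periodic detectable: $\dot y=(A(t)+K_2(t)C(t))y$ is exponentially stable for some strongly continuous $\theta$-periodic $K_2:\mathbb R\to L(H)$. For $T>0$, a mild solution on $[0,T]$ of the Riccati equation $$\dot P+A^*P+PA-PBQ^{-1}B^*P+C^*C=0$$ is a $P\in C([0,T];\Sigma^+(H))$ such that for all $t\in[0,T]$ and $h\in H$ $$P(t)h=U_A^*(T,t)P(T)U_A(T,t)h-\int_t^TU_A^*(s,t)\big(P(s)B(s)Q^{-1}(s)B^*(s)P(s)-C^*(s)C(s)\big)U_A(s,t)h\,ds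 .$$ Let $P^T$ denote a mild solution on $[0,T]$ with $P^T(T)=0$, and let $P_\theta$ denote a mild solution on $[0,\theta]$ with $P_\theta(\theta)=P_\theta(0)$, extended $\theta$-periodically to $\mathbb R$. **Proposition 3.1.** There is at most one $P_\theta$, and at most one $P^T$ for each $T>0$. If $P_\theta$ exists, there are constants $M,\mu>0$, independent of $T$, such that for every $T>0$ for which $P^T$ exists, $$\|P_\theta(t)-P^T(t)\|\le Me^{-\mu(T-t)},\qquad 0\le t\le T .$$ Moreover, $P_\theta$ exists, and $P^T$ exists for every $T>0$, whenever $(t,s)\mapsto U_A^*(t,s)x$ is continuous on $\{0\le s\le t\}$ for each $x\in H$. -/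

import Mathlib

open Set MeasureTheory
open scoped InnerProductSpace

section PeriodicRiccati

variable {𝕜 : Type*} [RCLike 𝕜]
variable {H : Type*} [NormedAddCommGroup H] [InnerProductSpace 𝕜 H] [CompleteSpace H]
  [NormedSpace ℝ H]
variable {U : Type*} [NormedAddCommGroup U] [InnerProductSpace 𝕜 U] [CompleteSpace U]

/-- Membership of `t ↦ F t` in `C(ℝ; L(E, G))`: strong continuity, that is, continuity of
`t ↦ F t x` for every vector `x`. -/
def StronglyContinuous {E G : Type*} [NormedAddCommGroup E] [NormedSpace 𝕜 E]
    [NormedAddCommGroup G] [NormedSpace 𝕜 G] (F : ℝ → E →L[𝕜] G) : Prop :=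
  ∀ x : E, Continuous fun t => F t x

/-- A two-parameter family `V t s`, relevant for `0 ≤ s ≤ t` only, is jointly strongly
continuous there. -/
def StronglyContinuousTriangle (V : ℝ → ℝ → H →L[𝕜] H) : Prop :=
  ∀ x : H, ContinuousOn (fun p : ℝ × ℝ => V p.1 p.2 x) {p | 0 ≤ p.2 ∧ p.2 ≤ p.1}

/-- `A(·)` is a family of densely defined, possibly unbounded operators which generates the
evolution system `UA t s`, `0 ≤ s ≤ t`. The equation `∂/∂t UA(t,s) = A(t) UA(t,s)` is read on the
domain of `A(s)`: for `x ∈ D(A(s))` the vector `UA(t,s) x` lies in `D(A(t))` for `t ≥ s`, and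
`t ↦ UA(t,s) x` is differentiable on `[s, ∞)` (from the right at `t = s`). -/
structure GeneratesEvolution (A : ℝ → H →ₗ.[𝕜] H) (UA : ℝ → ℝ → H →L[𝕜] H) : Prop where
  dense_domain : ∀ t, 0 ≤ t → Dense ((A t).domain : Set H)
  strong_cont : StronglyContinuousTriangle UA
  refl : ∀ s, 0 ≤ s → UA s s = ContinuousLinearMap.id 𝕜 H
  comp : ∀ s r t, 0 ≤ s → s ≤ r → r ≤ t → (UA t r).comp (UA r s) = UA t s
  deriv : ∀ s t, 0 ≤ s → s ≤ t → ∀ x : (A s).domain, ∃ y : (A t).domain,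
    (y : H) = UA t s x ∧ HasDerivWithinAt (fun τ => UA τ s x) (A t y) (Ici s) t

/-- `V` is the evolution operator of the perturbed equation `y' = (A(t) + F(t)) y`, with mild
solutions given by the variation of constants formula relative to the evolution operator `UA`
of `A(·)`. -/
structure IsPerturbedEvolution (UA : ℝ → ℝ → H →L[𝕜] H) (F : ℝ → H →L[𝕜] H)
    (V : ℝ → ℝ → H →L[𝕜] H) : Prop where
  strong_cont : StronglyContinuousTriangle V
  mild : ∀ s t, 0 ≤ s → s ≤ t → ∀ x : H,
    V t s x = UA t s x + ∫ r in s..t, UA t r (F r (V r s x))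

/-- The equation `y' = (A(t) + F(t)) y` is exponentially stable. -/
def ExpStablePerturbation (UA : ℝ → ℝ → H →L[𝕜] H) (F : ℝ → H →L[𝕜] H) : Prop :=
  ∃ V : ℝ → ℝ → H →L[𝕜] H, IsPerturbedEvolution UA F V ∧
    ∃ M > 0, ∃ ρ > 0, ∀ s t, 0 ≤ s → s ≤ t → ‖V t s‖ ≤ M * Real.exp (-ρ * (t - s))

/-- The pair `(A(·), B(·))` is exponentially `θ`-periodic stabilizable: a strongly continuous
`θ`-periodic feedback `K` makes `y' = (A(t) + B(t) K(t)) y` exponentially stable. -/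
def PeriodicStabilizable (θ : ℝ) (UA : ℝ → ℝ → H →L[𝕜] H) (B : ℝ → U →L[𝕜] H) : Prop :=
  ∃ K : ℝ → H →L[𝕜] U, StronglyContinuous K ∧ Function.Periodic K θ ∧
    ExpStablePerturbation UA fun t => (B t).comp (K t)

/-- The pair `(A(·), C(·))` is exponentially `θ`-periodic detectable: a strongly continuous
`θ`-periodic `K` makes `y' = (A(t) + K(t) C(t)) y` exponentially stable. -/
def PeriodicDetectable (θ : ℝ) (UA : ℝ → ℝ → H →L[𝕜] H) (C : ℝ → H →L[𝕜] H) : Prop :=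
  ∃ K : ℝ → H →L[𝕜] H, StronglyContinuous K ∧ Function.Periodic K θ ∧
    ExpStablePerturbation UA fun t => (K t).comp (C t)

open ContinuousLinearMap (adjoint)

/-- The operator `P B(t) Q(t)⁻¹ B(t)* P - C(t)* C(t)`; `Q t` is invertible wherever this is used. -/
noncomputable def riccatiTerm (B : ℝ → U →L[𝕜] H) (C : ℝ → H →L[𝕜] H) (Q : ℝ → U →L[𝕜] U)
    (t : ℝ) (P : H →L[𝕜] H) : H →L[𝕜] H :=
  P ∘L B t ∘L (Q t).inverse ∘L adjoint (B t) ∘L P - adjoint (C t) ∘L C t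

/-- `P ∈ C([0, T]; Σ⁺(H))` (strongly continuous, self-adjoint and nonnegative) is a mild solution
on `[0, T]` of `P' + A* P + P A - P B Q⁻¹ B* P + C* C = 0`. Values of `P` outside `[0, T]` are
irrelevant. -/
structure IsMildRiccati (UA : ℝ → ℝ → H →L[𝕜] H) (B : ℝ → U →L[𝕜] H) (C : ℝ → H →L[𝕜] H)
    (Q : ℝ → U →L[𝕜] U) (T : ℝ) (P : ℝ → H →L[𝕜] H) : Prop where
  strong_cont : ∀ x : H, ContinuousOn (fun t => P t x) (Icc 0 T)
  pos : ∀ t ∈ Icc 0 T, (P t).IsPositive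
  mild : ∀ t ∈ Icc 0 T, ∀ h : H,
    P t h = adjoint (UA T t) (P T (UA T t h)) -
      ∫ s in t..T, adjoint (UA s t) (riccatiTerm B C Q s (P s) (UA s t h))

/-- `P` solves the Riccati equation on `[0, T]` with the final value `P(T) = 0`. -/
structure IsFinalRiccati (UA : ℝ → ℝ → H →L[𝕜] H) (B : ℝ → U →L[𝕜] H) (C : ℝ → H →L[𝕜] H)
    (Q : ℝ → U →L[𝕜] U) (T : ℝ) (P : ℝ → H →L[𝕜] H) : Prop where
  sol : IsMildRiccati UA B C Q T P
  final : P T = 0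

/-- `P` solves the Riccati equation on `[0, θ]` and is extended `θ`-periodically to `ℝ`; in
particular `P(θ) = P(0)`. -/
structure IsPeriodicRiccati (UA : ℝ → ℝ → H →L[𝕜] H) (B : ℝ → U →L[𝕜] H) (C : ℝ → H →L[𝕜] H)
    (Q : ℝ → U →L[𝕜] U) (θ : ℝ) (P : ℝ → H →L[𝕜] H) : Prop where
  sol : IsMildRiccati UA B C Q θ P
  periodic : Function.Periodic P θ

end PeriodicRiccati

/-!
The mild Riccati equation is treated in weak form: paired with two vectors, it is a Lyapunov
equation `P' + A* P + P A = P S P - R` with `S = B Q⁻¹ B*` and `R = C* C` (`IsRiccati`). Although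
nothing in it is differentiable, the product rule for `⟨y₁, P y₂⟩` along mild trajectories `y₁`,
`y₂` holds, since the defect of its integrated form over `[r, s]` is of order `(s - r) ^ 2`
(`IsLyapunov.inner_sub_inner`). All estimates follow from this identity.

*Bound.* Along the trajectory `y` of the stabilizing feedback the product rule bounds `⟨P y, y⟩`
by the cost of this feedback. A solution with final value zero is therefore bounded independently
of `T` (`RiccatiSystem.exists_norm_le_of_final`).

*Stability.* Along the closed loop `y' = (A - S P) y`, the function `⟨P y, y⟩` decreases at the
rate of the running cost, which controls the difference between `y` and the exponentially stable
detecting feedback. So `‖y‖² + c ⟨P y, y⟩` contracts by a fixed factor over time steps of a fixed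
length, and the closed loop decays exponentially, with constants that depend only on a bound for
`P` (`RiccatiSystem.exists_closedLoop_decay`).

*Comparison.* For two solutions `P₁` and `P₂`, the quantity `⟨y₁, (P₁ - P₂) y₂⟩` is constant if
`yᵢ` is a closed loop trajectory of `Pᵢ` (`RiccatiSystem.inner_sub_eq`). With the exponential
decay this gives `‖P₁(t) - P₂(t)‖ ≤ M e^{-μ(T-t)} ‖P₁(T) - P₂(T)‖`
(`RiccatiSystem.exists_norm_sub_le`), whence both uniqueness statements and the convergence to the
periodic solution. The latter extends to a solution on `[0, ∞)` as the evolution operators are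
themselves periodic (`GeneratesEvolution.periodic`).

*Existence.* If the adjoint evolution operators are strongly continuous, Banach's fixed point
theorem yields strongly continuous local solutions (`RiccatiSystem.exists_local`); they are
nonnegative by the product rule, and by the a priori bound they can be continued to `[0, T]` in
steps of a fixed length (`RiccatiSystem.exists_final`). By the comparison estimate the solutions
on `[0, n θ]` with final value zero form a Cauchy sequence on `[0, θ]`; its limit is periodic
because the solution on `[θ, (n + 1) θ]` is the shift of that on `[0, n θ]`
(`RiccatiSystem.exists_periodic`).

Separability of `H` is not available. Integrands such as `s ↦ U(s,t)* N(s) U(s,t) h` need not be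
continuous, since the adjoints of a strongly continuous family are only weakly continuous; but this
suffices for their strong measurability (`stronglyMeasurable_of_weaklyContinuous`).
-/

open ContinuousLinearMap (adjoint)

/-! ### Strong measurability of operator-valued functions -/

section Measurability

open Filter Topology

variable {𝕜 : Type*} [RCLike 𝕜]
variable {E : Type*} [NormedAddCommGroup E] [InnerProductSpace 𝕜 E]
variable {G : Type*} [NormedAddCommGroup G] [InnerProductSpace 𝕜 G]

/-- An operator-valued function of time is strongly measurable if all its orbits are. -/
def StrMeas (T : ℝ → E →L[𝕜] G) : Prop :=
  ∀ x, StronglyMeasurable fun t => T t x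

/-- Approximating `f` by simple functions reduces the claim to constant `f`. -/
theorem StrMeas.apply {T : ℝ → E →L[𝕜] G} (hT : StrMeas T) {f : ℝ → E}
    (hf : StronglyMeasurable f) : StronglyMeasurable fun t => T t (f t) := by
  refine stronglyMeasurable_of_tendsto atTop (f := fun n t => T t (hf.approx n t))
    (fun n => ?_) ?_
  · have : (fun t => T t (hf.approx n t)) = fun t => ∑ v ∈ (hf.approx n).range,
        (hf.approx n ⁻¹' {v}).indicator (fun t => T t v) t := by
      ext t
      rw [Finset.sum_eq_single (hf.approx n t)]
      · simp
      · intro v _ hv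
        exact indicator_of_notMem (fun h => hv (by simpa using h.symm)) _
      · intro h
        exact absurd (SimpleFunc.mem_range_self _ _) h
    rw [this]
    exact Finset.stronglyMeasurable_fun_sum _ fun v _ =>
      (hT v).indicator ((hf.approx n).measurableSet_fiber v)
  · rw [tendsto_pi_nhds]
    exact fun t => ((T t).continuous.tendsto _).comp (hf.tendsto_approx t)

theorem StrMeas.comp {F : Type*} [NormedAddCommGroup F] [InnerProductSpace 𝕜 F]
    {T : ℝ → E →L[𝕜] G} {R : ℝ → F →L[𝕜] E} (hT : StrMeas T) (hR : StrMeas R) :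
    StrMeas fun t => T t ∘L R t :=
  fun x => hT.apply (hR x)

theorem StrMeas.sub {T R : ℝ → E →L[𝕜] G} (hT : StrMeas T) (hR : StrMeas R) :
    StrMeas fun t => T t - R t :=
  fun x => (hT x).sub (hR x)

theorem StronglyContinuous.strMeas {T : ℝ → E →L[𝕜] G} (hT : StronglyContinuous T) :
    StrMeas T :=
  fun x => (hT x).stronglyMeasurable

/-- A weakly continuous curve in a Hilbert space is strongly measurable, even if the space is not
separable: the curve stays in the closed span of its values at rational times, and the preimages
of closed balls are closed, as the norm is weakly lower semicontinuous. -/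
theorem stronglyMeasurable_of_weaklyContinuous [CompleteSpace E] {f : ℝ → E}
    (hf : ∀ y : E, Continuous fun t => ⟪y, f t⟫_𝕜) : StronglyMeasurable f := by
  set K : Submodule 𝕜 E := (Submodule.span 𝕜 (range fun q : ℚ => f q)).topologicalClosure with hK
  have hKclosed : IsClosed (K : Set E) := Submodule.isClosed_topologicalClosure _
  have hKsep : TopologicalSpace.IsSeparable (K : Set E) :=
    ((countable_range fun q : ℚ => f q).isSeparable.span (R := 𝕜)).closure
  have hmem : ∀ t, f t ∈ K := by
    intro t
    have : CompleteSpace K := hKclosed.completeSpace_coe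
    rw [← Submodule.orthogonal_orthogonal K, Submodule.mem_orthogonal]
    intro y hy
    have h0 : (fun t => ⟪y, f t⟫_𝕜) = fun _ => 0 := by
      refine Continuous.ext_on Rat.isDenseEmbedding_coe_real.dense (hf y) continuous_const ?_
      rintro _ ⟨q, rfl⟩
      refine Submodule.inner_left_of_mem_orthogonal ?_ hy
      exact Submodule.le_topologicalClosure _ (Submodule.subset_span ⟨q, rfl⟩)
    exact congrFun h0 t
  have hball : ∀ (c : E) (r : ℝ), MeasurableSet (f ⁻¹' Metric.closedBall c r) := by
    intro c r
    apply IsClosed.measurableSet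
    rw [← isOpen_compl_iff, isOpen_iff_mem_nhds]
    intro t₀ ht₀
    have h1 : r < ‖f t₀ - c‖ := by simpa [dist_eq_norm] using ht₀
    rcases lt_or_ge r 0 with hr | hr
    · filter_upwards with t
      simpa [dist_eq_norm] using hr.trans_le (norm_nonneg (f t - c))
    have h2 : 0 < ‖f t₀ - c‖ := hr.trans_lt h1
    have hc : Continuous fun t => ‖⟪f t₀ - c, f t - c⟫_𝕜‖ := by
      simp only [inner_sub_right (f t₀ - c)]
      exact ((hf (f t₀ - c)).sub continuous_const).norm
    have h3 : r * ‖f t₀ - c‖ < ‖⟪f t₀ - c, f t₀ - c⟫_𝕜‖ := by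
      rw [inner_self_eq_norm_sq_to_K, norm_pow, RCLike.norm_ofReal, abs_norm, sq]
      gcongr
    filter_upwards [hc.continuousAt.eventually (lt_mem_nhds h3)] with t ht
    have h4 := norm_inner_le_norm (𝕜 := 𝕜) (f t₀ - c) (f t - c)
    have h5 : r < ‖f t - c‖ := by
      by_contra! h
      nlinarith
    simpa [dist_eq_norm] using h5
  borelize E
  refine stronglyMeasurable_iff_measurable_separable.2 ⟨?_, hKsep.mono ?_⟩
  swap
  · rintro _ ⟨t, rfl⟩
    exact hmem t
  refine measurable_of_isOpen fun V hV => ?_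
  obtain ⟨D, hDK, hDc, hD⟩ := hKsep.exists_countable_dense_subset
  have hcov : f ⁻¹' V = ⋃ p ∈ {p : E × ℚ | p.1 ∈ D ∧ Metric.closedBall p.1 (p.2 : ℝ) ⊆ V},
      f ⁻¹' Metric.closedBall p.1 (p.2 : ℝ) := by
    ext t
    simp only [mem_preimage, mem_iUnion, exists_prop, mem_ofPred_eq, Prod.exists]
    constructor
    · intro ht
      obtain ⟨ε, hε, hεV⟩ := Metric.isOpen_iff.1 hV _ ht
      obtain ⟨q, hq0, hq⟩ := exists_rat_btwn (half_pos hε)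
      have hq0' : (0 : ℝ) < q := hq0
      obtain ⟨c, hcD, hc⟩ := Metric.mem_closure_iff.1 (hD (hmem t)) q hq0'
      refine ⟨c, q, ⟨hcD, fun z hz => hεV ?_⟩, hc.le⟩
      rw [Metric.mem_ball]
      rw [Metric.mem_closedBall] at hz
      calc dist z (f t) ≤ dist z c + dist (f t) c := dist_triangle_right _ _ _
        _ < ε := by linarith
    · rintro ⟨c, q, ⟨-, hsub⟩, hmem⟩
      exact hsub hmem
  rw [hcov]
  refine MeasurableSet.biUnion ?_ fun p _ => hball _ _
  refine Countable.mono (s₂ := D ×ˢ (univ : Set ℚ)) ?_ (hDc.prod countable_univ)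
  exact fun p hp => ⟨hp.1, mem_univ _⟩

/-- The adjoint of a strongly continuous family is weakly, hence measurably, but in general not
strongly continuous. -/
theorem StronglyContinuous.adjoint_strMeas [CompleteSpace E] [CompleteSpace G]
    {T : ℝ → E →L[𝕜] G} (hT : StronglyContinuous T) : StrMeas fun t => adjoint (T t) := by
  intro x
  refine stronglyMeasurable_of_weaklyContinuous (𝕜 := 𝕜) fun y => ?_
  simp only [ContinuousLinearMap.adjoint_inner_right]
  exact (hT y).inner continuous_const

/-- A strongly continuous family of operators is bounded on compact sets (Banach–Steinhaus). -/
theorem exists_norm_le_of_stronglyContinuousOn {X : Type*} [TopologicalSpace X] [CompleteSpace E]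
    {T : X → E →L[𝕜] G} {K : Set X} (hK : IsCompact K)
    (hT : ∀ x, ContinuousOn (fun t => T t x) K) : ∃ c, 0 ≤ c ∧ ∀ t ∈ K, ‖T t‖ ≤ c := by
  obtain ⟨c, hc⟩ := banach_steinhaus (g := fun t : K => T t) fun x => by
    obtain ⟨c, hc⟩ := hK.exists_bound_of_continuousOn (hT x)
    exact ⟨c, fun t => hc t t.2⟩
  exact ⟨max c 0, le_max_right _ _, fun t ht => (hc ⟨t, ht⟩).trans (le_max_left _ _)⟩

theorem StronglyContinuous.exists_norm_le [CompleteSpace E] {T : ℝ → E →L[𝕜] G}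
    (hT : StronglyContinuous T) (a b : ℝ) : ∃ c, 0 ≤ c ∧ ∀ t ∈ Icc a b, ‖T t‖ ≤ c :=
  exists_norm_le_of_stronglyContinuousOn isCompact_Icc fun x => (hT x).continuousOn

/-- A strongly continuous periodic family of operators is bounded. -/
theorem StronglyContinuous.exists_norm_le_of_periodic [CompleteSpace E] {T : ℝ → E →L[𝕜] G}
    (hT : StronglyContinuous T) {θ : ℝ} (hθ : 0 < θ) (hp : Function.Periodic T θ) :
    ∃ c, 0 ≤ c ∧ ∀ t, ‖T t‖ ≤ c := by
  obtain ⟨c, hc0, hc⟩ := hT.exists_norm_le 0 θ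
  refine ⟨c, hc0, fun t => ?_⟩
  obtain ⟨s, hs, hst⟩ := hp.exists_mem_Ico₀ hθ t
  rw [hst]
  exact hc s ⟨hs.1, hs.2.le⟩

/-- A jointly continuous action of strongly continuous families. -/
theorem continuous_apply_of_stronglyContinuous {X : Type*} [TopologicalSpace X]
    [LocallyCompactSpace X] [CompleteSpace E] {T : X → E →L[𝕜] G}
    (hT : ∀ x, Continuous fun t => T t x) {f : X → E} (hf : Continuous f) :
    Continuous fun t => T t (f t) := by
  refine continuous_iff_continuousAt.2 fun t₀ => ?_
  obtain ⟨K, hK, hKt⟩ := exists_compact_mem_nhds t₀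
  obtain ⟨c, hc0, hc⟩ := exists_norm_le_of_stronglyContinuousOn hK fun x => (hT x).continuousOn
  have h1 : Tendsto (fun t => T t (f t - f t₀)) (𝓝 t₀) (𝓝 0) := by
    refine squeeze_zero_norm' (a := fun t => c * ‖f t - f t₀‖) ?_ ?_
    · filter_upwards [hKt] with t ht
      exact ((T t).le_opNorm _).trans (by gcongr; exact hc t ht)
    · have : Tendsto (fun t => c * ‖f t - f t₀‖) (𝓝 t₀) (𝓝 (c * ‖f t₀ - f t₀‖)) :=
        (continuous_const.mul (hf.sub continuous_const).norm).tendsto t₀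
      simpa using this
  have h2 := h1.add ((hT (f t₀)).tendsto t₀)
  simp only [map_sub, sub_add_cancel, zero_add] at h2
  exact h2

end Measurability

section Integrals

theorem integral_exp_neg_le {l : ℝ} (hl : 0 < l) (a b : ℝ) :
    ∫ s in a..b, Real.exp (-l * (b - s)) ≤ 1 / l := by
  have hd : ∀ s ∈ uIcc a b, HasDerivAt (fun s => Real.exp (-l * (b - s)) / l)
      (Real.exp (-l * (b - s))) s := by
    intro s _
    have h1 : HasDerivAt (fun s => -l * (b - s)) l s := by
      simpa using ((hasDerivAt_id s).const_sub b).const_mul (-l)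
    have h2 := (h1.exp).div_const l
    rwa [mul_div_assoc, div_self hl.ne', mul_one] at h2
  have hci : Continuous fun s : ℝ => Real.exp (-l * (b - s)) := by fun_prop
  rw [intervalIntegral.integral_eq_sub_of_hasDerivAt hd (hci.intervalIntegrable _ _)]
  simp only [sub_self, mul_zero, Real.exp_zero]
  have : 0 ≤ Real.exp (-l * (b - a)) / l := by positivity
  linarith

theorem integral_exp_neg_le' {l : ℝ} (hl : 0 < l) (a b : ℝ) :
    ∫ s in a..b, Real.exp (-l * (s - a)) ≤ 1 / l := by
  have hd : ∀ s ∈ uIcc a b, HasDerivAt (fun s => -(Real.exp (-l * (s - a)) / l))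
      (Real.exp (-l * (s - a))) s := by
    intro s _
    have h1 : HasDerivAt (fun s => -l * (s - a)) (-l) s := by
      simpa using ((hasDerivAt_id s).sub_const a).const_mul (-l)
    have h2 := ((h1.exp).div_const l).neg
    rwa [mul_neg, neg_div, neg_neg, mul_div_assoc, div_self hl.ne', mul_one] at h2
  have hci : Continuous fun s : ℝ => Real.exp (-l * (s - a)) := by fun_prop
  rw [intervalIntegral.integral_eq_sub_of_hasDerivAt hd (hci.intervalIntegrable _ _)]
  simp only [sub_self, mul_zero, Real.exp_zero]
  have : 0 ≤ Real.exp (-l * (b - a)) / l := by positivity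
  linarith

variable {E : Type*} [NormedAddCommGroup E]

theorem intervalIntegrable_of_norm_le {f : ℝ → E} (hf : StronglyMeasurable f) {a b c : ℝ}
    (hab : a ≤ b) (hc : ∀ s ∈ Icc a b, ‖f s‖ ≤ c) : IntervalIntegrable f volume a b := by
  rw [intervalIntegrable_iff_integrableOn_Icc_of_le hab]
  refine Measure.integrableOn_of_bounded (M := c) (by simp) hf.aestronglyMeasurable ?_
  exact (ae_restrict_iff' measurableSet_Icc).2 (.of_forall hc)

theorem norm_integral_le_of_norm_le_Icc [NormedSpace ℝ E] {f : ℝ → E} {a b c : ℝ} (hab : a ≤ b)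
    (hc : ∀ s ∈ Icc a b, ‖f s‖ ≤ c) : ‖∫ s in a..b, f s‖ ≤ c * (b - a) := by
  have h := intervalIntegral.norm_integral_le_of_norm_le_const (f := f) (a := a) (b := b) (C := c)
    fun s hs => hc s (by rw [uIoc_of_le hab] at hs; exact ⟨hs.1.le, hs.2⟩)
  rwa [abs_of_nonneg (sub_nonneg.2 hab)] at h

/-- A function whose increments are of second order is constant. -/
theorem eq_of_norm_sub_le_sq [NormedSpace ℝ E] {f : ℝ → E} {a b c : ℝ} (hab : a ≤ b)
    (hf : ∀ r s, a ≤ r → r ≤ s → s ≤ b → ‖f s - f r‖ ≤ c * (s - r) ^ 2) : f b = f a := by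
  have hf' : ∀ r ∈ Icc a b, ∀ s ∈ Icc a b, ‖f s - f r‖ ≤ c * (s - r) ^ 2 := by
    intro r hr s hs
    rcases le_total r s with h | h
    · exact hf r s hr.1 h hs.2
    · have := hf s r hs.1 h hr.2
      rw [norm_sub_rev]
      convert this using 2
      ring
  have hd : ∀ r ∈ Icc a b, HasDerivWithinAt f 0 (Icc a b) r := by
    intro r hr
    rw [hasDerivWithinAt_iff_isLittleO]
    simp only [smul_zero, sub_zero]
    have hO : (fun s => f s - f r) =O[nhdsWithin r (Icc a b)] fun s => (s - r) ^ 2 := by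
      refine Asymptotics.IsBigO.of_bound c ?_
      filter_upwards [self_mem_nhdsWithin] with s hs
      rw [norm_pow, Real.norm_eq_abs, sq_abs]
      exact hf' r hr s hs
    refine hO.trans_isLittleO ?_
    have : (fun s : ℝ => (s - r) ^ 2) =o[nhds r] fun s => (s - r) ^ 1 := by
      have h0 : Filter.Tendsto (fun s : ℝ => s - r) (nhds r) (nhds 0) := by
        have : Filter.Tendsto (fun s : ℝ => s - r) (nhds r) (nhds (r - r)) :=
          (continuous_id.sub continuous_const).tendsto r
        simpa using this
      exact (Asymptotics.isLittleO_pow_pow (𝕜 := ℝ) one_lt_two).comp_tendsto h0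
    simpa using this.mono nhdsWithin_le_nhds
  refine constant_of_has_deriv_right_zero (fun r hr => (hd r hr).continuousWithinAt) ?_ b
    (right_mem_Icc.2 hab)
  intro r hr
  exact ((hd r ⟨hr.1, hr.2.le⟩).mono_of_mem_nhdsWithin (Icc_mem_nhdsGE_of_mem hr))

/-- The primitive of a bounded measurable function that depends continuously on a parameter is
jointly continuous in the parameter and the endpoint. -/
theorem continuous_parametric_primitive [NormedSpace ℝ E] {F : ℝ → ℝ → E} (a : ℝ)
    (hm : ∀ t, StronglyMeasurable (F t)) (hc : ∀ s, Continuous fun t => F t s)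
    (hb : ∀ l, ∃ c, ∀ t ∈ Icc (-l) l, ∀ s ∈ Icc (-l) l, ‖F t s‖ ≤ c) :
    Continuous fun p : ℝ × ℝ => ∫ s in a..p.2, F p.1 s := by
  refine continuous_iff_continuousAt.2 fun ⟨t, b⟩ => ?_
  set l := |a| + |b| + |t| + 1 with hl
  have ha := abs_le.1 (le_refl |a|)
  have hb' := abs_le.1 (le_refl |b|)
  have ht := abs_le.1 (le_refl |t|)
  have := abs_nonneg a
  have := abs_nonneg b
  have := abs_nonneg t
  obtain ⟨c, hc'⟩ := hb l
  refine intervalIntegral.continuousAt_parametric_primitive_of_dominated (fun _ => c) (-l) l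
    (fun t => (hm t).aestronglyMeasurable) ?_ intervalIntegrable_const
    (.of_forall fun s => (hc s).continuousAt) ⟨by linarith, by linarith⟩
    ⟨by linarith, by linarith⟩ (by simp)
  have hn : Icc (-l) l ∈ nhds t := Icc_mem_nhds (by linarith) (by linarith)
  filter_upwards [hn] with t' ht'
  refine (ae_restrict_iff' measurableSet_uIoc).2 (.of_forall fun s hs => ?_)
  rw [uIoc_of_le (by linarith)] at hs
  exact hc' t' ht' s ⟨hs.1.le, hs.2⟩

/-- Homogeneous integral form of Gronwall's inequality. -/
theorem eq_zero_of_norm_le_integral {f : ℝ → E} (hf : Continuous f) {a b c : ℝ}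
    (h : ∀ s ∈ Icc a b, ‖f s‖ ≤ c * ∫ r in a..s, ‖f r‖) : ∀ s ∈ Icc a b, f s = 0 := by
  have hcont : Continuous fun r => ‖f r‖ := hf.norm
  have hd : ∀ s, HasDerivAt (fun s => ∫ r in a..s, ‖f r‖) ‖f s‖ s := fun s =>
    intervalIntegral.integral_hasDerivAt_right (hcont.intervalIntegrable _ _)
      (hcont.stronglyMeasurableAtFilter _ _) hcont.continuousAt
  have hg : ∀ s ∈ Icc a b, ‖∫ r in a..s, ‖f r‖‖ ≤ gronwallBound 0 c 0 (s - a) := by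
    refine norm_le_gronwallBound_of_norm_deriv_right_le (f' := fun s => ‖f s‖)
      (fun s _ => (hd s).continuousAt.continuousWithinAt)
      (fun s _ => (hd s).hasDerivWithinAt) (by simp) fun s hs => ?_
    have h0 : 0 ≤ ∫ r in a..s, ‖f r‖ :=
      intervalIntegral.integral_nonneg hs.1 fun _ _ => norm_nonneg _
    rw [norm_norm, add_zero, Real.norm_of_nonneg h0]
    exact h s ⟨hs.1, hs.2.le⟩
  intro s hs
  have h1 := hg s hs
  rw [gronwallBound_ε0_δ0, norm_le_zero_iff] at h1
  have h2 := h s hs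
  rw [h1, mul_zero] at h2
  exact norm_le_zero_iff.1 h2

end Integrals

/-! ### Evolution families, mild trajectories and Lyapunov equations -/

section Evolution

variable {𝕜 : Type*} [RCLike 𝕜]
variable {H : Type*} [NormedAddCommGroup H] [InnerProductSpace 𝕜 H]
variable {U : ℝ → ℝ → H →L[𝕜] H}

theorem stronglyContinuous_left (hU : ∀ x, Continuous fun p : ℝ × ℝ => U p.1 p.2 x) (s : ℝ) :
    StronglyContinuous fun t => U t s :=
  fun x => (hU x).comp (continuous_id.prodMk continuous_const)

theorem stronglyContinuous_right (hU : ∀ x, Continuous fun p : ℝ × ℝ => U p.1 p.2 x) (t : ℝ) :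
    StronglyContinuous fun s => U t s :=
  fun x => (hU x).comp (continuous_const.prodMk continuous_id)

theorem exists_norm_le_square [CompleteSpace H]
    (hU : ∀ x, Continuous fun p : ℝ × ℝ => U p.1 p.2 x) (a b : ℝ) :
    ∃ c, 0 ≤ c ∧ ∀ t ∈ Icc a b, ∀ s ∈ Icc a b, ‖U t s‖ ≤ c := by
  obtain ⟨c, hc0, hc⟩ := exists_norm_le_of_stronglyContinuousOn (T := fun p : ℝ × ℝ => U p.1 p.2)
    (isCompact_Icc.prod isCompact_Icc : IsCompact (Icc a b ×ˢ Icc a b))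
    fun x => (hU x).continuousOn
  exact ⟨c, hc0, fun t ht s hs => hc (t, s) ⟨ht, hs⟩⟩

theorem exists_norm_le_orbit {y : ℝ → H} (hy : Continuous y) (a b : ℝ) :
    ∃ c, 0 ≤ c ∧ ∀ s ∈ Icc a b, ‖y s‖ ≤ c := by
  obtain ⟨c, hc⟩ := (isCompact_Icc (a := a) (b := b)).exists_bound_of_continuousOn hy.continuousOn
  exact ⟨max c 0, le_max_right _ _, fun t ht => (hc t ht).trans (le_max_left _ _)⟩

theorem norm_inner_apply_le {x z : H} {T : H →L[𝕜] H} {α β γ : ℝ} (hx : ‖x‖ ≤ α) (hT : ‖T‖ ≤ β)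
    (hz : ‖z‖ ≤ γ) : ‖⟪x, T z⟫_𝕜‖ ≤ α * β * γ := by
  have hα := (norm_nonneg x).trans hx
  have hβ := (norm_nonneg T).trans hT
  calc ‖⟪x, T z⟫_𝕜‖ ≤ ‖x‖ * (‖T‖ * ‖z‖) :=
        (norm_inner_le_norm _ _).trans (by gcongr; exact T.le_opNorm z)
    _ ≤ α * (β * γ) := by gcongr
    _ = α * β * γ := by ring

variable [CompleteSpace H] [NormedSpace ℝ H]

theorem inner_intervalIntegral_right {f : ℝ → H} {a b : ℝ} (hf : IntervalIntegrable f volume a b)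
    (x : H) : ⟪x, ∫ s in a..b, f s⟫_𝕜 = ∫ s in a..b, ⟪x, f s⟫_𝕜 :=
  ((innerSL 𝕜 x).intervalIntegral_comp_comm hf).symm

theorem inner_intervalIntegral_left {f : ℝ → H} {a b : ℝ} (hf : IntervalIntegrable f volume a b)
    (x : H) : ⟪∫ s in a..b, f s, x⟫_𝕜 = ∫ s in a..b, ⟪f s, x⟫_𝕜 := by
  rw [← inner_conj_symm, inner_intervalIntegral_right hf, ← intervalIntegral.intervalIntegral_conj]
  simp only [inner_conj_symm]

/-- A jointly strongly continuous evolution family, defined on the whole plane for convenience;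
the values `U t s` matter for `s ≤ t` only. -/
structure EvolutionFamily (U : ℝ → ℝ → H →L[𝕜] H) : Prop where
  cont : ∀ x, Continuous fun p : ℝ × ℝ => U p.1 p.2 x
  refl : ∀ s x, U s s x = x
  comp : ∀ s r t, s ≤ r → r ≤ t → ∀ x, U t r (U r s x) = U t s x

/-- `y` is a mild solution of `y' = A(t) y + g(t)` on `[a, b]`. -/
structure IsTrajectory (U : ℝ → ℝ → H →L[𝕜] H) (g y : ℝ → H) (a b : ℝ) : Prop where
  cont : Continuous y
  meas : StronglyMeasurable g
  bdd : ∃ c, ∀ s ∈ Icc a b, ‖g s‖ ≤ c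
  mild : ∀ r s, a ≤ r → r ≤ s → s ≤ b → y s = U s r (y r) + ∫ σ in r..s, U s σ (g σ)

/-- `W` solves `W' + A* W + W A = N` on `[a, b]` in the mild sense, tested against pairs of
vectors. -/
def IsLyapunov (U : ℝ → ℝ → H →L[𝕜] H) (W N : ℝ → H →L[𝕜] H) (a b : ℝ) : Prop :=
  ∀ r s, a ≤ r → r ≤ s → s ≤ b → ∀ x z,
    ⟪x, W r z⟫_𝕜 = ⟪U s r x, W s (U s r z)⟫_𝕜 - ∫ σ in r..s, ⟪U σ r x, N σ (U σ r z)⟫_𝕜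

/-- `V` is the evolution operator of `A(t) + F(t)`, extended to the whole plane. -/
structure IsPerturbation (U : ℝ → ℝ → H →L[𝕜] H) (F : ℝ → H →L[𝕜] H)
    (V : ℝ → ℝ → H →L[𝕜] H) : Prop where
  cont : ∀ x, Continuous fun p : ℝ × ℝ => V p.1 p.2 x
  mild : ∀ s t, 0 ≤ s → s ≤ t → ∀ x, V t s x = U t s x + ∫ r in s..t, U t r (F r (V r s x))

/-- It suffices to know the variation of constants formula from the initial time `a`. -/
theorem IsTrajectory.of_start (hU : EvolutionFamily U) {g y : ℝ → H} {a b : ℝ}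
    (hy : Continuous y) (hg : StronglyMeasurable g) (hgb : ∃ c, ∀ s ∈ Icc a b, ‖g s‖ ≤ c)
    (h : ∀ s, a ≤ s → s ≤ b → y s = U s a (y a) + ∫ σ in a..s, U s σ (g σ)) :
    IsTrajectory U g y a b := by
  refine ⟨hy, hg, hgb, fun r s har hrs hsb => ?_⟩
  obtain ⟨c, hc⟩ := hgb
  obtain ⟨u, hu0, hu⟩ := exists_norm_le_square hU.cont a b
  have hint : ∀ t ∈ Icc a b, ∀ p q, a ≤ p → p ≤ q → q ≤ b →
      IntervalIntegrable (fun σ => U t σ (g σ)) volume p q := by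
    intro t ht p q hap hpq hqb
    refine intervalIntegrable_of_norm_le
      ((stronglyContinuous_right hU.cont t).strMeas.apply hg) hpq (c := u * c) fun σ hσ => ?_
    have hσ' : σ ∈ Icc a b := ⟨hap.trans hσ.1, hσ.2.trans hqb⟩
    exact ((U t σ).le_opNorm _).trans
      (mul_le_mul (hu t ht σ hσ') (hc σ hσ') (norm_nonneg _) hu0)
  have hr : r ∈ Icc a b := ⟨har, hrs.trans hsb⟩
  have hs : s ∈ Icc a b := ⟨har.trans hrs, hsb⟩
  rw [h s hs.1 hsb, h r har hr.2, map_add, hU.comp a r s har hrs,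
    ← (U s r).intervalIntegral_comp_comm (hint r hr a r le_rfl har hr.2), add_assoc,
    ← intervalIntegral.integral_add_adjacent_intervals (hint s hs a r le_rfl har hr.2)
      (hint s hs r s har hrs hsb)]
  congr 2
  refine intervalIntegral.integral_congr fun σ hσ => ?_
  rw [uIcc_of_le har] at hσ
  exact (hU.comp σ r s hσ.2 hrs _).symm

/-- Product rule for `⟨y₁, W y₂⟩` along mild trajectories of a mild solution `W` of a Lyapunov
equation. None of the factors need be differentiable; instead, the defect of the integrated
product rule over `[r, s]` is of order `(s - r) ^ 2`. -/
theorem IsLyapunov.inner_sub_inner (hU : EvolutionFamily U) {W N : ℝ → H →L[𝕜] H} {a b : ℝ}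
    (hab : a ≤ b) (hW : StronglyContinuous W) (hN : StrMeas N)
    (hNb : ∃ c, ∀ s ∈ Icc a b, ‖N s‖ ≤ c) (hL : IsLyapunov U W N a b) {g₁ y₁ g₂ y₂ : ℝ → H}
    (h₁ : IsTrajectory U g₁ y₁ a b) (h₂ : IsTrajectory U g₂ y₂ a b) :
    ⟪y₁ b, W b (y₂ b)⟫_𝕜 - ⟪y₁ a, W a (y₂ a)⟫_𝕜 =
      ∫ s in a..b, (⟪g₁ s, W s (y₂ s)⟫_𝕜 + ⟪y₁ s, W s (g₂ s)⟫_𝕜 + ⟪y₁ s, N s (y₂ s)⟫_𝕜) := by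
  obtain ⟨u, hu0, hu⟩ := exists_norm_le_square hU.cont a b
  obtain ⟨w, hw0, hw⟩ := hW.exists_norm_le a b
  obtain ⟨n, hn⟩ := hNb
  obtain ⟨γ₁, hγ₁⟩ := h₁.bdd
  obtain ⟨γ₂, hγ₂⟩ := h₂.bdd
  obtain ⟨β₁, hβ₁0, hβ₁⟩ := exists_norm_le_orbit h₁.cont a b
  obtain ⟨β₂, hβ₂0, hβ₂⟩ := exists_norm_le_orbit h₂.cont a b
  have haI : a ∈ Icc a b := left_mem_Icc.2 hab
  have hn0 : 0 ≤ n := (norm_nonneg _).trans (hn a haI)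
  have hγ₁0 : 0 ≤ γ₁ := (norm_nonneg _).trans (hγ₁ a haI)
  have hγ₂0 : 0 ≤ γ₂ := (norm_nonneg _).trans (hγ₂ a haI)
  -- one constant bounds all the data on `[a, b]`
  obtain ⟨c, hc⟩ : ∃ c, c = u + w + n + γ₁ + γ₂ + β₁ + β₂ := ⟨_, rfl⟩
  have hc0 : 0 ≤ c := by linarith
  replace hu : ∀ t ∈ Icc a b, ∀ s ∈ Icc a b, ‖U t s‖ ≤ c :=
    fun t ht s hs => (hu t ht s hs).trans (by linarith)
  replace hw : ∀ s ∈ Icc a b, ‖W s‖ ≤ c := fun s hs => (hw s hs).trans (by linarith)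
  replace hn : ∀ s ∈ Icc a b, ‖N s‖ ≤ c := fun s hs => (hn s hs).trans (by linarith)
  replace hγ₁ : ∀ s ∈ Icc a b, ‖g₁ s‖ ≤ c := fun s hs => (hγ₁ s hs).trans (by linarith)
  replace hγ₂ : ∀ s ∈ Icc a b, ‖g₂ s‖ ≤ c := fun s hs => (hγ₂ s hs).trans (by linarith)
  replace hβ₁ : ∀ s ∈ Icc a b, ‖y₁ s‖ ≤ c := fun s hs => (hβ₁ s hs).trans (by linarith)
  replace hβ₂ : ∀ s ∈ Icc a b, ‖y₂ s‖ ≤ c := fun s hs => (hβ₂ s hs).trans (by linarith)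
  have hUx : ∀ t ∈ Icc a b, ∀ s ∈ Icc a b, ∀ x, ∀ d, ‖x‖ ≤ d → ‖U t s x‖ ≤ c * d :=
    fun t ht s hs x d hx => ((U t s).le_opNorm x).trans
      (mul_le_mul (hu t ht s hs) hx (norm_nonneg _) hc0)
  have hmU : ∀ t {f : ℝ → H}, StronglyMeasurable f → StronglyMeasurable fun σ => U t σ (f σ) :=
    fun t f hf => (stronglyContinuous_right hU.cont t).strMeas.apply hf
  have hmU' : ∀ r x, StronglyMeasurable fun σ => U σ r x :=
    fun r => (stronglyContinuous_left hU.cont r).strMeas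
  have hmW := hW.strMeas
  have hm₁ := h₁.cont.stronglyMeasurable
  have hm₂ := h₂.cont.stronglyMeasurable
  set f : ℝ → 𝕜 := fun s => ⟪g₁ s, W s (y₂ s)⟫_𝕜 + ⟪y₁ s, W s (g₂ s)⟫_𝕜 +
    ⟪y₁ s, N s (y₂ s)⟫_𝕜 with hf
  have hfm : StronglyMeasurable f :=
    ((h₁.meas.inner (hmW.apply hm₂)).add (hm₁.inner (hmW.apply h₂.meas))).add
      (hm₁.inner (hN.apply hm₂))
  have hfb : ∀ s ∈ Icc a b, ‖f s‖ ≤ c * c * c + c * c * c + c * c * c := fun s hs =>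
    (norm_add₃_le).trans (add_le_add (add_le_add
      (norm_inner_apply_le (hγ₁ s hs) (hw s hs) (hβ₂ s hs))
      (norm_inner_apply_le (hβ₁ s hs) (hw s hs) (hγ₂ s hs)))
      (norm_inner_apply_le (hβ₁ s hs) (hn s hs) (hβ₂ s hs)))
  have hfi : ∀ r s, a ≤ r → r ≤ s → s ≤ b → IntervalIntegrable f volume r s :=
    fun r s har hrs hsb => intervalIntegrable_of_norm_le hfm hrs
      fun σ hσ => hfb σ ⟨har.trans hσ.1, hσ.2.trans hsb⟩
  obtain ⟨ψ, hψ⟩ : ∃ ψ : ℝ → 𝕜, ∀ s, ψ s = ⟪y₁ s, W s (y₂ s)⟫_𝕜 - ∫ σ in a..s, f σ :=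
    ⟨_, fun _ => rfl⟩
  suffices h : ψ b = ψ a by
    rw [hψ, hψ, intervalIntegral.integral_same, sub_zero] at h
    rw [← h]
    ring
  refine eq_of_norm_sub_le_sq (f := ψ) (c := 2 * (c ^ 6 + c ^ 4) + (c ^ 5 + c ^ 4) + c ^ 5) hab
    fun r s har hrs hsb => ?_
  have hr : r ∈ Icc a b := ⟨har, hrs.trans hsb⟩
  have hs : s ∈ Icc a b := ⟨har.trans hrs, hsb⟩
  have hmem : ∀ σ ∈ Icc r s, σ ∈ Icc a b := fun σ hσ => ⟨har.trans hσ.1, hσ.2.trans hsb⟩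
  have hδ0 : 0 ≤ s - r := sub_nonneg.2 hrs
  -- the free evolution follows `y₁`, `y₂` and the weight `W` up to first order
  have he : ∀ {g y : ℝ → H}, IsTrajectory U g y a b → (∀ s ∈ Icc a b, ‖g s‖ ≤ c) →
      ∀ σ ∈ Icc r s, ‖y σ - U σ r (y r)‖ ≤ c ^ 2 * (s - r) := by
    intro g y hy hg σ hσ
    rw [hy.mild r σ har hσ.1 (hmem σ hσ).2, add_sub_cancel_left]
    refine (norm_integral_le_of_norm_le_Icc (c := c * c) hσ.1 fun τ hτ => ?_).trans ?_
    · have hτ' := hmem τ ⟨hτ.1, hτ.2.trans hσ.2⟩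
      exact hUx σ (hmem σ hσ) τ hτ' _ _ (hg τ hτ')
    · rw [sq]
      gcongr
      exact hσ.2
  have hLW : ∀ σ ∈ Icc r s, ∀ x z, ‖x‖ ≤ c → ‖z‖ ≤ c ^ 2 →
      ‖⟪U s σ x, W s (U s σ z)⟫_𝕜 - ⟪x, W σ z⟫_𝕜‖ ≤ c ^ 6 * (s - r) := by
    intro σ hσ x z hx hz
    rw [hL σ s (hmem σ hσ).1 hσ.2 hsb x z, sub_sub_cancel]
    refine (norm_integral_le_of_norm_le_Icc (c := (c * c) * c * (c * c ^ 2)) hσ.2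
      fun τ hτ => ?_).trans ?_
    · have hτ' := hmem τ ⟨hσ.1.trans hτ.1, hτ.2⟩
      exact norm_inner_apply_le (hUx τ hτ' σ (hmem σ hσ) _ _ hx) (hn τ hτ')
        (hUx τ hτ' σ (hmem σ hσ) _ _ hz)
    · have : c * c * c * (c * c ^ 2) = c ^ 6 := by ring
      rw [this]
      gcongr
      exact hσ.1
  have hv₁ : ∀ σ ∈ Icc r s, ‖U σ r (y₁ r)‖ ≤ c ^ 2 := fun σ hσ => by
    rw [sq]; exact hUx σ (hmem σ hσ) r hr _ _ (hβ₁ r hr)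
  have hv₂ : ∀ σ ∈ Icc r s, ‖U σ r (y₂ r)‖ ≤ c ^ 2 := fun σ hσ => by
    rw [sq]; exact hUx σ (hmem σ hσ) r hr _ _ (hβ₂ r hr)
  have hcomp : ∀ σ ∈ Icc r s, ∀ x, U s r x = U s σ (U σ r x) :=
    fun σ hσ x => (hU.comp r σ s hσ.1 hσ.2 x).symm
  set I₁ := ∫ σ in r..s, U s σ (g₁ σ) with hI₁
  set I₂ := ∫ σ in r..s, U s σ (g₂ σ) with hI₂
  have hi₁ : IntervalIntegrable (fun σ => U s σ (g₁ σ)) volume r s :=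
    intervalIntegrable_of_norm_le (hmU s h₁.meas) hrs
      fun σ hσ => hUx s hs σ (hmem σ hσ) _ _ (hγ₁ σ (hmem σ hσ))
  have hi₂ : IntervalIntegrable (fun σ => U s σ (g₂ σ)) volume r s :=
    intervalIntegrable_of_norm_le (hmU s h₂.meas) hrs
      fun σ hσ => hUx s hs σ (hmem σ hσ) _ _ (hγ₂ σ (hmem σ hσ))
  have hI₁b : ‖I₁‖ ≤ c ^ 2 * (s - r) := by
    have := he h₁ hγ₁ s ⟨hrs, le_rfl⟩
    rwa [h₁.mild r s har hrs hsb, add_sub_cancel_left] at this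
  have hI₂b : ‖I₂‖ ≤ c ^ 2 * (s - r) := by
    have := he h₂ hγ₂ s ⟨hrs, le_rfl⟩
    rwa [h₂.mild r s har hrs hsb, add_sub_cancel_left] at this
  set p₁ : ℝ → 𝕜 := fun σ => ⟪U s σ (g₁ σ), W s (U s r (y₂ r))⟫_𝕜 with hp₁
  set p₂ : ℝ → 𝕜 := fun σ => ⟪U s r (y₁ r), W s (U s σ (g₂ σ))⟫_𝕜 with hp₂
  set p₃ : ℝ → 𝕜 := fun σ => ⟪U σ r (y₁ r), N σ (U σ r (y₂ r))⟫_𝕜 with hp₃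
  have hq₁ : ⟪I₁, W s (U s r (y₂ r))⟫_𝕜 = ∫ σ in r..s, p₁ σ :=
    inner_intervalIntegral_left hi₁ _
  have hq₂ : ⟪U s r (y₁ r), W s I₂⟫_𝕜 = ∫ σ in r..s, p₂ σ :=
    (((innerSL 𝕜 (U s r (y₁ r))).comp (W s)).intervalIntegral_comp_comm hi₂).symm
  have hip₁ : IntervalIntegrable p₁ volume r s :=
    intervalIntegrable_of_norm_le ((hmU s h₁.meas).inner stronglyMeasurable_const) hrs
      fun σ hσ => norm_inner_apply_le (hUx s hs σ (hmem σ hσ) _ _ (hγ₁ σ (hmem σ hσ)))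
        (hw s hs) (hv₂ s ⟨hrs, le_rfl⟩)
  have hip₂ : IntervalIntegrable p₂ volume r s :=
    intervalIntegrable_of_norm_le
      (stronglyMeasurable_const.inner ((W s).continuous.comp_stronglyMeasurable (hmU s h₂.meas)))
      hrs fun σ hσ => norm_inner_apply_le (hv₁ s ⟨hrs, le_rfl⟩)
        (hw s hs) (hUx s hs σ (hmem σ hσ) _ _ (hγ₂ σ (hmem σ hσ)))
  have hip₃ : IntervalIntegrable p₃ volume r s :=
    intervalIntegrable_of_norm_le ((hmU' r _).inner (hN.apply (hmU' r _))) hrs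
      fun σ hσ => norm_inner_apply_le (hv₁ σ hσ) (hn σ (hmem σ hσ)) (hv₂ σ hσ)
  have hkey : (⟪y₁ s, W s (y₂ s)⟫_𝕜 - ∫ σ in a..s, f σ) -
      (⟪y₁ r, W r (y₂ r)⟫_𝕜 - ∫ σ in a..r, f σ) =
      (∫ σ in r..s, (p₁ σ + p₂ σ + p₃ σ - f σ)) + ⟪I₁, W s I₂⟫_𝕜 := by
    rw [intervalIntegral.integral_sub ((hip₁.add hip₂).add hip₃) (hfi r s har hrs hsb),
      intervalIntegral.integral_add (hip₁.add hip₂) hip₃,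
      intervalIntegral.integral_add hip₁ hip₂,
      ← intervalIntegral.integral_add_adjacent_intervals (hfi a r le_rfl har hr.2)
        (hfi r s har hrs hsb), ← hq₁, ← hq₂, hL r s har hrs hsb (y₁ r) (y₂ r),
      h₁.mild r s har hrs hsb, h₂.mild r s har hrs hsb]
    simp only [map_add, inner_add_left, inner_add_right]
    ring
  have hpt : ∀ σ ∈ Icc r s, ‖p₁ σ + p₂ σ + p₃ σ - f σ‖ ≤
      (2 * (c ^ 6 + c ^ 4) + (c ^ 5 + c ^ 4)) * (s - r) := by
    intro σ hσ
    have hσ' := hmem σ hσ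
    have hd : p₁ σ + p₂ σ + p₃ σ - f σ =
        (⟪U s σ (g₁ σ), W s (U s σ (U σ r (y₂ r)))⟫_𝕜 - ⟪g₁ σ, W σ (U σ r (y₂ r))⟫_𝕜)
        - ⟪g₁ σ, W σ (y₂ σ - U σ r (y₂ r))⟫_𝕜
        + (⟪U s σ (U σ r (y₁ r)), W s (U s σ (g₂ σ))⟫_𝕜 - ⟪U σ r (y₁ r), W σ (g₂ σ)⟫_𝕜)
        - ⟪y₁ σ - U σ r (y₁ r), W σ (g₂ σ)⟫_𝕜
        - ⟪y₁ σ - U σ r (y₁ r), N σ (U σ r (y₂ r))⟫_𝕜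
        - ⟪y₁ σ, N σ (y₂ σ - U σ r (y₂ r))⟫_𝕜 := by
      simp only [hp₁, hp₂, hp₃, hf, hcomp σ hσ, map_sub, inner_sub_left, inner_sub_right]
      ring
    have hLW' : ‖⟪U s σ (U σ r (y₁ r)), W s (U s σ (g₂ σ))⟫_𝕜 - ⟪U σ r (y₁ r), W σ (g₂ σ)⟫_𝕜‖ ≤
        c ^ 6 * (s - r) := by
      rw [hL σ s hσ'.1 hσ.2 hsb, sub_sub_cancel]
      refine (norm_integral_le_of_norm_le_Icc (c := (c * c ^ 2) * c * (c * c)) hσ.2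
        fun τ hτ => ?_).trans ?_
      · have hτ' := hmem τ ⟨hσ.1.trans hτ.1, hτ.2⟩
        exact norm_inner_apply_le (hUx τ hτ' σ hσ' _ _ (hv₁ σ hσ)) (hn τ hτ')
          (hUx τ hτ' σ hσ' _ _ (hγ₂ σ hσ'))
      · have : c * c ^ 2 * c * (c * c) = c ^ 6 := by ring
        rw [this]
        gcongr
        exact hσ.1
    have b₁ := hLW σ hσ _ _ (hγ₁ σ hσ') (hv₂ σ hσ)
    have b₂ := norm_inner_apply_le (𝕜 := 𝕜) (hγ₁ σ hσ') (hw σ hσ') (he h₂ hγ₂ σ hσ)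
    have b₄ := norm_inner_apply_le (𝕜 := 𝕜) (he h₁ hγ₁ σ hσ) (hw σ hσ') (hγ₂ σ hσ')
    have b₅ := norm_inner_apply_le (𝕜 := 𝕜) (he h₁ hγ₁ σ hσ) (hn σ hσ') (hv₂ σ hσ)
    have b₆ := norm_inner_apply_le (𝕜 := 𝕜) (hβ₁ σ hσ') (hn σ hσ') (he h₂ hγ₂ σ hσ)
    rw [hd]
    refine (norm_sub_le _ _).trans ((add_le_add_left ((norm_sub_le _ _).trans
      (add_le_add_left ((norm_sub_le _ _).trans (add_le_add_left ((norm_add_le _ _).trans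
        (add_le_add_left (norm_sub_le _ _) _)) _)) _)) _).trans ?_)
    linarith
  rw [hψ, hψ, hkey]
  refine (norm_add_le _ _).trans ?_
  have h1 := norm_integral_le_of_norm_le_Icc hrs hpt
  have h2 := norm_inner_apply_le (𝕜 := 𝕜) hI₁b (hw s hs) hI₂b
  refine (add_le_add h1 h2).trans (le_of_eq ?_)
  ring

end Evolution

/-! ### Perturbed evolution operators -/

section Perturbation

open scoped BoundedContinuousFunction

variable {𝕜 : Type*} [RCLike 𝕜]
variable {H : Type*} [NormedAddCommGroup H] [InnerProductSpace 𝕜 H] [NormedSpace ℝ H]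
variable {U V : ℝ → ℝ → H →L[𝕜] H} {F : ℝ → H →L[𝕜] H}

theorem IsPerturbation.refl (hU : EvolutionFamily U) (hV : IsPerturbation U F V) {s : ℝ}
    (hs : 0 ≤ s) (x : H) : V s s x = x := by
  rw [hV.mild s s hs le_rfl, intervalIntegral.integral_same, add_zero, hU.refl]

variable [CompleteSpace H]

theorem IsPerturbation.isTrajectory (hU : EvolutionFamily U) (hF : StronglyContinuous F)
    (hV : IsPerturbation U F V) {a b : ℝ} (ha : 0 ≤ a) (x : H) :
    IsTrajectory U (fun σ => F σ (V σ a x)) (fun σ => V σ a x) a b := by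
  have hc : Continuous fun σ => V σ a x := stronglyContinuous_left hV.cont a x
  have hFc : Continuous fun σ => F σ (V σ a x) := continuous_apply_of_stronglyContinuous hF hc
  obtain ⟨c, -, hc'⟩ := exists_norm_le_orbit hFc a b
  refine .of_start hU hc hFc.stronglyMeasurable ⟨c, hc'⟩ fun s has _ => ?_
  rw [hV.refl hU ha, hV.mild a s ha has]

theorem IsPerturbation.comp (hU : EvolutionFamily U) (hF : StronglyContinuous F)
    (hV : IsPerturbation U F V) {s r t : ℝ} (hs : 0 ≤ s) (hsr : s ≤ r) (hrt : r ≤ t) (x : H) :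
    V t r (V r s x) = V t s x := by
  have h₁ := hV.isTrajectory hU hF (hs.trans hsr) (b := t) (V r s x)
  have h₂ := hV.isTrajectory hU hF hs (b := t) x
  obtain ⟨u, hu0, hu⟩ := exists_norm_le_square hU.cont r t
  obtain ⟨f, hf0, hf⟩ := hF.exists_norm_le r t
  have hint : ∀ τ ∈ Icc r t, ∀ {y : ℝ → H}, Continuous y →
      IntervalIntegrable (fun σ => U τ σ (F σ (y σ))) volume r τ := fun τ hτ y hy =>
    (continuous_apply_of_stronglyContinuous (stronglyContinuous_right hU.cont τ)
      (continuous_apply_of_stronglyContinuous hF hy)).intervalIntegrable _ _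
  have hd : Continuous fun τ => V τ r (V r s x) - V τ s x := h₁.cont.sub h₂.cont
  refine sub_eq_zero.1 (eq_zero_of_norm_le_integral hd (a := r) (b := t) (c := u * f)
    (fun τ hτ => ?_) t ⟨hrt, le_rfl⟩)
  rw [h₁.mild r τ le_rfl hτ.1 hτ.2, h₂.mild r τ hsr hτ.1 hτ.2, hV.refl hU (hs.trans hsr),
    add_sub_add_left_eq_sub, ← intervalIntegral.integral_sub (hint τ hτ h₁.cont)
      (hint τ hτ h₂.cont), ← intervalIntegral.integral_const_mul]
  refine intervalIntegral.norm_integral_le_of_norm_le hτ.1 (.of_forall fun σ hσ => ?_)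
    ((continuous_const.mul hd.norm).intervalIntegrable _ _)
  have hσ' : σ ∈ Icc r t := ⟨hσ.1.le, hσ.2.trans hτ.2⟩
  rw [← map_sub, ← map_sub, mul_assoc]
  refine ((U τ σ).le_opNorm _).trans (mul_le_mul (hu τ hτ σ hσ') ?_ (norm_nonneg _) hu0)
  exact ((F σ).le_opNorm _).trans (by gcongr; exact hf σ hσ')

/-- Change of the reference evolution in the variation of constants formula. As for the product
rule, the increments of `V(s, ·) y(·)` agree with those of the integral up to second order. -/
theorem IsTrajectory.mild_perturbation (hU : EvolutionFamily U) (hF : StronglyContinuous F)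
    (hV : IsPerturbation U F V) {g y : ℝ → H} {a b : ℝ} (ha : 0 ≤ a)
    (hy : IsTrajectory U g y a b) {r₀ s₀ : ℝ} (har₀ : a ≤ r₀) (hrs₀ : r₀ ≤ s₀) (hsb₀ : s₀ ≤ b) :
    y s₀ = V s₀ r₀ (y r₀) + ∫ σ in r₀..s₀, V s₀ σ (g σ - F σ (y σ)) := by
  have hab : a ≤ b := har₀.trans (hrs₀.trans hsb₀)
  obtain ⟨u, hu0, hu⟩ := exists_norm_le_square hU.cont a b
  obtain ⟨v, hv0, hv⟩ := exists_norm_le_square hV.cont a b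
  obtain ⟨f, hf0, hf⟩ := hF.exists_norm_le a b
  obtain ⟨γ, hγ⟩ := hy.bdd
  obtain ⟨β, hβ0, hβ⟩ := exists_norm_le_orbit hy.cont a b
  have hγ0 : 0 ≤ γ := (norm_nonneg _).trans (hγ a (left_mem_Icc.2 hab))
  obtain ⟨c, hc⟩ : ∃ c, c = u + v + f + γ + β := ⟨_, rfl⟩
  have hc0 : 0 ≤ c := by linarith
  have hle : ∀ (T : H →L[𝕜] H) x α, ‖T‖ ≤ c → ‖x‖ ≤ α → ‖T x‖ ≤ c * α := fun T x α hT hx =>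
    (T.le_opNorm x).trans (mul_le_mul hT hx (norm_nonneg _) hc0)
  replace hu : ∀ t ∈ Icc a b, ∀ s ∈ Icc a b, ‖U t s‖ ≤ c :=
    fun t ht s hs => (hu t ht s hs).trans (by linarith)
  replace hv : ∀ t ∈ Icc a b, ∀ s ∈ Icc a b, ‖V t s‖ ≤ c :=
    fun t ht s hs => (hv t ht s hs).trans (by linarith)
  replace hf : ∀ s ∈ Icc a b, ‖F s‖ ≤ c := fun s hs => (hf s hs).trans (by linarith)
  replace hγ : ∀ s ∈ Icc a b, ‖g s‖ ≤ c := fun s hs => (hγ s hs).trans (by linarith)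
  replace hβ : ∀ s ∈ Icc a b, ‖y s‖ ≤ c := fun s hs => (hβ s hs).trans (by linarith)
  have hFm := hF.strMeas
  have hym := hy.cont.stronglyMeasurable
  obtain ⟨k, hk⟩ : ∃ k : ℝ → H, ∀ σ, k σ = g σ - F σ (y σ) := ⟨_, fun _ => rfl⟩
  have hkm : StronglyMeasurable k := by
    rw [show k = fun σ => g σ - F σ (y σ) from funext hk]
    exact hy.meas.sub (hFm.apply hym)
  have hkb : ∀ s ∈ Icc a b, ‖k s‖ ≤ c + c * c := fun s hs => by
    rw [hk]
    exact (norm_sub_le _ _).trans (add_le_add (hγ s hs) (hle _ _ _ (hf s hs) (hβ s hs)))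
  have hVk : ∀ t ∈ Icc a b, ∀ r s, a ≤ r → r ≤ s → s ≤ b →
      IntervalIntegrable (fun σ => V t σ (k σ)) volume r s := fun t ht r s har hrs hsb =>
    intervalIntegrable_of_norm_le ((stronglyContinuous_right hV.cont t).strMeas.apply hkm) hrs
      fun σ hσ => hle _ _ _ (hv t ht σ ⟨har.trans hσ.1, hσ.2.trans hsb⟩)
        (hkb σ ⟨har.trans hσ.1, hσ.2.trans hsb⟩)
  have hr₀ : r₀ ∈ Icc a b := ⟨har₀, hrs₀.trans hsb₀⟩
  have hs₀ : s₀ ∈ Icc a b := ⟨har₀.trans hrs₀, hsb₀⟩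
  obtain ⟨ψ, hψ⟩ : ∃ ψ : ℝ → H, ∀ r, ψ r = V s₀ r (y r) - ∫ σ in r₀..r, V s₀ σ (k σ) :=
    ⟨_, fun _ => rfl⟩
  suffices h : ψ s₀ = ψ r₀ by
    rw [hψ, hψ, intervalIntegral.integral_same, sub_zero, hV.refl hU (ha.trans hs₀.1),
      sub_eq_iff_eq_add] at h
    simpa only [hk] using h
  refine eq_of_norm_sub_le_sq (f := ψ)
    (c := c * (c * c * c * (c + c * c) + c * (c * (c * (c + c * (c * c)))))) hrs₀
    fun r s hrr hrs hss => ?_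
  have har : a ≤ r := har₀.trans hrr
  have hsb : s ≤ b := hss.trans hsb₀
  have hr : r ∈ Icc a b := ⟨har, hrs.trans hsb⟩
  have hs : s ∈ Icc a b := ⟨har.trans hrs, hsb⟩
  have hmem : ∀ σ ∈ Icc r s, σ ∈ Icc a b := fun σ hσ => ⟨har.trans hσ.1, hσ.2.trans hsb⟩
  set w : ℝ → H := fun σ => g σ - F σ (V σ r (y r)) with hw
  have hwm : StronglyMeasurable w :=
    hy.meas.sub (hFm.apply ((stronglyContinuous_left hV.cont r).strMeas _))
  have hwb : ∀ σ ∈ Icc r s, ‖w σ‖ ≤ c + c * (c * c) := fun σ hσ =>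
    (norm_sub_le _ _).trans (add_le_add (hγ σ (hmem σ hσ)) (hle _ _ _ (hf σ (hmem σ hσ))
      (hle _ _ _ (hv σ (hmem σ hσ) r hr) (hβ r hr))))
  have hUw : ∀ t ∈ Icc r s, IntervalIntegrable (fun σ => U t σ (w σ)) volume r t := fun t ht =>
    intervalIntegrable_of_norm_le ((stronglyContinuous_right hU.cont t).strMeas.apply hwm) ht.1
      fun σ hσ => hle _ _ _ (hu t (hmem t ht) σ (hmem σ ⟨hσ.1, hσ.2.trans ht.2⟩))
        (hwb σ ⟨hσ.1, hσ.2.trans ht.2⟩)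
  have hdiff : ∀ t ∈ Icc r s, y t - V t r (y r) = ∫ σ in r..t, U t σ (w σ) := by
    intro t ht
    have hi₁ : IntervalIntegrable (fun σ => U t σ (g σ)) volume r t :=
      intervalIntegrable_of_norm_le ((stronglyContinuous_right hU.cont t).strMeas.apply hy.meas)
        ht.1 fun σ hσ => hle _ _ _ (hu t (hmem t ht) σ (hmem σ ⟨hσ.1, hσ.2.trans ht.2⟩))
          (hγ σ (hmem σ ⟨hσ.1, hσ.2.trans ht.2⟩))
    have hi₂ : IntervalIntegrable (fun σ => U t σ (F σ (V σ r (y r)))) volume r t :=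
      (continuous_apply_of_stronglyContinuous (stronglyContinuous_right hU.cont t)
        (continuous_apply_of_stronglyContinuous hF
          (stronglyContinuous_left hV.cont r _))).intervalIntegrable _ _
    rw [hy.mild r t har ht.1 (hmem t ht).2, hV.mild r t (ha.trans har) ht.1,
      add_sub_add_left_eq_sub, ← intervalIntegral.integral_sub hi₁ hi₂]
    simp only [hw, map_sub]
  have hdb : ∀ t ∈ Icc r s, ‖y t - V t r (y r)‖ ≤ c * (c + c * (c * c)) * (s - r) := by
    intro t ht
    rw [hdiff t ht]
    refine (norm_integral_le_of_norm_le_Icc ht.1 fun σ hσ => hle _ _ _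
      (hu t (hmem t ht) σ (hmem σ ⟨hσ.1, hσ.2.trans ht.2⟩))
      (hwb σ ⟨hσ.1, hσ.2.trans ht.2⟩)).trans ?_
    have := ht.2
    gcongr
  have hUV : ∀ σ ∈ Icc r s, ‖U s σ (k σ) - V s σ (k σ)‖ ≤
      c * c * c * (c + c * c) * (s - r) := by
    intro σ hσ
    rw [hV.mild σ s (ha.trans (hmem σ hσ).1) hσ.2, sub_add_cancel_left, norm_neg]
    refine (norm_integral_le_of_norm_le_Icc (c := c * (c * (c * (c + c * c)))) hσ.2
      fun τ hτ => ?_).trans ?_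
    · have hτ' := hmem τ ⟨hσ.1.trans hτ.1, hτ.2⟩
      exact hle _ _ _ (hu s hs τ hτ') (hle _ _ _ (hf τ hτ')
        (hle _ _ _ (hv τ hτ' σ (hmem σ hσ)) (hkb σ (hmem σ hσ))))
    · have : c * (c * (c * (c + c * c))) = c * c * c * (c + c * c) := by ring
      rw [this]
      have := hσ.1
      gcongr
  have hinc : ψ s - ψ r = V s₀ s (∫ σ in r..s, (U s σ (w σ) - V s σ (k σ))) := by
    rw [intervalIntegral.integral_sub (hUw s ⟨hrs, le_rfl⟩) (hVk s hs r s har hrs hsb),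
      ← hdiff s ⟨hrs, le_rfl⟩, map_sub, map_sub, hV.comp hU hF (ha.trans har) hrs hss,
      ← (V s₀ s).intervalIntegral_comp_comm (hVk s hs r s har hrs hsb), hψ, hψ,
      ← intervalIntegral.integral_add_adjacent_intervals
        (hVk s₀ hs₀ r₀ r har₀ hrr hr.2) (hVk s₀ hs₀ r s har hrs hsb)]
    have : ∫ σ in r..s, V s₀ s (V s σ (k σ)) = ∫ σ in r..s, V s₀ σ (k σ) := by
      refine intervalIntegral.integral_congr fun σ hσ => ?_
      rw [uIcc_of_le hrs] at hσ
      exact hV.comp hU hF (ha.trans (hmem σ hσ).1) hσ.2 hss _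
    rw [this]
    abel
  have hpt : ∀ σ ∈ Icc r s, ‖U s σ (w σ) - V s σ (k σ)‖ ≤
      (c * c * c * (c + c * c) + c * (c * (c * (c + c * (c * c))))) * (s - r) := by
    intro σ hσ
    have : U s σ (w σ) - V s σ (k σ) =
        (U s σ (k σ) - V s σ (k σ)) + U s σ (F σ (y σ - V σ r (y r))) := by
      simp only [hw, hk, map_sub]
      abel
    rw [this, add_mul]
    refine (norm_add_le _ _).trans (add_le_add (hUV σ hσ) ?_)
    refine (hle _ _ _ (hu s hs σ (hmem σ hσ)) (hle _ _ _ (hf σ (hmem σ hσ))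
      (hdb σ hσ))).trans (le_of_eq (by ring))
  rw [hinc]
  refine (hle _ _ _ (hv s₀ hs₀ s hs) (norm_integral_le_of_norm_le_Icc hrs hpt)).trans
    (le_of_eq (by ring))

/-- Solvability of the Volterra equation of a bounded measurable perturbation. In terms of
`z(s) = exp(-l (s - a)) y(s)`, with `l` large, it is a fixed point equation of a contraction. -/
theorem exists_isTrajectory (hU : EvolutionFamily U) {a b : ℝ} (hab : a ≤ b) (hF : StrMeas F)
    (hFb : ∃ c, ∀ s ∈ Icc a b, ‖F s‖ ≤ c) (x : H) :
    ∃ y, IsTrajectory U (fun s => F s (y s)) y a b ∧ y a = x := by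
  obtain ⟨f, hf⟩ := hFb
  have hf0 : 0 ≤ f := (norm_nonneg _).trans (hf a (left_mem_Icc.2 hab))
  obtain ⟨u, hu0, hu⟩ := exists_norm_le_square hU.cont a b
  set π : ℝ → ℝ := fun s => max a (min s b) with hπ
  have hπc : Continuous π := continuous_const.max (continuous_id.min continuous_const)
  have hπm : ∀ s, π s ∈ Icc a b := fun s => ⟨le_max_left _ _, max_le hab (min_le_right _ _)⟩
  have hπid : ∀ s ∈ Icc a b, π s = s := fun s hs => by
    simp only [hπ]
    rw [min_eq_left hs.2, max_eq_right hs.1]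
  set F' : ℝ → H →L[𝕜] H := fun s => F (π s) with hF'
  have hF'm : StrMeas F' := fun x => (hF x).comp_measurable hπc.measurable
  have hF'b : ∀ s, ‖F' s‖ ≤ f := fun s => hf _ (hπm s)
  set l : ℝ := 2 * (u * f) + 1 with hl
  have hl0 : 0 < l := by positivity
  -- the kernel of the integral operator
  set K : (ℝ → H) → ℝ → ℝ → H := fun z t σ => Real.exp (-l * (t - σ)) • U t σ (F' σ (z σ)) with hK
  have hKm : ∀ z : ℝ →ᵇ H, ∀ t, StronglyMeasurable (K z t) := fun z t => by
    have h1 : Continuous fun σ : ℝ => Real.exp (-l * (t - σ)) := by fun_prop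
    exact h1.stronglyMeasurable.smul ((stronglyContinuous_right hU.cont t).strMeas.apply
      (hF'm.apply z.continuous.stronglyMeasurable))
  have hKb : ∀ z : ℝ → H, ∀ t ∈ Icc a b, ∀ σ ∈ Icc a t, ∀ d, ‖z σ‖ ≤ d →
      ‖K z t σ‖ ≤ Real.exp (-l * (t - σ)) * (u * f * d) := by
    intro z t ht σ hσ d hd
    rw [hK, norm_smul, Real.norm_eq_abs, abs_of_pos (Real.exp_pos _), mul_assoc u]
    gcongr
    refine ((U t σ).le_opNorm _).trans (mul_le_mul (hu t ht σ ⟨hσ.1, hσ.2.trans ht.2⟩) ?_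
      (norm_nonneg _) hu0)
    exact ((F' σ).le_opNorm _).trans (mul_le_mul (hF'b σ) hd (norm_nonneg _) hf0)
  have hKc : ∀ z : ℝ →ᵇ H, Continuous fun p : ℝ × ℝ => ∫ σ in a..p.2, K z p.1 σ := by
    intro z
    refine continuous_parametric_primitive a (hKm z) (fun σ => ?_) fun m => ?_
    · have h1 : Continuous fun t : ℝ => Real.exp (-l * (t - σ)) := by fun_prop
      exact h1.smul (stronglyContinuous_left hU.cont σ _)
    · obtain ⟨u', hu'0, hu'⟩ := exists_norm_le_square hU.cont (-m) m
      refine ⟨Real.exp (l * (2 * m)) * (u' * (f * ‖z‖)), fun t ht s hs => ?_⟩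
      rw [hK, norm_smul, Real.norm_eq_abs, abs_of_pos (Real.exp_pos _)]
      have h1 : 0 ≤ 2 * m + t - s := by linarith [ht.1, hs.2]
      have h2 : Real.exp (-l * (t - s)) ≤ Real.exp (l * (2 * m)) :=
        Real.exp_le_exp.2 (by linarith [mul_nonneg hl0.le h1])
      exact mul_le_mul h2 (((U t s).le_opNorm _).trans (mul_le_mul (hu' t ht s hs)
          (((F' s).le_opNorm _).trans (mul_le_mul (hF'b s) (z.norm_coe_le_norm s)
            (norm_nonneg _) hf0)) (norm_nonneg _) hu'0)) (norm_nonneg _) (Real.exp_pos _).le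
  have hKi : ∀ z : ℝ →ᵇ H, ∀ t ∈ Icc a b, IntervalIntegrable (K z t) volume a t := by
    intro z t ht
    refine intervalIntegrable_of_norm_le (hKm z t) ht.1 (c := u * f * ‖z‖) fun σ hσ => ?_
    refine (hKb z t ht σ hσ _ (z.norm_coe_le_norm σ)).trans ?_
    have : Real.exp (-l * (t - σ)) ≤ 1 := Real.exp_le_one_iff.2 (by
      have := hσ.2
      nlinarith)
    exact mul_le_of_le_one_left (by positivity) this
  have hexp : ∀ t, ∫ σ in a..t, Real.exp (-l * (t - σ)) ≤ 1 / l := integral_exp_neg_le hl0 a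
  set φ : (ℝ →ᵇ H) → ℝ → H := fun z s =>
    Real.exp (-l * (π s - a)) • U (π s) a x + ∫ σ in a..π s, K z (π s) σ with hφ
  have hφc : ∀ z, Continuous (φ z) := by
    intro z
    have h1 : Continuous fun s : ℝ => Real.exp (-l * (π s - a)) := by fun_prop
    exact (h1.smul ((stronglyContinuous_left hU.cont a x).comp hπc)).add
      ((hKc z).comp (hπc.prodMk hπc))
  have hφb : ∀ z, ∃ c, ∀ s, ‖φ z s‖ ≤ c := by
    intro z
    obtain ⟨c, -, hc⟩ := exists_norm_le_orbit (hφc z) a b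
    refine ⟨c, fun s => ?_⟩
    have : φ z s = φ z (π s) := by simp only [hφ, hπid _ (hπm s)]
    rw [this]
    exact hc _ (hπm s)
  choose C hC using hφb
  set Φ : (ℝ →ᵇ H) → (ℝ →ᵇ H) := fun z =>
    BoundedContinuousFunction.ofNormedAddCommGroup (φ z) (hφc z) (C z) (hC z) with hΦ
  have hcontr : ContractingWith (1 / 2) Φ := by
    refine ⟨by norm_num, LipschitzWith.of_dist_le_mul fun z z' => ?_⟩
    rw [BoundedContinuousFunction.dist_le (by positivity)]
    intro s
    have hs := hπm s
    have hsub : ∀ σ, K z (π s) σ - K z' (π s) σ = K (z - z') (π s) σ := by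
      intro σ
      simp only [hK, Pi.sub_apply, map_sub, smul_sub]
    have h1 : dist (Φ z s) (Φ z' s) = ‖∫ σ in a..π s, K (z - z') (π s) σ‖ := by
      rw [dist_eq_norm]
      change ‖φ z s - φ z' s‖ = _
      simp only [hφ]
      rw [add_sub_add_left_eq_sub, ← intervalIntegral.integral_sub (hKi z _ hs) (hKi z' _ hs)]
      simp only [hsub]
    rw [h1]
    have hci : Continuous fun σ : ℝ => Real.exp (-l * (π s - σ)) * (u * f * dist z z') := by
      fun_prop
    refine (intervalIntegral.norm_integral_le_of_norm_le hs.1 (.of_forall fun σ hσ =>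
      hKb _ _ hs σ ⟨hσ.1.le, hσ.2⟩ (dist z z') ?_) (hci.intervalIntegrable _ _)).trans ?_
    · rw [Pi.sub_apply, ← dist_eq_norm]
      exact BoundedContinuousFunction.dist_coe_le_dist σ
    · rw [intervalIntegral.integral_mul_const]
      have h2 : 1 / l * (u * f) ≤ 1 / 2 := by
        rw [div_mul_eq_mul_div, div_le_iff₀ hl0]
        linarith
      have h3 := hexp (π s)
      calc _ ≤ 1 / l * (u * f * dist z z') := by gcongr
        _ = 1 / l * (u * f) * dist z z' := by ring
        _ ≤ 1 / 2 * dist z z' := by gcongr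
        _ = _ := by norm_num
  obtain ⟨z, hz, -⟩ := hcontr.exists_fixedPoint 0 (edist_ne_top _ _)
  have hz' : ∀ s ∈ Icc a b, z s = Real.exp (-l * (s - a)) • U s a x + ∫ σ in a..s, K z s σ := by
    intro s hs
    have h1 : Φ z s = z s := by rw [hz]
    rw [← h1]
    change φ z s = _
    simp only [hφ, hπid s hs]
  have hza : z a = x := by
    rw [hz' a (left_mem_Icc.2 hab)]
    simp [hU.refl]
  have hyc : Continuous fun s => Real.exp (l * (s - a)) • z s := by
    have h1 : Continuous fun s : ℝ => Real.exp (l * (s - a)) := by fun_prop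
    exact h1.smul z.continuous
  refine ⟨fun s => Real.exp (l * (s - a)) • z s, .of_start hU hyc
    (hF.apply hyc.stronglyMeasurable) ?_ ?_, by simp [hza]⟩
  · obtain ⟨c, hc0, hc⟩ := exists_norm_le_orbit hyc a b
    exact ⟨f * c, fun s hs => ((F s).le_opNorm _).trans
      (mul_le_mul (hf s hs) (hc s hs) (norm_nonneg _) hf0)⟩
  · intro s has hsb
    simp only [sub_self, mul_zero, Real.exp_zero, one_smul, hza]
    rw [hz' s ⟨has, hsb⟩, smul_add, smul_smul, ← Real.exp_add, ← intervalIntegral.integral_smul]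
    have h1 : l * (s - a) + -l * (s - a) = 0 := by ring
    rw [h1, Real.exp_zero, one_smul]
    congr 1
    refine intervalIntegral.integral_congr fun σ hσ => ?_
    rw [uIcc_of_le has] at hσ
    have h2 : F' σ = F σ := by
      simp only [hF', hπid σ ⟨hσ.1, hσ.2.trans hsb⟩]
    simp only [hK]
    rw [smul_smul, ← Real.exp_add, h2, map_real_smul (F σ) (F σ).continuous,
      map_real_smul (U s σ) (U s σ).continuous]
    congr 2
    ring

end Perturbation

/-! ### Real-variable and operator inequalities -/

section Inequalities

theorem sq_integral_mul_le {f g : ℝ → ℝ} {a b c d : ℝ} (hab : a ≤ b) (hf : StronglyMeasurable f)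
    (hg : StronglyMeasurable g) (hfb : ∀ s ∈ Icc a b, ‖f s‖ ≤ c) (hgb : ∀ s ∈ Icc a b, ‖g s‖ ≤ d) :
    (∫ s in a..b, f s * g s) ^ 2 ≤ (∫ s in a..b, f s ^ 2) * ∫ s in a..b, g s ^ 2 := by
  have hmul : ∀ {f g : ℝ → ℝ} {c d : ℝ}, StronglyMeasurable f → StronglyMeasurable g →
      (∀ s ∈ Icc a b, ‖f s‖ ≤ c) → (∀ s ∈ Icc a b, ‖g s‖ ≤ d) →
      IntervalIntegrable (fun s => f s * g s) volume a b := fun hf hg hfb hgb =>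
    intervalIntegrable_of_norm_le (hf.mul hg) hab fun s hs => (norm_mul_le _ _).trans
      (mul_le_mul (hfb s hs) (hgb s hs) (norm_nonneg _) ((norm_nonneg _).trans (hfb s hs)))
  have hff : IntervalIntegrable (fun s => f s ^ 2) volume a b := by
    simpa only [sq] using hmul hf hf hfb hfb
  have hgg : IntervalIntegrable (fun s => g s ^ 2) volume a b := by
    simpa only [sq] using hmul hg hg hgb hgb
  have hfg := hmul hf hg hfb hgb
  have hquad : ∀ x : ℝ, 0 ≤ (∫ s in a..b, f s ^ 2) * (x * x) +
      (-(2 * ∫ s in a..b, f s * g s)) * x + ∫ s in a..b, g s ^ 2 := by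
    intro x
    have h0 : 0 ≤ ∫ s in a..b, (x * f s - g s) ^ 2 :=
      intervalIntegral.integral_nonneg hab fun _ _ => sq_nonneg _
    have h1 : ∀ s, (x * f s - g s) ^ 2 = x ^ 2 * f s ^ 2 - 2 * x * (f s * g s) + g s ^ 2 :=
      fun s => by ring
    simp only [h1] at h0
    rw [intervalIntegral.integral_add ((hff.const_mul _).sub (hfg.const_mul _)) hgg,
      intervalIntegral.integral_sub (hff.const_mul _) (hfg.const_mul _),
      intervalIntegral.integral_const_mul, intervalIntegral.integral_const_mul] at h0
    linarith
  have h := discrim_le_zero hquad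
  rw [discrim] at h
  linarith

/-- A function that contracts by a fixed factor over each time step `L` and stays comparable in
between decays exponentially. -/
theorem le_mul_exp_of_step {Φ : ℝ → ℝ} {a b m κ L : ℝ} (hm : 0 ≤ m) (hκ : 0 < κ) (hκ1 : κ ≤ 1)
    (hL : 0 < L) (hΦ : ∀ s ∈ Icc a b, 0 ≤ Φ s)
    (h₁ : ∀ r s, a ≤ r → r ≤ s → s ≤ b → Φ s ≤ m * Φ r)
    (h₂ : ∀ r, a ≤ r → r + L ≤ b → Φ (r + L) ≤ κ * Φ r) {r s : ℝ} (har : a ≤ r) (hrs : r ≤ s)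
    (hsb : s ≤ b) : Φ s ≤ m / κ * Real.exp (-(-Real.log κ / L) * (s - r)) * Φ r := by
  set n := ⌊(s - r) / L⌋₊ with hn
  have hn1 : (n : ℝ) * L ≤ s - r := by
    rw [← le_div_iff₀ hL]
    exact Nat.floor_le (div_nonneg (sub_nonneg.2 hrs) hL.le)
  have hn2 : (s - r) / L - 1 ≤ n := by
    have := Nat.lt_floor_add_one ((s - r) / L)
    linarith
  have hstep : ∀ j : ℕ, (j : ℝ) * L ≤ s - r → Φ (r + j * L) ≤ κ ^ j * Φ r := by
    intro j
    induction j with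
    | zero => intro _; simp
    | succ j ih =>
      intro hj
      push_cast at hj ⊢
      have hj' : (j : ℝ) * L ≤ s - r := by nlinarith
      have h3 := h₂ (r + j * L) (by nlinarith [Nat.cast_nonneg (α := ℝ) j]) (by linarith)
      calc Φ (r + (j + 1) * L) = Φ (r + j * L + L) := by ring_nf
        _ ≤ κ * Φ (r + j * L) := h3
        _ ≤ κ * (κ ^ j * Φ r) := by gcongr; exact ih hj'
        _ = κ ^ (j + 1) * Φ r := by ring
  have hnL : 0 ≤ (n : ℝ) * L := by positivity
  have hr0 := hΦ r ⟨har, hrs.trans hsb⟩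
  have hpow : κ ^ n ≤ 1 / κ * Real.exp (-(-Real.log κ / L) * (s - r)) := by
    have h3 : κ ^ n = Real.exp (n * Real.log κ) := by
      rw [mul_comm, Real.exp_mul, Real.exp_log hκ, Real.rpow_natCast]
    have h4 : 1 / κ = Real.exp (-Real.log κ) := by rw [Real.exp_neg, Real.exp_log hκ, one_div]
    rw [h3, h4, ← Real.exp_add]
    apply Real.exp_le_exp.2
    have h5 := Real.log_nonpos hκ.le hκ1
    have h6 : -Real.log κ + -(-Real.log κ / L) * (s - r) = ((s - r) / L - 1) * Real.log κ := by
      ring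
    rw [h6]
    exact mul_le_mul_of_nonpos_right hn2 h5
  calc Φ s ≤ m * Φ (r + n * L) := h₁ _ _ (by linarith) (by linarith) hsb
    _ ≤ m * (κ ^ n * Φ r) := by gcongr; exact hstep n hn1
    _ ≤ m * (1 / κ * Real.exp (-(-Real.log κ / L) * (s - r)) * Φ r) := by gcongr
    _ = _ := by ring

variable {𝕜 : Type*} [RCLike 𝕜] {H : Type*} [NormedAddCommGroup H] [InnerProductSpace 𝕜 H]

theorem re_inner_apply_le {T : H →L[𝕜] H} {c : ℝ} (hT : ‖T‖ ≤ c) (x : H) :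
    RCLike.re ⟪x, T x⟫_𝕜 ≤ c * ‖x‖ ^ 2 := by
  refine (RCLike.re_le_norm _).trans ((norm_inner_apply_le le_rfl hT le_rfl).trans (le_of_eq ?_))
  ring

/-- Cauchy–Schwarz inequality for the form of a nonnegative operator, obtained by testing the form
on `x - p⁻¹ T x`. -/
theorem ContinuousLinearMap.IsPositive.norm_apply_sq_le {T : H →L[𝕜] H} (hT : T.IsPositive)
    {p : ℝ} (hp : 0 < p) (h : ∀ x, RCLike.re ⟪x, T x⟫_𝕜 ≤ p * ‖x‖ ^ 2) (x : H) :
    ‖T x‖ ^ 2 ≤ p * RCLike.re ⟪x, T x⟫_𝕜 := by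
  have hcast : ((p⁻¹ : ℝ) : 𝕜) = (p : 𝕜)⁻¹ := by push_cast; rfl
  have h1 := hT.re_inner_nonneg_right (x - ((p⁻¹ : ℝ) : 𝕜) • T x)
  have h2 := h (T x)
  have hsym : ⟪x, T (T x)⟫_𝕜 = ⟪T x, T x⟫_𝕜 := (hT.inner_left_eq_inner_right x (T x)).symm
  simp only [map_sub, map_smul, inner_sub_left, inner_sub_right, inner_smul_left, inner_smul_right,
    RCLike.conj_ofReal, RCLike.re_ofReal_mul, hsym, inner_self_eq_norm_sq] at h1
  have h3 : p⁻¹ * (p⁻¹ * RCLike.re ⟪T x, T (T x)⟫_𝕜) ≤ p⁻¹ * ‖T x‖ ^ 2 := by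
    have : p⁻¹ * (p * ‖T x‖ ^ 2) = ‖T x‖ ^ 2 := by field_simp
    gcongr
    rw [← this]
    gcongr
  have h4 : p⁻¹ * ‖T x‖ ^ 2 ≤ RCLike.re ⟪x, T x⟫_𝕜 := by linarith
  rwa [inv_mul_le_iff₀ hp] at h4

theorem ContinuousLinearMap.IsPositive.norm_le {T : H →L[𝕜] H} (hT : T.IsPositive)
    {p : ℝ} (hp : 0 < p) (h : ∀ x, RCLike.re ⟪x, T x⟫_𝕜 ≤ p * ‖x‖ ^ 2) : ‖T‖ ≤ p := by
  refine T.opNorm_le_bound hp.le fun x => ?_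
  have h1 := hT.norm_apply_sq_le hp h x
  refine abs_le_of_sq_le_sq' ?_ (by positivity) |>.2
  calc ‖T x‖ ^ 2 ≤ p * (p * ‖x‖ ^ 2) := h1.trans (by gcongr; exact h x)
    _ = (p * ‖x‖) ^ 2 := by ring

theorem ContinuousLinearMap.opNorm_le_of_inner_le {T : H →L[𝕜] H} {c : ℝ} (hc : 0 ≤ c)
    (h : ∀ x z, ‖⟪x, T z⟫_𝕜‖ ≤ c * ‖x‖ * ‖z‖) : ‖T‖ ≤ c := by
  refine T.opNorm_le_bound hc fun z => ?_
  have h1 := h (T z) z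
  rw [inner_self_eq_norm_sq_to_K, norm_pow, RCLike.norm_ofReal, abs_norm] at h1
  by_contra! h2
  have h3 : 0 < ‖T z‖ := (by positivity : 0 ≤ c * ‖z‖).trans_lt h2
  nlinarith

end Inequalities

/-! ### Stability of the closed loop and comparison of Riccati solutions -/

section Riccati

variable {𝕜 : Type*} [RCLike 𝕜]
variable {H : Type*} [NormedAddCommGroup H] [InnerProductSpace 𝕜 H]

/-- The zeroth order part `P S P - R` of the Riccati equation. -/
def riccatiDefect (S R P : ℝ → H →L[𝕜] H) (t : ℝ) : H →L[𝕜] H :=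
  P t ∘L S t ∘L P t - R t

/-- `V` is exponentially stable on `0 ≤ s ≤ t`. -/
structure IsExpStable (V : ℝ → ℝ → H →L[𝕜] H) (M ρ : ℝ) : Prop where
  pos : 0 < M
  rate_pos : 0 < ρ
  le : ∀ s t, 0 ≤ s → s ≤ t → ‖V t s‖ ≤ M * Real.exp (-ρ * (t - s))

/-- The data of the Riccati equation `P' + A* P + P A - P S P + R = 0`, where `A` generates `U`. -/
structure RiccatiSystem (U : ℝ → ℝ → H →L[𝕜] H) (S R : ℝ → H →L[𝕜] H) : Prop where
  evol : EvolutionFamily U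
  S_meas : StrMeas S
  R_meas : StrMeas R
  S_bdd : ∃ c, ∀ t, ‖S t‖ ≤ c
  R_bdd : ∃ c, ∀ t, ‖R t‖ ≤ c
  S_pos : ∀ t, (S t).IsPositive
  R_pos : ∀ t, (R t).IsPositive

variable {U : ℝ → ℝ → H →L[𝕜] H} {S R P : ℝ → H →L[𝕜] H} {a b : ℝ}

theorem RiccatiSystem.strMeas_riccatiDefect (hs : RiccatiSystem U S R) (hP : StrMeas P) :
    StrMeas (riccatiDefect S R P) :=
  (hP.comp (hs.S_meas.comp hP)).sub hs.R_meas

theorem norm_riccatiDefect_le {σ ς p : ℝ} {t : ℝ} (hS : ‖S t‖ ≤ σ) (hR : ‖R t‖ ≤ ς)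
    (hP : ‖P t‖ ≤ p) : ‖riccatiDefect S R P t‖ ≤ p * (σ * p) + ς := by
  have hp := (norm_nonneg _).trans hP
  have hσ := (norm_nonneg _).trans hS
  refine (norm_sub_le _ _).trans (add_le_add ?_ hR)
  refine (ContinuousLinearMap.opNorm_comp_le _ _).trans (mul_le_mul hP ?_ (norm_nonneg _) hp)
  exact (ContinuousLinearMap.opNorm_comp_le _ _).trans (mul_le_mul hS hP (norm_nonneg _) hσ)

theorem IsLyapunov.mono {W N : ℝ → H →L[𝕜] H} (h : IsLyapunov U W N a b) {c d : ℝ} (hac : a ≤ c)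
    (hdb : d ≤ b) : IsLyapunov U W N c d :=
  fun r s hr hrs hs => h r s (hac.trans hr) hrs (hs.trans hdb)

theorem RiccatiSystem.exists_norm_riccatiDefect_le [CompleteSpace H] (hs : RiccatiSystem U S R)
    (hP : StronglyContinuous P) (a b : ℝ) :
    ∃ c, ∀ t ∈ Icc a b, ‖riccatiDefect S R P t‖ ≤ c := by
  obtain ⟨σ, hσ⟩ := hs.S_bdd
  obtain ⟨ς, hς⟩ := hs.R_bdd
  obtain ⟨p, -, hp⟩ := hP.exists_norm_le a b
  exact ⟨_, fun t ht => norm_riccatiDefect_le (hσ t) (hς t) (hp t ht)⟩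

theorem intervalIntegrable_inner_lyapunov [CompleteSpace H] {N : ℝ → H →L[𝕜] H}
    (hU : EvolutionFamily U) (hN : StrMeas N) (hNb : ∃ c, ∀ s ∈ Icc a b, ‖N s‖ ≤ c) {t r s : ℝ}
    (hat : a ≤ t) (htb : t ≤ b) (har : a ≤ r) (hrs : r ≤ s) (hsb : s ≤ b) (x z : H) :
    IntervalIntegrable (fun σ => ⟪U σ t x, N σ (U σ t z)⟫_𝕜) volume r s := by
  obtain ⟨n, hn⟩ := hNb
  obtain ⟨u, hu0, hu⟩ := exists_norm_le_square hU.cont a b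
  have hUm := (stronglyContinuous_left hU.cont t).strMeas
  refine intervalIntegrable_of_norm_le (c := u * ‖x‖ * n * (u * ‖z‖))
    ((hUm x).inner (hN.apply (hUm z))) hrs fun τ hτ => ?_
  have hτ' : τ ∈ Icc a b := ⟨har.trans hτ.1, hτ.2.trans hsb⟩
  exact norm_inner_apply_le (((U τ t).le_opNorm x).trans
    (mul_le_mul_of_nonneg_right (hu τ hτ' t ⟨hat, htb⟩) (norm_nonneg _))) (hn τ hτ')
    (((U τ t).le_opNorm z).trans
      (mul_le_mul_of_nonneg_right (hu τ hτ' t ⟨hat, htb⟩) (norm_nonneg _)))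

/-- `P` is a nonnegative solution on `[a, b]` of the Riccati equation, in weak form. Outside of
`[a, b]` only strong continuity is required, which can be achieved by extending `P` constantly. -/
structure IsRiccati (U : ℝ → ℝ → H →L[𝕜] H) (S R P : ℝ → H →L[𝕜] H) (a b : ℝ) : Prop where
  cont : StronglyContinuous P
  pos : ∀ t ∈ Icc a b, (P t).IsPositive
  lyap : IsLyapunov U P (riccatiDefect S R P) a b

theorem IsRiccati.mono (h : IsRiccati U S R P a b) {c d : ℝ} (hac : a ≤ c)
    (hdb : d ≤ b) : IsRiccati U S R P c d :=
  ⟨h.cont, fun t ht => h.pos t ⟨hac.trans ht.1, ht.2.trans hdb⟩, h.lyap.mono hac hdb⟩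

variable [NormedSpace ℝ H]

/-- Stabilizability expressed in terms of `S = B Q⁻¹ B*`: some `F` (namely `B K`) makes `A + F`
exponentially stable, and the cost of this feedback is controlled by the state. -/
def IsStabilizable (U : ℝ → ℝ → H →L[𝕜] H) (S : ℝ → H →L[𝕜] H) : Prop :=
  ∃ F V, StronglyContinuous F ∧ IsPerturbation U F V ∧ (∃ M ρ, IsExpStable V M ρ) ∧
    ∃ q, 0 ≤ q ∧ ∀ t y p, -(2 * RCLike.re ⟪F t y, p⟫_𝕜) ≤ RCLike.re ⟪p, S t p⟫_𝕜 + q * ‖y‖ ^ 2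

/-- Detectability expressed in terms of `R = C* C`: some `F` (namely `K C`) that is bounded by the
observation makes `A + F` exponentially stable. -/
def IsDetectable (U : ℝ → ℝ → H →L[𝕜] H) (R : ℝ → H →L[𝕜] H) : Prop :=
  ∃ F V, StronglyContinuous F ∧ IsPerturbation U F V ∧ (∃ M ρ, IsExpStable V M ρ) ∧
    ∃ k, 0 ≤ k ∧ ∀ t y, ‖F t y‖ ^ 2 ≤ k * RCLike.re ⟪y, R t y⟫_𝕜

/-- `y` is a trajectory of the closed loop equation `y' = (A - S P) y`. -/
def IsClosedLoop (U : ℝ → ℝ → H →L[𝕜] H) (S P : ℝ → H →L[𝕜] H) (y : ℝ → H) (a b : ℝ) : Prop :=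
  IsTrajectory U (fun s => -(S s (P s (y s)))) y a b

theorem IsTrajectory.mono {g y : ℝ → H} (h : IsTrajectory U g y a b) {c d : ℝ} (hac : a ≤ c)
    (hdb : d ≤ b) : IsTrajectory U g y c d := by
  obtain ⟨γ, hγ⟩ := h.bdd
  exact ⟨h.cont, h.meas, ⟨γ, fun s hs => hγ s ⟨hac.trans hs.1, hs.2.trans hdb⟩⟩,
    fun r s hr hrs hs => h.mild r s (hac.trans hr) hrs (hs.trans hdb)⟩

variable [CompleteSpace H]

theorem RiccatiSystem.exists_isClosedLoop (hs : RiccatiSystem U S R) (hP : StronglyContinuous P)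
    (hab : a ≤ b) (x : H) : ∃ y, IsClosedLoop U S P y a b ∧ y a = x := by
  obtain ⟨σ, hσ⟩ := hs.S_bdd
  obtain ⟨p, hp0, hp⟩ := hP.exists_norm_le a b
  refine exists_isTrajectory (F := fun s => -(S s ∘L P s)) hs.evol hab
    (fun x => (hs.S_meas.comp hP.strMeas x).neg) ⟨σ * p, fun s hs' => ?_⟩ x
  rw [norm_neg]
  exact (ContinuousLinearMap.opNorm_comp_le _ _).trans
    (mul_le_mul (hσ s) (hp s hs') (norm_nonneg _) ((norm_nonneg _).trans (hσ s)))

/-- Along the closed loop, `⟨P y, y⟩` decreases at the rate of the running cost. Nonnegativity of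
`P` is not assumed, as it is a consequence of this identity. -/
theorem RiccatiSystem.closedLoop_cost (hs : RiccatiSystem U S R) (hP : StronglyContinuous P)
    (hsym : ∀ t ∈ Icc a b, ∀ x z, ⟪P t x, z⟫_𝕜 = ⟪x, P t z⟫_𝕜)
    (hL : IsLyapunov U P (riccatiDefect S R P) a b) {y : ℝ → H} (hy : IsClosedLoop U S P y a b)
    {r s : ℝ} (har : a ≤ r) (hrs : r ≤ s) (hsb : s ≤ b) :
    IntervalIntegrable (fun σ => RCLike.re ⟪P σ (y σ), S σ (P σ (y σ))⟫_𝕜 +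
      RCLike.re ⟪y σ, R σ (y σ)⟫_𝕜) volume r s ∧
    RCLike.re ⟪y r, P r (y r)⟫_𝕜 - RCLike.re ⟪y s, P s (y s)⟫_𝕜 =
      ∫ σ in r..s, (RCLike.re ⟪P σ (y σ), S σ (P σ (y σ))⟫_𝕜 + RCLike.re ⟪y σ, R σ (y σ)⟫_𝕜) := by
  obtain ⟨σ, hσ⟩ := hs.S_bdd
  obtain ⟨ς, hς⟩ := hs.R_bdd
  obtain ⟨p, hp0, hp⟩ := hP.exists_norm_le r s
  obtain ⟨β, hβ0, hβ⟩ := exists_norm_le_orbit hy.cont r s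
  have hym := hy.cont.stronglyMeasurable
  have hPy := hP.strMeas.apply hym
  have hint : IntervalIntegrable (fun σ => ⟪P σ (y σ), S σ (P σ (y σ))⟫_𝕜 +
      ⟪y σ, R σ (y σ)⟫_𝕜) volume r s := by
    refine intervalIntegrable_of_norm_le ((hPy.inner (hs.S_meas.apply hPy)).add
      (hym.inner (hs.R_meas.apply hym))) hrs fun τ hτ => (norm_add_le _ _).trans
        (add_le_add (norm_inner_apply_le (α := p * β) ?_ (hσ τ) (γ := p * β) ?_)
          (norm_inner_apply_le (hβ τ hτ) (hς τ) (hβ τ hτ)))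
    all_goals
      exact ((P τ).le_opNorm _).trans (mul_le_mul (hp τ hτ) (hβ τ hτ) (norm_nonneg _) hp0)
  have hkey := (hL.mono har hsb).inner_sub_inner hs.evol hrs hP
    (hs.strMeas_riccatiDefect hP.strMeas) (hs.exists_norm_riccatiDefect_le hP r s)
    (IsTrajectory.mono hy har hsb) (IsTrajectory.mono hy har hsb)
  have hcong : ∫ σ in r..s, (⟪-(S σ (P σ (y σ))), P σ (y σ)⟫_𝕜 +
      ⟪y σ, P σ (-(S σ (P σ (y σ))))⟫_𝕜 + ⟪y σ, riccatiDefect S R P σ (y σ)⟫_𝕜) =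
      -∫ σ in r..s, (⟪P σ (y σ), S σ (P σ (y σ))⟫_𝕜 + ⟪y σ, R σ (y σ)⟫_𝕜) := by
    rw [← intervalIntegral.integral_neg]
    refine intervalIntegral.integral_congr fun τ hτ => ?_
    rw [uIcc_of_le hrs] at hτ
    have hτ' : τ ∈ Icc a b := ⟨har.trans hτ.1, hτ.2.trans hsb⟩
    have e := (hs.S_pos τ).inner_left_eq_inner_right (P τ (y τ)) (P τ (y τ))
    simp only [riccatiDefect, sub_apply, ContinuousLinearMap.comp_apply,
      map_neg, inner_neg_left, inner_neg_right, inner_sub_right, ← hsym τ hτ' (y τ), e]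
    ring
  rw [hcong] at hkey
  have hre : ∀ σ, RCLike.re ⟪P σ (y σ), S σ (P σ (y σ))⟫_𝕜 + RCLike.re ⟪y σ, R σ (y σ)⟫_𝕜 =
      RCLike.re (⟪P σ (y σ), S σ (P σ (y σ))⟫_𝕜 + ⟪y σ, R σ (y σ)⟫_𝕜) := fun σ =>
    (map_add _ _ _).symm
  simp only [hre]
  refine ⟨⟨hint.1.re, hint.2.re⟩, ?_⟩
  rw [intervalIntegral.intervalIntegral_re hint, ← map_sub, ← neg_sub, hkey, neg_neg]

/-- Stabilizability bounds the solutions that vanish at the final time, independently of it: the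
stabilizing feedback is a competitor for the optimal cost. -/
theorem RiccatiSystem.exists_norm_le_of_final (hs : RiccatiSystem U S R)
    (hst : IsStabilizable U S) :
    ∃ p, 0 < p ∧ ∀ {P a T}, 0 ≤ a → IsRiccati U S R P a T → P T = 0 →
      ∀ t ∈ Icc a T, ‖P t‖ ≤ p := by
  obtain ⟨F, V, hF, hV, ⟨M, ρ, hM⟩, q, hq0, hq⟩ := hst
  obtain ⟨ς, hς⟩ := hs.R_bdd
  have hM0 := hM.pos
  have hρ := hM.rate_pos
  have hς0 : 0 ≤ ς := (norm_nonneg _).trans (hς 0)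
  refine ⟨(q + ς) * M ^ 2 * (1 / (2 * ρ)) + 1, by positivity, ?_⟩
  intro P a T ha hP hPT t ht
  refine (hP.pos t ht).norm_le (by positivity) fun x => ?_
  have ht0 : 0 ≤ t := ha.trans ht.1
  replace hP := hP.mono ht.1 le_rfl
  have hy := hV.isTrajectory hs.evol hF ht0 (b := T) x
  obtain ⟨y, hyd⟩ : ∃ y : ℝ → H, y = fun σ => V σ t x := ⟨_, rfl⟩
  have hyV : (fun σ => F σ (V σ t x)) = fun σ => F σ (y σ) := by rw [hyd]
  rw [hyV, ← hyd] at hy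
  have hkey := hP.lyap.inner_sub_inner hs.evol ht.2 hP.cont
    (hs.strMeas_riccatiDefect hP.cont.strMeas) (hs.exists_norm_riccatiDefect_le hP.cont t T) hy hy
  have hyt : y t = x := by rw [hyd]; exact hV.refl hs.evol ht0 x
  rw [hPT, hyt, zero_apply, inner_zero_right, zero_sub] at hkey
  have hym := hy.cont.stronglyMeasurable
  have hPm := hP.cont.strMeas
  set f : ℝ → 𝕜 := fun σ => ⟪F σ (y σ), P σ (y σ)⟫_𝕜 + ⟪y σ, P σ (F σ (y σ))⟫_𝕜 +
    ⟪y σ, riccatiDefect S R P σ (y σ)⟫_𝕜 with hf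
  have hfi : IntervalIntegrable f volume t T := by
    obtain ⟨c, hc⟩ := hy.bdd
    obtain ⟨p, hp0, hp⟩ := hP.cont.exists_norm_le t T
    obtain ⟨β, hβ0, hβ⟩ := exists_norm_le_orbit hy.cont t T
    obtain ⟨n, hn⟩ := hs.exists_norm_riccatiDefect_le hP.cont t T
    exact intervalIntegrable_of_norm_le (((hy.meas.inner (hPm.apply hym)).add
      (hym.inner (hPm.apply hy.meas))).add (hym.inner ((hs.strMeas_riccatiDefect hPm).apply hym)))
      ht.2 fun τ hτ => norm_add₃_le.trans (add_le_add (add_le_add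
        (norm_inner_apply_le (hc τ hτ) (hp τ hτ) (hβ τ hτ))
        (norm_inner_apply_le (hβ τ hτ) (hp τ hτ) (hc τ hτ)))
        (norm_inner_apply_le (hβ τ hτ) (hn τ hτ) (hβ τ hτ)))
  have hlow : ∀ τ ∈ Icc t T,
      -((q + ς) * M ^ 2 * ‖x‖ ^ 2 * Real.exp (-(2 * ρ) * (τ - t))) ≤ RCLike.re (f τ) := by
    intro τ hτ
    have hsym := fun x z => (hP.pos τ hτ).inner_left_eq_inner_right x z
    have h1 : RCLike.re (f τ) = 2 * RCLike.re ⟪F τ (y τ), P τ (y τ)⟫_𝕜 +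
        RCLike.re ⟪P τ (y τ), S τ (P τ (y τ))⟫_𝕜 - RCLike.re ⟪y τ, R τ (y τ)⟫_𝕜 := by
      simp only [hf, riccatiDefect, sub_apply,
        ContinuousLinearMap.comp_apply, inner_sub_right, map_add, map_sub, ← hsym (y τ)]
      rw [inner_re_symm (P τ (y τ)) (F τ (y τ))]
      ring
    have h2 := hq τ (y τ) (P τ (y τ))
    have h3 := re_inner_apply_le (hς τ) (y τ)
    have h4 : ‖y τ‖ ≤ M * Real.exp (-ρ * (τ - t)) * ‖x‖ := by
      rw [hyd]
      exact ((V τ t).le_opNorm x).trans (by gcongr; exact hM.le t τ ht0 hτ.1)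
    have h5 : ‖y τ‖ ^ 2 ≤ M ^ 2 * ‖x‖ ^ 2 * Real.exp (-(2 * ρ) * (τ - t)) := by
      have h6 : Real.exp (-(2 * ρ) * (τ - t)) = Real.exp (-ρ * (τ - t)) ^ 2 := by
        rw [← Real.exp_nat_mul]
        congr 1
        push_cast
        ring
      calc ‖y τ‖ ^ 2 ≤ (M * Real.exp (-ρ * (τ - t)) * ‖x‖) ^ 2 := by gcongr
        _ = _ := by rw [h6]; ring
    have h7 := mul_le_mul_of_nonneg_left h5 (add_nonneg hq0 hς0)
    rw [h1]
    linarith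
  have hci : Continuous fun τ : ℝ =>
      -((q + ς) * M ^ 2 * ‖x‖ ^ 2 * Real.exp (-(2 * ρ) * (τ - t))) := by fun_prop
  have hmono := intervalIntegral.integral_mono_on ht.2 (hci.intervalIntegrable t T)
    (⟨hfi.1.re, hfi.2.re⟩ : IntervalIntegrable (fun τ => RCLike.re (f τ)) volume t T) hlow
  rw [intervalIntegral.intervalIntegral_re hfi, ← hkey, intervalIntegral.integral_neg,
    intervalIntegral.integral_const_mul, map_neg, neg_le_neg_iff] at hmono
  have hexp := integral_exp_neg_le' (by positivity : 0 < 2 * ρ) t T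
  have h8 := mul_le_mul_of_nonneg_left hexp
    (by positivity : 0 ≤ (q + ς) * M ^ 2 * ‖x‖ ^ 2)
  have h9 : 0 ≤ ‖x‖ ^ 2 := by positivity
  linarith

/-- Energy estimate for the closed loop: by detectability and the variation of constants formula,
the state is controlled by its initial value and the running cost, the latter being the decrease of
`⟨P y, y⟩`. -/
theorem RiccatiSystem.exists_energy_estimate (hs : RiccatiSystem U S R) (hdet : IsDetectable U R) :
    ∃ m ρ c, 0 < m ∧ 0 < ρ ∧ 0 ≤ c ∧ ∀ {P a b}, 0 ≤ a → IsRiccati U S R P a b →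
      ∀ {y}, IsClosedLoop U S P y a b → ∀ {r s}, a ≤ r → r ≤ s → s ≤ b →
      ‖y s‖ ^ 2 ≤ m * Real.exp (-(2 * ρ) * (s - r)) * ‖y r‖ ^ 2 +
        c * (RCLike.re ⟪y r, P r (y r)⟫_𝕜 - RCLike.re ⟪y s, P s (y s)⟫_𝕜) := by
  obtain ⟨F, V, hF, hV, ⟨M, ρ, hM⟩, k, hk0, hk⟩ := hdet
  obtain ⟨σ, hσ⟩ := hs.S_bdd
  have hM0 := hM.pos
  have hρ := hM.rate_pos
  have hσ0 : 0 ≤ σ := (norm_nonneg _).trans (hσ 0)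
  have hSsq : ∀ t x, ‖S t x‖ ^ 2 ≤ (σ + 1) * RCLike.re ⟪x, S t x⟫_𝕜 := fun t x =>
    (hs.S_pos t).norm_apply_sq_le (by positivity)
      (fun x => re_inner_apply_le ((hσ t).trans (by linarith)) x) x
  set K := 2 * (σ + 1 + k) with hK
  have hK0 : 0 ≤ K := by positivity
  refine ⟨2 * M ^ 2, ρ, M ^ 2 / ρ * K, by positivity, hρ, by positivity, ?_⟩
  intro P a b ha hP y hy r s har hrs hsb
  set ψ : ℝ → ℝ := fun t => RCLike.re ⟪y t, P t (y t)⟫_𝕜 with hψ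
  have hr : r ∈ Icc a b := ⟨har, hrs.trans hsb⟩
  have hs' : s ∈ Icc a b := ⟨har.trans hrs, hsb⟩
  obtain ⟨hci, hcost⟩ := hs.closedLoop_cost hP.cont
    (fun t ht x z => (hP.pos t ht).inner_left_eq_inner_right x z) hP.lyap hy har hrs hsb
  have hvar := IsTrajectory.mild_perturbation hs.evol hF hV ha hy har hrs hsb
  -- As a perturbation of the detecting feedback, the closed loop has the forcing term `w`, which
  -- the running cost controls.
  obtain ⟨w, hw⟩ : ∃ w : ℝ → H, ∀ t, w t = -(S t (P t (y t))) - F t (y t) := ⟨_, fun _ => rfl⟩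
  simp only [← hw] at hvar
  have hFy := continuous_apply_of_stronglyContinuous hF hy.cont
  have hwm : StronglyMeasurable w := by
    rw [show w = fun t => -(S t (P t (y t))) - F t (y t) from funext hw]
    exact hy.meas.sub hFy.stronglyMeasurable
  obtain ⟨d, hd⟩ : ∃ d, ∀ t ∈ Icc r s, ‖w t‖ ≤ d := by
    obtain ⟨γ, hγ⟩ := hy.bdd
    obtain ⟨φ, -, hφ⟩ := exists_norm_le_orbit hFy a b
    refine ⟨γ + φ, fun t ht => ?_⟩
    have ht' : t ∈ Icc a b := ⟨har.trans ht.1, ht.2.trans hsb⟩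
    rw [hw]
    exact (norm_sub_le _ _).trans (add_le_add (hγ t ht') (hφ t ht'))
  have hwcost : ∀ t ∈ Icc r s, ‖w t‖ ^ 2 ≤ K * (RCLike.re ⟪P t (y t), S t (P t (y t))⟫_𝕜 +
      RCLike.re ⟪y t, R t (y t)⟫_𝕜) := by
    intro t _
    have h1 := hSsq t (P t (y t))
    have h2 := hk t (y t)
    have h3 := (hs.S_pos t).re_inner_nonneg_right (P t (y t))
    have h4 := (hs.R_pos t).re_inner_nonneg_right (y t)
    have h5 : ‖w t‖ ≤ ‖S t (P t (y t))‖ + ‖F t (y t)‖ := by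
      rw [hw, ← norm_neg (S t (P t (y t)))]
      exact norm_sub_le _ _
    have h6 : ‖w t‖ ^ 2 ≤ (‖S t (P t (y t))‖ + ‖F t (y t)‖) ^ 2 := by gcongr
    have h7 := sq_nonneg (‖S t (P t (y t))‖ - ‖F t (y t)‖)
    have h8 := mul_nonneg hk0 h3
    have h9 := mul_nonneg (add_nonneg hσ0 zero_le_one) h4
    rw [hK]
    nlinarith
  have hwi : IntervalIntegrable (fun t => ‖w t‖ ^ 2) volume r s := by
    refine intervalIntegrable_of_norm_le (c := d ^ 2) (hwm.norm.pow 2) hrs fun t ht => ?_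
    rw [Pi.pow_apply, norm_pow, norm_norm]
    exact pow_le_pow_left₀ (norm_nonneg _) (hd t ht) 2
  have hw2 : ∫ t in r..s, ‖w t‖ ^ 2 ≤ K * (ψ r - ψ s) := by
    rw [hcost, ← intervalIntegral.integral_const_mul]
    exact intervalIntegral.integral_mono_on hrs hwi (hci.const_mul K) hwcost
  have hec : Continuous fun t : ℝ => Real.exp (-ρ * (s - t)) := by fun_prop
  have hI : ‖∫ t in r..s, V s t (w t)‖ ≤ M * ∫ t in r..s, Real.exp (-ρ * (s - t)) * ‖w t‖ := by
    rw [← intervalIntegral.integral_const_mul]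
    refine intervalIntegral.norm_integral_le_of_norm_le hrs (.of_forall fun t ht => ?_)
      (IntervalIntegrable.const_mul (intervalIntegrable_of_norm_le (c := 1 * d)
        (hec.stronglyMeasurable.mul hwm.norm) hrs fun t ht => ?_) M)
    · rw [← mul_assoc]
      refine ((V s t).le_opNorm _).trans ?_
      gcongr
      exact hM.le t s (ha.trans (har.trans ht.1.le)) ht.2
    · rw [Pi.mul_apply, norm_mul, norm_norm, Real.norm_eq_abs, abs_of_pos (Real.exp_pos _)]
      refine mul_le_mul (Real.exp_le_one_iff.2 ?_) (hd t ht) (norm_nonneg _) zero_le_one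
      nlinarith [ht.2]
  have hCS := sq_integral_mul_le (c := 1) (d := d) hrs hec.stronglyMeasurable hwm.norm
    (fun t ht => by
      rw [Real.norm_eq_abs, abs_of_pos (Real.exp_pos _)]
      exact Real.exp_le_one_iff.2 (by nlinarith [ht.2]))
    (fun t ht => by rw [norm_norm]; exact hd t ht)
  have hsq : ∀ t : ℝ, Real.exp (-ρ * (s - t)) ^ 2 = Real.exp (-(2 * ρ) * (s - t)) := by
    intro t
    rw [← Real.exp_nat_mul]
    congr 1
    push_cast
    ring
  simp only [hsq] at hCS
  have hexp := integral_exp_neg_le (by positivity : 0 < 2 * ρ) r s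
  have hw0 : 0 ≤ ∫ t in r..s, ‖w t‖ ^ 2 :=
    intervalIntegral.integral_nonneg hrs fun _ _ => by positivity
  have hI2 : ‖∫ t in r..s, V s t (w t)‖ ^ 2 ≤ M ^ 2 * (1 / (2 * ρ) * (K * (ψ r - ψ s))) := by
    calc _ ≤ (M * ∫ t in r..s, Real.exp (-ρ * (s - t)) * ‖w t‖) ^ 2 := by gcongr
      _ = M ^ 2 * (∫ t in r..s, Real.exp (-ρ * (s - t)) * ‖w t‖) ^ 2 := by ring
      _ ≤ M ^ 2 * ((∫ t in r..s, Real.exp (-(2 * ρ) * (s - t))) * ∫ t in r..s, ‖w t‖ ^ 2) := by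
        gcongr
      _ ≤ M ^ 2 * (1 / (2 * ρ) * (K * (ψ r - ψ s))) := by
        refine mul_le_mul_of_nonneg_left ?_ (by positivity)
        exact mul_le_mul hexp hw2 hw0 (by positivity)
  have hV2 : ‖V s r (y r)‖ ^ 2 ≤ M ^ 2 * Real.exp (-(2 * ρ) * (s - r)) * ‖y r‖ ^ 2 := by
    calc _ ≤ (M * Real.exp (-ρ * (s - r)) * ‖y r‖) ^ 2 := by
          gcongr
          exact ((V s r).le_opNorm _).trans (by gcongr; exact hM.le r s (ha.trans har) hrs)
      _ = _ := by rw [mul_pow, mul_pow, hsq]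
  have h1 : ‖y s‖ ≤ ‖V s r (y r)‖ + ‖∫ t in r..s, V s t (w t)‖ := by
    rw [hvar]
    exact norm_add_le _ _
  have h2 : ‖y s‖ ^ 2 ≤ (‖V s r (y r)‖ + ‖∫ t in r..s, V s t (w t)‖) ^ 2 := by gcongr
  have h3 := sq_nonneg (‖V s r (y r)‖ - ‖∫ t in r..s, V s t (w t)‖)
  have h4 : M ^ 2 / ρ * K * (ψ r - ψ s) = 2 * (M ^ 2 * (1 / (2 * ρ) * (K * (ψ r - ψ s)))) := by
    field_simp
  change _ ≤ _ + M ^ 2 / ρ * K * (ψ r - ψ s)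
  rw [h4]
  linarith

/-- Detectability makes the closed loop exponentially stable, with constants that depend on the
solution only through a bound for it. With `ψ = ⟨P y, y⟩`, the detecting feedback yields
`‖y(s)‖² ≤ m e^{-2ρ(s-r)} ‖y(r)‖² + c (ψ(r) - ψ(s))`, so that `‖y‖² + c ψ` is a Lyapunov
function. -/
theorem RiccatiSystem.exists_closedLoop_decay (hs : RiccatiSystem U S R) (hdet : IsDetectable U R)
    {p : ℝ} (hp : 0 ≤ p) :
    ∃ M μ, 0 < M ∧ 0 < μ ∧ ∀ {P a b}, 0 ≤ a → IsRiccati U S R P a b →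
      (∀ t ∈ Icc a b, ‖P t‖ ≤ p) → ∀ {y}, IsClosedLoop U S P y a b →
      ∀ {r s}, a ≤ r → r ≤ s → s ≤ b → ‖y s‖ ≤ M * Real.exp (-μ * (s - r)) * ‖y r‖ := by
  obtain ⟨m, ρ, c, hm0, hρ, hc0, henergy⟩ := hs.exists_energy_estimate hdet
  -- After time `L` the exponential term of the energy estimate is at most `‖y r‖ ^ 2 / 2`.
  set L := Real.log (2 * m + 2) / (2 * ρ) with hL
  have hL0 : 0 < L := div_pos (Real.log_pos (by linarith)) (by positivity)
  have hmL : m * Real.exp (-(2 * ρ) * L) ≤ 1 / 2 := by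
    have h1 : -(2 * ρ) * L = -Real.log (2 * m + 2) := by
      rw [hL]
      field_simp
    rw [h1, Real.exp_neg, Real.exp_log (by positivity), ← div_eq_mul_inv,
      div_le_div_iff₀ (by positivity) (by positivity)]
    linarith
  set κ := 1 - 1 / 2 / (1 + c * p) with hκ
  have hcp : 0 ≤ c * p := by positivity
  have hfrac : 1 / 2 / (1 + c * p) ≤ 1 / 2 := div_le_self (by norm_num) (by linarith)
  have hfrac0 : 0 < 1 / 2 / (1 + c * p) := by positivity
  have hκ0 : 0 < κ := by linarith
  have hκ1 : κ < 1 := by linarith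
  set m' := max m 1 with hm'
  have hm'0 : 0 < m' := lt_max_of_lt_left hm0
  set ν := -Real.log κ / L with hν
  have hν0 : 0 < ν := div_pos (neg_pos.2 (Real.log_neg hκ0 hκ1)) hL0
  refine ⟨Real.sqrt (m' / κ * (1 + c * p)), ν / 2, by positivity, by positivity, ?_⟩
  intro P a b ha hP hPp y hy r s har hrs hsb
  set ψ : ℝ → ℝ := fun t => RCLike.re ⟪y t, P t (y t)⟫_𝕜 with hψ
  have hψ0 : ∀ t ∈ Icc a b, 0 ≤ ψ t := fun t ht => (hP.pos t ht).re_inner_nonneg_right _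
  have hψp : ∀ t ∈ Icc a b, ψ t ≤ p * ‖y t‖ ^ 2 := fun t ht => re_inner_apply_le (hPp t ht) _
  have hmain : ∀ r s, a ≤ r → r ≤ s → s ≤ b →
      ‖y s‖ ^ 2 ≤ m * Real.exp (-(2 * ρ) * (s - r)) * ‖y r‖ ^ 2 + c * (ψ r - ψ s) :=
    fun r s har hrs hsb => henergy ha hP hy har hrs hsb
  set Φ : ℝ → ℝ := fun t => ‖y t‖ ^ 2 + c * ψ t with hΦ
  have hΦ0 : ∀ t ∈ Icc a b, 0 ≤ Φ t := fun t ht =>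
    add_nonneg (by positivity) (mul_nonneg hc0 (hψ0 t ht))
  have hΦy : ∀ t ∈ Icc a b, Φ t ≤ (1 + c * p) * ‖y t‖ ^ 2 := fun t ht => by
    have := mul_le_mul_of_nonneg_left (hψp t ht) hc0
    simp only [hΦ]
    linarith
  have hr : r ∈ Icc a b := ⟨har, hrs.trans hsb⟩
  have hs' : s ∈ Icc a b := ⟨har.trans hrs, hsb⟩
  have hΦ₁ : ∀ r s, a ≤ r → r ≤ s → s ≤ b → Φ s ≤ m' * Φ r := by
    intro r s har hrs hsb
    have h1 := hmain r s har hrs hsb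
    have h2 : Real.exp (-(2 * ρ) * (s - r)) ≤ 1 :=
      Real.exp_le_one_iff.2 (by nlinarith)
    have h3 : m * Real.exp (-(2 * ρ) * (s - r)) * ‖y r‖ ^ 2 ≤ m' * ‖y r‖ ^ 2 := by
      gcongr
      exact (mul_le_of_le_one_right hm0.le h2).trans (le_max_left _ _)
    have h4 : c * ψ r ≤ m' * (c * ψ r) :=
      le_mul_of_one_le_left (mul_nonneg hc0 (hψ0 r ⟨har, hrs.trans hsb⟩)) (le_max_right _ _)
    simp only [hΦ]
    linarith
  have hΦ₂ : ∀ r, a ≤ r → r + L ≤ b → Φ (r + L) ≤ κ * Φ r := by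
    intro r har hrb
    have hr' : r ∈ Icc a b := ⟨har, by linarith⟩
    have h1 := hmain r (r + L) har (by linarith) hrb
    rw [add_sub_cancel_left] at h1
    have h2 : m * Real.exp (-(2 * ρ) * L) * ‖y r‖ ^ 2 ≤ 1 / 2 * ‖y r‖ ^ 2 := by gcongr
    have h3 : 1 / 2 / (1 + c * p) * Φ r ≤ 1 / 2 * ‖y r‖ ^ 2 := by
      rw [div_mul_eq_mul_div, div_le_iff₀ (by positivity)]
      linarith [hΦy r hr']
    simp only [hΦ] at h3 ⊢
    rw [hκ]
    linarith
  have hdecay := le_mul_exp_of_step hm'0.le hκ0 hκ1.le hL0 hΦ0 hΦ₁ hΦ₂ har hrs hsb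
  rw [← hν] at hdecay
  have h1 : ‖y s‖ ^ 2 ≤ Φ s := le_add_of_nonneg_right (mul_nonneg hc0 (hψ0 s hs'))
  have h2 := hΦy r hr
  refine abs_le_of_sq_le_sq' ?_ (by positivity) |>.2
  have h3 : Real.exp (-(ν / 2) * (s - r)) ^ 2 = Real.exp (-ν * (s - r)) := by
    rw [← Real.exp_nat_mul]
    congr 1
    push_cast
    ring
  rw [mul_pow, mul_pow, Real.sq_sqrt (by positivity), h3]
  calc ‖y s‖ ^ 2 ≤ m' / κ * Real.exp (-ν * (s - r)) * Φ r := h1.trans hdecay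
    _ ≤ m' / κ * Real.exp (-ν * (s - r)) * ((1 + c * p) * ‖y r‖ ^ 2) := by gcongr
    _ = _ := by ring

/-- The difference of two Riccati solutions is transported by their closed loops. -/
theorem RiccatiSystem.inner_sub_eq (hs : RiccatiSystem U S R) {P₁ P₂ : ℝ → H →L[𝕜] H}
    (h₁ : IsRiccati U S R P₁ a b) (h₂ : IsRiccati U S R P₂ a b) (hab : a ≤ b) {y₁ y₂ : ℝ → H}
    (hy₁ : IsClosedLoop U S P₁ y₁ a b) (hy₂ : IsClosedLoop U S P₂ y₂ a b) :
    ⟪y₁ a, (P₁ a - P₂ a) (y₂ a)⟫_𝕜 = ⟪y₁ b, (P₁ b - P₂ b) (y₂ b)⟫_𝕜 := by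
  have hc : StronglyContinuous fun t => P₁ t - P₂ t := fun x => (h₁.cont x).sub (h₂.cont x)
  have hm₁ := hs.strMeas_riccatiDefect h₁.cont.strMeas
  have hm₂ := hs.strMeas_riccatiDefect h₂.cont.strMeas
  obtain ⟨n₁, hn₁⟩ := hs.exists_norm_riccatiDefect_le h₁.cont a b
  obtain ⟨n₂, hn₂⟩ := hs.exists_norm_riccatiDefect_le h₂.cont a b
  have hL : IsLyapunov U (fun t => P₁ t - P₂ t)
      (fun t => riccatiDefect S R P₁ t - riccatiDefect S R P₂ t) a b := by
    intro r s har hrs hsb x z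
    simp only [sub_apply, inner_sub_right]
    rw [h₁.lyap r s har hrs hsb, h₂.lyap r s har hrs hsb, intervalIntegral.integral_sub
      (intervalIntegrable_inner_lyapunov hs.evol hm₁ ⟨n₁, hn₁⟩ har (hrs.trans hsb) har hrs hsb x z)
      (intervalIntegrable_inner_lyapunov hs.evol hm₂ ⟨n₂, hn₂⟩ har (hrs.trans hsb) har hrs hsb x z)]
    ring
  have hkey := hL.inner_sub_inner hs.evol hab hc (hm₁.sub hm₂)
    ⟨n₁ + n₂, fun t ht => (norm_sub_le _ _).trans (add_le_add (hn₁ t ht) (hn₂ t ht))⟩ hy₁ hy₂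
  refine (sub_eq_zero.1 (hkey.trans ?_)).symm
  rw [← intervalIntegral.integral_zero (a := a) (b := b) (μ := volume) (E := 𝕜)]
  refine intervalIntegral.integral_congr fun t ht => ?_
  rw [uIcc_of_le hab] at ht
  have s₁ := fun x z => (h₁.pos t ht).inner_left_eq_inner_right x z
  have s₂ := fun x z => (h₂.pos t ht).inner_left_eq_inner_right x z
  have s₃ := fun x z => (hs.S_pos t).inner_left_eq_inner_right x z
  simp only [riccatiDefect, sub_apply, ContinuousLinearMap.comp_apply,
    map_neg, inner_neg_left, inner_neg_right, inner_sub_right, ← s₁, ← s₂, ← s₃]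
  ring

/-- Two Riccati solutions approach each other exponentially, backwards in time. -/
theorem RiccatiSystem.exists_norm_sub_le (hs : RiccatiSystem U S R) (hdet : IsDetectable U R)
    {p : ℝ} (hp : 0 ≤ p) :
    ∃ M μ, 0 < M ∧ 0 < μ ∧ ∀ {P₁ P₂ a b}, 0 ≤ a → a ≤ b →
      IsRiccati U S R P₁ a b → (∀ t ∈ Icc a b, ‖P₁ t‖ ≤ p) →
      IsRiccati U S R P₂ a b → (∀ t ∈ Icc a b, ‖P₂ t‖ ≤ p) →
      ‖P₁ a - P₂ a‖ ≤ M * Real.exp (-μ * (b - a)) * ‖P₁ b - P₂ b‖ := by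
  obtain ⟨M, μ, hM, hμ, hdecay⟩ := hs.exists_closedLoop_decay hdet hp
  refine ⟨M ^ 2, 2 * μ, by positivity, by positivity, ?_⟩
  intro P₁ P₂ a b ha hab h₁ hp₁ h₂ hp₂
  refine ContinuousLinearMap.opNorm_le_of_inner_le (𝕜 := 𝕜) (by positivity) fun x z => ?_
  obtain ⟨y₁, hy₁, hx⟩ := hs.exists_isClosedLoop h₁.cont hab x
  obtain ⟨y₂, hy₂, hz⟩ := hs.exists_isClosedLoop h₂.cont hab z
  have hd₁ := hdecay ha h₁ hp₁ hy₁ le_rfl hab le_rfl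
  have hd₂ := hdecay ha h₂ hp₂ hy₂ le_rfl hab le_rfl
  have heq := hs.inner_sub_eq h₁ h₂ hab hy₁ hy₂
  rw [hx] at hd₁
  rw [hz] at hd₂
  rw [hx, hz] at heq
  rw [heq]
  refine (norm_inner_apply_le hd₁ le_rfl hd₂).trans (le_of_eq ?_)
  have h3 : Real.exp (-(2 * μ) * (b - a)) = Real.exp (-μ * (b - a)) ^ 2 := by
    rw [← Real.exp_nat_mul]
    congr 1
    push_cast
    ring
  rw [h3]
  ring

/-- A Riccati solution is determined by its final value. -/
theorem RiccatiSystem.eqOn_of_eq_final (hs : RiccatiSystem U S R) (hdet : IsDetectable U R)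
    {P₁ P₂ : ℝ → H →L[𝕜] H} (ha : 0 ≤ a) (h₁ : IsRiccati U S R P₁ a b)
    (h₂ : IsRiccati U S R P₂ a b) (h : P₁ b = P₂ b) : EqOn P₁ P₂ (Icc a b) := by
  intro t ht
  obtain ⟨p₁, hp₁0, hp₁⟩ := h₁.cont.exists_norm_le a b
  obtain ⟨p₂, hp₂0, hp₂⟩ := h₂.cont.exists_norm_le a b
  obtain ⟨M, μ, -, -, hle⟩ := hs.exists_norm_sub_le hdet (add_nonneg hp₁0 hp₂0)
  have h3 := hle (ha.trans ht.1) ht.2 (h₁.mono ht.1 le_rfl)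
    (fun s hs' => (hp₁ s ⟨ht.1.trans hs'.1, hs'.2⟩).trans (by linarith)) (h₂.mono ht.1 le_rfl)
    (fun s hs' => (hp₂ s ⟨ht.1.trans hs'.1, hs'.2⟩).trans (by linarith))
  rw [h, sub_self, norm_zero, mul_zero] at h3
  exact sub_eq_zero.1 (norm_le_zero_iff.1 h3)

end Riccati

/-! ### Existence of solutions of the Riccati equation -/

section Existence

open scoped BoundedContinuousFunction

variable {𝕜 : Type*} [RCLike 𝕜]
variable {H : Type*} [NormedAddCommGroup H] [InnerProductSpace 𝕜 H]

theorem IsLyapunov.congr {U : ℝ → ℝ → H →L[𝕜] H} {W N W' N' : ℝ → H →L[𝕜] H} {a b : ℝ}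
    (h : IsLyapunov U W N a b) (hW : EqOn W W' (Icc a b)) (hN : EqOn N N' (Icc a b)) :
    IsLyapunov U W' N' a b := by
  intro r s har hrs hsb x z
  rw [← hW ⟨har, hrs.trans hsb⟩, ← hW ⟨har.trans hrs, hsb⟩, h r s har hrs hsb]
  congr 1
  refine intervalIntegral.integral_congr fun σ hσ => ?_
  rw [uIcc_of_le hrs] at hσ
  simp only [hN ⟨har.trans hσ.1, hσ.2.trans hsb⟩]

theorem norm_riccatiDefect_sub_le {S R P P' : ℝ → H →L[𝕜] H} {t σ p d : ℝ} (hS : ‖S t‖ ≤ σ)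
    (hP : ‖P t‖ ≤ p) (hP' : ‖P' t‖ ≤ p) (hd : ‖P t - P' t‖ ≤ d) :
    ‖riccatiDefect S R P t - riccatiDefect S R P' t‖ ≤ 2 * (p * σ) * d := by
  have h0 : riccatiDefect S R P t - riccatiDefect S R P' t =
      P t * (S t * (P t - P' t)) + (P t - P' t) * (S t * P' t) := by
    simp only [riccatiDefect]
    change P t * (S t * P t) - R t - (P' t * (S t * P' t) - R t) = _
    noncomm_ring
  have hp0 := (norm_nonneg _).trans hP
  have hσ0 := (norm_nonneg _).trans hS
  have hd0 := (norm_nonneg _).trans hd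
  rw [h0]
  calc _ ≤ ‖P t‖ * (‖S t‖ * ‖P t - P' t‖) + ‖P t - P' t‖ * (‖S t‖ * ‖P' t‖) :=
        (norm_add_le _ _).trans (add_le_add
          ((norm_mul_le _ _).trans (by gcongr; exact norm_mul_le _ _))
          ((norm_mul_le _ _).trans (by gcongr; exact norm_mul_le _ _)))
    _ ≤ p * (σ * d) + d * (σ * p) := by gcongr
    _ = _ := by ring

variable [CompleteSpace H]

theorem norm_adjoint_apply_le {V T : H →L[𝕜] H} {u n : ℝ} (hV : ‖V‖ ≤ u) (hT : ‖T‖ ≤ n) (h : H) :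
    ‖adjoint V (T (V h))‖ ≤ u * n * u * ‖h‖ := by
  have hu0 := (norm_nonneg _).trans hV
  have hn0 := (norm_nonneg _).trans hT
  calc ‖adjoint V (T (V h))‖ ≤ ‖adjoint V‖ * (‖T‖ * (‖V‖ * ‖h‖)) :=
        ((adjoint V).le_opNorm _).trans (by
          gcongr
          exact (T.le_opNorm _).trans (by gcongr; exact V.le_opNorm _))
    _ ≤ u * (n * (u * ‖h‖)) := by
        rw [LinearIsometryEquiv.norm_map]
        gcongr
    _ = _ := by ring

theorem intervalIntegrable_lyapunov {U : ℝ → ℝ → H →L[𝕜] H} {a b : ℝ}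
    (hU : EvolutionFamily U) {N : ℝ → H →L[𝕜] H} (hN : StrMeas N)
    (hNb : ∃ c, ∀ s ∈ Icc a b, ‖N s‖ ≤ c) {t : ℝ} (ht : t ∈ Icc a b) (h : H) :
    IntervalIntegrable (fun s => adjoint (U s t) (N s (U s t h))) volume t b := by
  obtain ⟨n, hn⟩ := hNb
  obtain ⟨u, hu0, hu⟩ := exists_norm_le_square hU.cont a b
  have hUs := stronglyContinuous_left hU.cont t
  refine intervalIntegrable_of_norm_le (c := u * (n * (u * ‖h‖)))
    (hUs.adjoint_strMeas.apply (hN.apply (hUs.strMeas h))) ht.2 fun τ hτ => ?_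
  have hτ' : τ ∈ Icc a b := ⟨ht.1.trans hτ.1, hτ.2⟩
  have hn0 := (norm_nonneg _).trans (hn τ hτ')
  refine ((adjoint (U τ t)).le_opNorm _).trans (mul_le_mul ?_ ?_ (norm_nonneg _) hu0)
  · rw [LinearIsometryEquiv.norm_map]
    exact hu τ hτ' t ht
  · refine ((N τ).le_opNorm _).trans (mul_le_mul (hn τ hτ') ?_ (norm_nonneg _) hn0)
    exact ((U τ t).le_opNorm _).trans
      (mul_le_mul_of_nonneg_right (hu τ hτ' t ht) (norm_nonneg _))

/-- It suffices to know the mild Lyapunov equation relative to the final time `b`. -/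
theorem IsLyapunov.of_final {U : ℝ → ℝ → H →L[𝕜] H} {W N : ℝ → H →L[𝕜] H} {a b : ℝ}
    (hU : EvolutionFamily U) (hN : StrMeas N) (hNb : ∃ c, ∀ s ∈ Icc a b, ‖N s‖ ≤ c)
    (h : ∀ t ∈ Icc a b, ∀ x z, ⟪x, W t z⟫_𝕜 = ⟪U b t x, W b (U b t z)⟫_𝕜 -
      ∫ σ in t..b, ⟪U σ t x, N σ (U σ t z)⟫_𝕜) : IsLyapunov U W N a b := by
  intro r s har hrs hsb x z
  have hr : r ∈ Icc a b := ⟨har, hrs.trans hsb⟩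
  rw [h r hr, h s ⟨har.trans hrs, hsb⟩, hU.comp r s b hrs hsb, hU.comp r s b hrs hsb,
    ← intervalIntegral.integral_add_adjacent_intervals
      (intervalIntegrable_inner_lyapunov hU hN hNb har hr.2 har hrs hsb x z)
      (intervalIntegrable_inner_lyapunov hU hN hNb har hr.2 (har.trans hrs) hsb le_rfl x z)]
  have : ∫ σ in s..b, ⟪U σ s (U s r x), N σ (U σ s (U s r z))⟫_𝕜 =
      ∫ σ in s..b, ⟪U σ r x, N σ (U σ r z)⟫_𝕜 := by
    refine intervalIntegral.integral_congr fun σ hσ => ?_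
    rw [uIcc_of_le hsb] at hσ
    simp only [hU.comp r s σ hrs hσ.1]
  rw [this]
  ring

theorem IsLyapunov.trans {U : ℝ → ℝ → H →L[𝕜] H} {W N : ℝ → H →L[𝕜] H} {a b c : ℝ}
    (hU : EvolutionFamily U) (hac : a ≤ c) (hcb : c ≤ b)
    (hN : StrMeas N) (hNb : ∃ c, ∀ s ∈ Icc a b, ‖N s‖ ≤ c)
    (h₁ : IsLyapunov U W N a c) (h₂ : IsLyapunov U W N c b) : IsLyapunov U W N a b := by
  refine .of_final hU hN hNb fun t ht x z => ?_
  rcases le_total c t with hct | htc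
  · exact h₂ t b hct ht.2 le_rfl x z
  rw [h₁ t c ht.1 htc le_rfl, h₂ c b le_rfl hcb le_rfl, hU.comp t c b htc hcb,
    hU.comp t c b htc hcb, ← intervalIntegral.integral_add_adjacent_intervals
      (intervalIntegrable_inner_lyapunov hU hN hNb ht.1 ht.2 ht.1 htc hcb x z)
      (intervalIntegrable_inner_lyapunov hU hN hNb ht.1 ht.2 hac hcb le_rfl x z)]
  have : ∫ σ in c..b, ⟪U σ c (U c t x), N σ (U σ c (U c t z))⟫_𝕜 =
      ∫ σ in c..b, ⟪U σ t x, N σ (U σ t z)⟫_𝕜 := by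
    refine intervalIntegral.integral_congr fun σ hσ => ?_
    rw [uIcc_of_le hcb] at hσ
    simp only [hU.comp t c σ htc hσ.1]
  rw [this]
  ring

variable [NormedSpace ℝ H]
variable {U : ℝ → ℝ → H →L[𝕜] H} {S R P : ℝ → H →L[𝕜] H} {a b : ℝ}

/-- The right-hand side of the mild Lyapunov equation with final value `G` at time `b`. -/
noncomputable def lyapunovMap (U : ℝ → ℝ → H →L[𝕜] H) (N : ℝ → H →L[𝕜] H) (G : H →L[𝕜] H)
    (b t : ℝ) (h : H) : H :=
  adjoint (U b t) (G (U b t h)) - ∫ s in t..b, adjoint (U s t) (N s (U s t h))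

theorem inner_lyapunovMap (hU : EvolutionFamily U) {N : ℝ → H →L[𝕜] H} (hN : StrMeas N)
    (hNb : ∃ c, ∀ s ∈ Icc a b, ‖N s‖ ≤ c) (G : H →L[𝕜] H) {t : ℝ} (ht : t ∈ Icc a b) (x z : H) :
    ⟪x, lyapunovMap U N G b t z⟫_𝕜 = ⟪U b t x, G (U b t z)⟫_𝕜 -
      ∫ σ in t..b, ⟪U σ t x, N σ (U σ t z)⟫_𝕜 := by
  rw [lyapunovMap, inner_sub_right, ContinuousLinearMap.adjoint_inner_right,
    inner_intervalIntegral_right (intervalIntegrable_lyapunov hU hN hNb ht z)]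
  simp only [ContinuousLinearMap.adjoint_inner_right]

theorem norm_lyapunovMap_le {N : ℝ → H →L[𝕜] H} {G : H →L[𝕜] H} {u g n t : ℝ}
    (hu : ∀ t ∈ Icc a b, ∀ s ∈ Icc a b, ‖U t s‖ ≤ u) (hn : ∀ s ∈ Icc a b, ‖N s‖ ≤ n)
    (hG : ‖G‖ ≤ g) (ht : t ∈ Icc a b) (h : H) :
    ‖lyapunovMap U N G b t h‖ ≤ (u * g * u + (b - a) * (u * n * u)) * ‖h‖ := by
  have hb : b ∈ Icc a b := ⟨ht.1.trans ht.2, le_rfl⟩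
  have hn0 := (norm_nonneg _).trans (hn t ht)
  have hu0 := (norm_nonneg _).trans (hu t ht t ht)
  have h1 := norm_adjoint_apply_le (hu b hb t ht) hG h
  have h2 := norm_integral_le_of_norm_le_Icc
    (f := fun s => adjoint (U s t) (N s (U s t h))) ht.2 fun s hs =>
      norm_adjoint_apply_le (hu s ⟨ht.1.trans hs.1, hs.2⟩ t ht) (hn s ⟨ht.1.trans hs.1, hs.2⟩) h
  have h3 : u * n * u * ‖h‖ * (b - t) ≤ u * n * u * ‖h‖ * (b - a) := by
    have := ht.1
    gcongr
  refine (norm_sub_le _ _).trans ?_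
  linarith

/-- The map `N ↦ lyapunovMap U N G b` yields strongly continuous operators. The space
`H →L[𝕜] (ℝ →ᵇ H)` is that of bounded strongly continuous functions `ℝ → H →L[𝕜] H` with the
supremum norm; `t` is clamped to `[a, b]`. Continuity in `t` uses strong continuity of the
adjoint evolution family. -/
theorem exists_lyapunovMap_eq (hU : EvolutionFamily U)
    (hadj : ∀ x, Continuous fun p : ℝ × ℝ => adjoint (U p.1 p.2) x) (hab : a ≤ b)
    {N : ℝ → H →L[𝕜] H} (hN : StrMeas N) (hNb : ∃ c, ∀ s, ‖N s‖ ≤ c) (G : H →L[𝕜] H) :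
    ∃ Y : H →L[𝕜] (ℝ →ᵇ H), ∀ h t, Y h t = lyapunovMap U N G b (max a (min t b)) h := by
  obtain ⟨n, hn⟩ := hNb
  obtain ⟨u, hu0, hu⟩ := exists_norm_le_square hU.cont a b
  have hNb' : ∃ c, ∀ s ∈ Icc a b, ‖N s‖ ≤ c := ⟨n, fun s _ => hn s⟩
  have hπ : ∀ t, max a (min t b) ∈ Icc a b :=
    fun t => ⟨le_max_left _ _, max_le hab (min_le_right _ _)⟩
  have hπc : Continuous fun t : ℝ => max a (min t b) :=
    continuous_const.max (continuous_id.min continuous_const)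
  have hcont : ∀ h, Continuous fun t => lyapunovMap U N G b t h := by
    intro h
    have h1 : Continuous fun t => adjoint (U b t) (G (U b t h)) :=
      continuous_apply_of_stronglyContinuous
        (stronglyContinuous_right (U := fun t s => adjoint (U t s)) hadj b)
        (G.continuous.comp (stronglyContinuous_right hU.cont b h))
    have h2 : Continuous fun p : ℝ × ℝ =>
        ∫ s in b..p.2, adjoint (U s p.1) (N s (U s p.1 h)) := by
      refine continuous_parametric_primitive
        (F := fun t s => adjoint (U s t) (N s (U s t h))) b (fun t => ?_) (fun s => ?_) fun l => ?_
      · exact (stronglyContinuous_left (U := fun t s => adjoint (U t s)) hadj t).strMeas.apply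
          (hN.apply ((stronglyContinuous_left hU.cont t).strMeas h))
      · exact continuous_apply_of_stronglyContinuous
          (stronglyContinuous_right (U := fun t s => adjoint (U t s)) hadj s)
          ((N s).continuous.comp (stronglyContinuous_right hU.cont s h))
      · obtain ⟨v, hv0, hv⟩ := exists_norm_le_square hU.cont (-l) l
        exact ⟨_, fun t ht s hs => norm_adjoint_apply_le (hv s hs t ht) (hn s) h⟩
    have h3 : Continuous fun t => ∫ s in b..t, adjoint (U s t) (N s (U s t h)) :=
      h2.comp (continuous_id.prodMk continuous_id)
    have h4 : (fun t => lyapunovMap U N G b t h) = fun t =>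
        adjoint (U b t) (G (U b t h)) + ∫ s in b..t, adjoint (U s t) (N s (U s t h)) := by
      ext t
      rw [lyapunovMap, intervalIntegral.integral_symm b t, sub_neg_eq_add]
    rw [h4]
    exact h1.add h3
  have hint := fun t h => intervalIntegrable_lyapunov hU hN hNb' (hπ t) h
  set κ : ℝ := u * ‖G‖ * u + (b - a) * (u * n * u) with hκ
  have hle : ∀ h t, ‖lyapunovMap U N G b (max a (min t b)) h‖ ≤ κ * ‖h‖ := fun h t =>
    norm_lyapunovMap_le hu (fun s _ => hn s) le_rfl (hπ t) h
  have hn0 : 0 ≤ n := (norm_nonneg _).trans (hn 0)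
  have hκ0 : 0 ≤ κ := by
    have := sub_nonneg.2 hab
    positivity
  let Y : H →ₗ[𝕜] (ℝ →ᵇ H) :=
    { toFun := fun h => BoundedContinuousFunction.ofNormedAddCommGroup
        (fun t => lyapunovMap U N G b (max a (min t b)) h) ((hcont h).comp hπc) _ (hle h)
      map_add' := by
        intro x z
        ext t
        change lyapunovMap U N G b _ (x + z) = lyapunovMap U N G b _ x + lyapunovMap U N G b _ z
        simp only [lyapunovMap, map_add]
        rw [intervalIntegral.integral_add (hint t x) (hint t z)]
        abel
      map_smul' := by
        intro c x
        ext t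
        change lyapunovMap U N G b _ (c • x) = c • lyapunovMap U N G b _ x
        simp only [lyapunovMap, map_smul, smul_sub]
        congr 1
        exact (c • ContinuousLinearMap.id 𝕜 H).intervalIntegral_comp_comm (hint t x) }
  refine ⟨Y.mkContinuous κ fun h => ?_, fun h t => rfl⟩
  refine (BoundedContinuousFunction.norm_le (by positivity)).2 fun t => hle h t

/-- A symmetric solution with nonnegative final value is nonnegative, by the cost identity. -/
theorem RiccatiSystem.isRiccati_of_symmetric (hs : RiccatiSystem U S R)
    (hP : StronglyContinuous P)
    (hsym : ∀ t ∈ Icc a b, ∀ x z, ⟪P t x, z⟫_𝕜 = ⟪x, P t z⟫_𝕜)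
    (hL : IsLyapunov U P (riccatiDefect S R P) a b) (hb : (P b).IsPositive) :
    IsRiccati U S R P a b := by
  refine ⟨hP, fun t ht => ?_, hL⟩
  rw [ContinuousLinearMap.isPositive_def]
  refine ⟨fun x z => hsym t ht x z, fun x => ?_⟩
  obtain ⟨y, hy, hx⟩ := hs.exists_isClosedLoop hP ht.2 x
  obtain ⟨-, hcost⟩ := hs.closedLoop_cost hP (fun s hs' => hsym s ⟨ht.1.trans hs'.1, hs'.2⟩)
    (hL.mono ht.1 le_rfl) hy le_rfl ht.2 le_rfl
  have h1 : 0 ≤ ∫ σ in t..b, (RCLike.re ⟪P σ (y σ), S σ (P σ (y σ))⟫_𝕜 +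
      RCLike.re ⟪y σ, R σ (y σ)⟫_𝕜) :=
    intervalIntegral.integral_nonneg ht.2 fun σ _ => add_nonneg
      ((hs.S_pos σ).re_inner_nonneg_right _) ((hs.R_pos σ).re_inner_nonneg_right _)
  have h2 := hb.re_inner_nonneg_right (y b)
  rw [hx] at hcost
  rw [ContinuousLinearMap.reApplyInnerSelf_apply, hsym t ht]
  linarith

/-- Local solvability, on intervals whose length depends only on a bound for the final value. -/
theorem RiccatiSystem.exists_local (hs : RiccatiSystem U S R)
    (hadj : ∀ x, Continuous fun p : ℝ × ℝ => adjoint (U p.1 p.2) x) (T : ℝ) {p : ℝ} (hp : 0 ≤ p) :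
    ∃ δ, 0 < δ ∧ ∀ {a b}, 0 ≤ a → a ≤ b → b ≤ T → b - a ≤ δ → ∀ {G : H →L[𝕜] H},
      G.IsPositive → ‖G‖ ≤ p → ∃ P, IsRiccati U S R P a b ∧ P b = G := by
  obtain ⟨σ, hσ⟩ := hs.S_bdd
  obtain ⟨ς, hς⟩ := hs.R_bdd
  have hσ0 : 0 ≤ σ := (norm_nonneg _).trans (hσ 0)
  have hς0 : 0 ≤ ς := (norm_nonneg _).trans (hς 0)
  obtain ⟨u, hu0, hu⟩ := exists_norm_le_square hs.evol.cont 0 T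
  -- `ρ` is the radius of the ball on which the fixed point map acts, `n` bounds `P S P - R` there,
  -- and intervals of length `1 / e` make the map a contraction of this ball into itself.
  set ρ := u * p * u + 1 with hρ
  have hρ0 : 0 < ρ := by positivity
  set n := ρ * (σ * ρ) + ς with hn
  have hn0 : 0 ≤ n := by positivity
  set e := u * n * u + 4 * (u * (ρ * σ) * u) + 1 with he
  have he0 : 0 < e := by positivity
  refine ⟨1 / e, by positivity, ?_⟩
  intro a b ha hab hbT hδ G hG hGp
  replace hu : ∀ t ∈ Icc a b, ∀ s ∈ Icc a b, ‖U t s‖ ≤ u := fun t ht s hs =>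
    hu t ⟨ha.trans ht.1, ht.2.trans hbT⟩ s ⟨ha.trans hs.1, hs.2.trans hbT⟩
  have hδe : (b - a) * e ≤ 1 := by rwa [le_div_iff₀ he0] at hδ
  have hba := sub_nonneg.2 hab
  have hbI : b ∈ Icc a b := ⟨hab, le_rfl⟩
  have hπ : ∀ t, max a (min t b) ∈ Icc a b :=
    fun t => ⟨le_max_left _ _, max_le hab (min_le_right _ _)⟩
  have hπid : ∀ t ∈ Icc a b, max a (min t b) = t := fun t ht => by
    rw [min_eq_left ht.2, max_eq_right ht.1]
  -- the operator-valued function represented by `X`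
  set ev : (H →L[𝕜] (ℝ →ᵇ H)) → ℝ → H →L[𝕜] H :=
    fun X t => (BoundedContinuousFunction.evalCLM 𝕜 t) ∘L X with hev
  have hevapp : ∀ X t h, ev X t h = X h t := fun X t h => rfl
  have hevc : ∀ X, StronglyContinuous (ev X) := fun X h => (X h).continuous
  have hevn : ∀ X t, ‖ev X t‖ ≤ ‖X‖ := fun X t =>
    (ev X t).opNorm_le_bound (norm_nonneg _) fun h =>
      ((X h).norm_coe_le_norm t).trans (X.le_opNorm h)
  have hDm : ∀ X, StrMeas (riccatiDefect S R (ev X)) := fun X =>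
    hs.strMeas_riccatiDefect (hevc X).strMeas
  have hDn : ∀ X t, ‖riccatiDefect S R (ev X) t‖ ≤ ‖X‖ * (σ * ‖X‖) + ς := fun X t =>
    norm_riccatiDefect_le (hσ t) (hς t) (hevn X t)
  have hDn' : ∀ X, ∃ c, ∀ t, ‖riccatiDefect S R (ev X) t‖ ≤ c := fun X => ⟨_, hDn X⟩
  have hDn'' : ∀ X, ∃ c, ∀ t ∈ Icc a b, ‖riccatiDefect S R (ev X) t‖ ≤ c :=
    fun X => ⟨_, fun t _ => hDn X t⟩
  choose Φ hΦ using fun X => exists_lyapunovMap_eq hs.evol hadj hab (hDm X) (hDn' X) G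
  -- Symmetry is part of the closed condition, while positivity is recovered for the fixed point.
  set B : Set (H →L[𝕜] (ℝ →ᵇ H)) :=
    {X | ‖X‖ ≤ ρ ∧ ∀ t x z, ⟪X x t, z⟫_𝕜 = ⟪x, X z t⟫_𝕜} with hB
  have hBclosed : IsClosed B := by
    have : B = {X | ‖X‖ ≤ ρ} ∩ ⋂ (t) (x) (z), {X | ⟪X x t, z⟫_𝕜 = ⟪x, X z t⟫_𝕜} := by
      ext X
      simp [hB]
    rw [this]
    refine (isClosed_le continuous_norm continuous_const).inter ?_
    refine isClosed_iInter fun t => isClosed_iInter fun x => isClosed_iInter fun z => ?_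
    have hc : ∀ x, Continuous fun X : H →L[𝕜] (ℝ →ᵇ H) => X x t := fun x =>
      (BoundedContinuousFunction.evalCLM (β := H) 𝕜 t).continuous.comp
        (ContinuousLinearMap.apply 𝕜 (ℝ →ᵇ H) x).continuous
    exact isClosed_eq ((hc x).inner continuous_const) (continuous_const.inner (hc z))
  have hmaps : MapsTo Φ B B := by
    intro X hX
    refine ⟨?_, fun t x z => ?_⟩
    · refine (Φ X).opNorm_le_bound hρ0.le fun h => ?_
      refine (BoundedContinuousFunction.norm_le (by positivity)).2 fun t => ?_
      rw [hΦ]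
      have h1 : ∀ s ∈ Icc a b, ‖riccatiDefect S R (ev X) s‖ ≤ n := fun s _ =>
        norm_riccatiDefect_le (hσ s) (hς s) ((hevn X s).trans hX.1)
      refine (norm_lyapunovMap_le hu h1 hGp (hπ t) h).trans ?_
      have h2 : (b - a) * (u * n * u) ≤ (b - a) * e := by
        gcongr
        rw [he]
        have : 0 ≤ 4 * (u * (ρ * σ) * u) := by positivity
        linarith
      gcongr
      linarith
    · rw [hΦ, hΦ, ← inner_conj_symm, inner_lyapunovMap hs.evol (hDm X) (hDn'' X) G (hπ t),
        inner_lyapunovMap hs.evol (hDm X) (hDn'' X) G (hπ t), map_sub,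
        ← intervalIntegral.intervalIntegral_conj]
      simp only [inner_conj_symm]
      rw [hG.inner_left_eq_inner_right]
      congr 1
      refine intervalIntegral.integral_congr fun s _ => ?_
      have h1 : ∀ x z, ⟪ev X s x, z⟫_𝕜 = ⟪x, ev X s z⟫_𝕜 := fun x z => hX.2 s x z
      simp only [riccatiDefect, sub_apply, ContinuousLinearMap.comp_apply, inner_sub_left,
        inner_sub_right, h1, (hs.S_pos s).inner_left_eq_inner_right,
        (hs.R_pos s).inner_left_eq_inner_right]
  have hcontr : ContractingWith (1 / 2) (hmaps.restrict Φ B B) := by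
    refine ⟨by norm_num, LipschitzWith.of_dist_le_mul fun X X' => ?_⟩
    obtain ⟨X, hX⟩ := X
    obtain ⟨X', hX'⟩ := X'
    change dist (Φ X) (Φ X') ≤ _ * dist X X'
    rw [dist_eq_norm, dist_eq_norm]
    refine ContinuousLinearMap.opNorm_le_bound _ (by positivity) fun h => ?_
    refine (BoundedContinuousFunction.norm_le (by positivity)).2 fun t => ?_
    change ‖Φ X h t - Φ X' h t‖ ≤ _
    rw [hΦ, hΦ]
    set t' := max a (min t b) with ht'
    have h1 : lyapunovMap U (riccatiDefect S R (ev X)) G b t' h -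
        lyapunovMap U (riccatiDefect S R (ev X')) G b t' h =
        lyapunovMap U (fun s => riccatiDefect S R (ev X) s - riccatiDefect S R (ev X') s) 0 b t'
          h := by
      simp only [lyapunovMap, sub_apply, zero_apply, map_sub, map_zero]
      rw [intervalIntegral.integral_sub
        (intervalIntegrable_lyapunov hs.evol (hDm X) (hDn'' X) (hπ t) h)
        (intervalIntegrable_lyapunov hs.evol (hDm X') (hDn'' X') (hπ t) h)]
      abel
    have h2 : ∀ s ∈ Icc a b, ‖riccatiDefect S R (ev X) s - riccatiDefect S R (ev X') s‖ ≤
        2 * (ρ * σ) * ‖X - X'‖ := fun s _ =>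
      norm_riccatiDefect_sub_le (hσ s) ((hevn X s).trans hX.1) ((hevn X' s).trans hX'.1)
        (hevn (X - X') s)
    rw [h1]
    refine (norm_lyapunovMap_le hu h2 (g := 0) (by simp) (hπ t) h).trans ?_
    have h3 : (b - a) * (4 * (u * (ρ * σ) * u)) ≤ (b - a) * e := by
      gcongr
      rw [he]
      have : 0 ≤ u * n * u := by positivity
      linarith
    have h4 : (b - a) * (2 * (u * (ρ * σ) * u)) ≤ 1 / 2 := by linarith
    have h5 : u * 0 * u + (b - a) * (u * (2 * (ρ * σ) * ‖X - X'‖) * u) =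
        (b - a) * (2 * (u * (ρ * σ) * u)) * ‖X - X'‖ := by ring
    rw [h5]
    gcongr
    exact h4.trans (by norm_num)
  have h0 : (0 : H →L[𝕜] (ℝ →ᵇ H)) ∈ B := by
    refine ⟨by simpa using hρ0.le, fun t x z => by simp⟩
  obtain ⟨X, hXB, hX, -⟩ := hcontr.exists_fixedPoint' hBclosed.isComplete hmaps h0
    (edist_ne_top _ _)
  have hfix : ∀ t ∈ Icc a b, ∀ h, ev X t h =
      lyapunovMap U (riccatiDefect S R (ev X)) G b t h := by
    intro t ht h
    have h1 : Φ X h t = X h t := by rw [hX.eq]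
    rw [hevapp, ← h1, hΦ, hπid t ht]
  have hfinal : ev X b = G := by
    ext h
    rw [hfix b hbI, lyapunovMap, intervalIntegral.integral_same, sub_zero]
    have h1 : U b b = ContinuousLinearMap.id 𝕜 H := by
      ext x
      exact hs.evol.refl b x
    rw [h1, ContinuousLinearMap.adjoint_id]
    rfl
  refine ⟨ev X, hs.isRiccati_of_symmetric (hevc X) (fun t _ x z => hXB.2 t x z)
    (.of_final hs.evol (hDm X) (hDn'' X) fun t ht x z => ?_) (by rwa [hfinal]), hfinal⟩
  rw [hfix t ht, hfinal, inner_lyapunovMap hs.evol (hDm X) (hDn'' X) G ht]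

end Existence

/-! ### Global, periodic and limit solutions of the Riccati equation -/

section GlobalExistence

open Filter Topology

variable {𝕜 : Type*} [RCLike 𝕜]
variable {H : Type*} [NormedAddCommGroup H] [InnerProductSpace 𝕜 H]
variable {U : ℝ → ℝ → H →L[𝕜] H} {S R P : ℝ → H →L[𝕜] H} {a b : ℝ}

theorem IsRiccati.congr (h : IsRiccati U S R P a b) {P' : ℝ → H →L[𝕜] H}
    (hP' : StronglyContinuous P') (heq : EqOn P P' (Icc a b)) : IsRiccati U S R P' a b := by
  refine ⟨hP', fun t ht => heq ht ▸ h.pos t ht, h.lyap.congr heq fun t ht => ?_⟩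
  simp only [riccatiDefect, heq ht]

theorem IsRiccati.trans [CompleteSpace H] (hs : RiccatiSystem U S R) {c : ℝ} (hac : a ≤ c)
    (hcb : c ≤ b) (h₁ : IsRiccati U S R P a c) (h₂ : IsRiccati U S R P c b) :
    IsRiccati U S R P a b := by
  refine ⟨h₁.cont, fun t ht => ?_, h₁.lyap.trans hs.evol hac hcb
    (hs.strMeas_riccatiDefect h₁.cont.strMeas) (hs.exists_norm_riccatiDefect_le h₁.cont a b)
    h₂.lyap⟩
  rcases le_total t c with htc | hct
  · exact h₁.pos t ⟨ht.1, htc⟩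
  · exact h₂.pos t ⟨hct, ht.2⟩

/-- Time shift of the Lyapunov equation by a period of the evolution family. -/
theorem isLyapunov_shift {θ : ℝ} (hU : ∀ s t, 0 ≤ s → s ≤ t → U (t + θ) (s + θ) = U t s)
    {W N : ℝ → H →L[𝕜] H} (ha : 0 ≤ a) :
    IsLyapunov U W N (a + θ) (b + θ) ↔
      IsLyapunov U (fun t => W (t + θ)) (fun t => N (t + θ)) a b := by
  have hint : ∀ r s, 0 ≤ r → r ≤ s → ∀ x z,
      ∫ σ in r..s, ⟪U σ r x, N (σ + θ) (U σ r z)⟫_𝕜 =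
        ∫ σ in (r + θ)..(s + θ), ⟪U σ (r + θ) x, N σ (U σ (r + θ) z)⟫_𝕜 := by
    intro r s hr hrs x z
    rw [← intervalIntegral.integral_comp_add_right]
    refine intervalIntegral.integral_congr fun σ hσ => ?_
    rw [uIcc_of_le hrs] at hσ
    simp only [hU r σ hr hσ.1]
  constructor
  · intro h r s har hrs hsb x z
    have h1 := h (r + θ) (s + θ) (by linarith) (by linarith) (by linarith) x z
    rwa [hU r s (ha.trans har) hrs, ← hint r s (ha.trans har) hrs] at h1
  · intro h r s har hrs hsb x z
    have hr : 0 ≤ r - θ := by linarith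
    have hrs' : r - θ ≤ s - θ := by linarith
    have h1 := h (r - θ) (s - θ) (by linarith) hrs' (by linarith) x z
    rw [hint _ _ hr hrs', ← hU _ _ hr hrs'] at h1
    simpa only [sub_add_cancel] using h1

theorem isRiccati_shift {θ : ℝ} (hU : ∀ s t, 0 ≤ s → s ≤ t → U (t + θ) (s + θ) = U t s)
    (hS : Function.Periodic S θ) (hR : Function.Periodic R θ) (ha : 0 ≤ a) :
    IsRiccati U S R P (a + θ) (b + θ) ↔ IsRiccati U S R (fun t => P (t + θ)) a b := by
  have hdef : riccatiDefect S R (fun t => P (t + θ)) = fun t => riccatiDefect S R P (t + θ) := by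
    ext1 t
    simp only [riccatiDefect, hS t, hR t]
  constructor
  · intro h
    refine ⟨fun x => (h.cont x).comp (continuous_id.add continuous_const), fun t ht =>
      h.pos _ ⟨by linarith [ht.1], by linarith [ht.2]⟩, ?_⟩
    rw [hdef]
    exact (isLyapunov_shift hU ha).1 h.lyap
  · intro h
    refine ⟨fun x => ?_, fun t ht => ?_, (isLyapunov_shift hU ha).2 ?_⟩
    · have h1 : Continuous fun t => P (t - θ + θ) x :=
        (h.cont x).comp (continuous_id.sub continuous_const)
      simpa only [sub_add_cancel] using h1
    · simpa only [sub_add_cancel] using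
        h.pos (t - θ) ⟨by linarith [ht.1], by linarith [ht.2]⟩
    · rw [← hdef]
      exact h.lyap

theorem ContinuousLinearMap.IsPositive.of_tendsto {T : ℕ → H →L[𝕜] H} {T₀ : H →L[𝕜] H}
    (hT : ∀ n, (T n).IsPositive) (h : Tendsto T atTop (𝓝 T₀)) : T₀.IsPositive := by
  have happ : ∀ x, Tendsto (fun n => T n x) atTop (𝓝 (T₀ x)) := fun x =>
    ((ContinuousLinearMap.apply 𝕜 H x).continuous.tendsto T₀).comp h
  rw [ContinuousLinearMap.isPositive_def]
  refine ⟨fun x z => ?_, fun x => ?_⟩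
  · refine tendsto_nhds_unique ((happ x).inner tendsto_const_nhds)
      ((tendsto_const_nhds.inner (happ z)).congr fun n => ?_)
    exact ((hT n).inner_left_eq_inner_right x z).symm
  · have h1 : Tendsto (fun n => RCLike.re ⟪T n x, x⟫_𝕜) atTop (𝓝 (RCLike.re ⟪T₀ x, x⟫_𝕜)) :=
      (RCLike.continuous_re.tendsto _).comp ((happ x).inner tendsto_const_nhds)
    exact ge_of_tendsto' h1 fun n => (hT n).re_inner_nonneg_left x

variable [CompleteSpace H]

/-- The limit of Riccati solutions that converge uniformly. -/
theorem RiccatiSystem.isRiccati_of_tendsto (hs : RiccatiSystem U S R)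
    {Q : ℕ → ℝ → H →L[𝕜] H} {p : ℝ} (hQ : ∀ n, IsRiccati U S R (Q n) a b)
    (hp : ∀ n, ∀ t ∈ Icc a b, ‖Q n t‖ ≤ p) {ε : ℕ → ℝ} (hε : Tendsto ε atTop (𝓝 0))
    (hle : ∀ n t, ‖P t - Q n t‖ ≤ ε n) : IsRiccati U S R P a b := by
  have hlim : ∀ t, Tendsto (fun n => Q n t) atTop (𝓝 (P t)) := fun t => by
    rw [tendsto_iff_norm_sub_tendsto_zero]
    refine squeeze_zero (fun _ => norm_nonneg _) (fun n => ?_) hε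
    rw [norm_sub_rev]
    exact hle n t
  have happ : ∀ t x, Tendsto (fun n => Q n t x) atTop (𝓝 (P t x)) := fun t x =>
    ((ContinuousLinearMap.apply 𝕜 H x).continuous.tendsto _).comp (hlim t)
  refine ⟨fun x => ?_, fun t ht => .of_tendsto (fun n => (hQ n).pos t ht) (hlim t), ?_⟩
  · have hu : TendstoUniformly (fun n t => Q n t x) (fun t => P t x) atTop := by
      rw [Metric.tendstoUniformly_iff]
      intro e he
      have h1 : Tendsto (fun n => ε n * ‖x‖) atTop (𝓝 0) := by simpa using hε.mul_const ‖x‖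
      filter_upwards [h1.eventually (gt_mem_nhds he)] with n hn t
      rw [dist_eq_norm]
      refine lt_of_le_of_lt ?_ hn
      exact ((P t - Q n t).le_opNorm x).trans (by gcongr; exact hle n t)
    exact hu.continuous (Frequently.of_forall fun n => (hQ n).cont x)
  · intro r s har hrs hsb x z
    obtain ⟨σ, hσ⟩ := hs.S_bdd
    obtain ⟨ς, hς⟩ := hs.R_bdd
    obtain ⟨u, hu0, hu⟩ := exists_norm_le_square hs.evol.cont a b
    have hr : r ∈ Icc a b := ⟨har, hrs.trans hsb⟩
    have hUm := (stronglyContinuous_left hs.evol.cont r).strMeas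
    have hdef : ∀ t y, Tendsto (fun n => riccatiDefect S R (Q n) t y) atTop
        (𝓝 (riccatiDefect S R P t y)) := fun t y => by
      have h1 : Tendsto (fun n => Q n t * (S t * Q n t) - R t) atTop
          (𝓝 (P t * (S t * P t) - R t)) :=
        ((hlim t).mul (tendsto_const_nhds.mul (hlim t))).sub_const _
      exact ((ContinuousLinearMap.apply 𝕜 H y).continuous.tendsto _).comp h1
    have hint : Tendsto
        (fun n => ∫ τ in r..s, ⟪U τ r x, riccatiDefect S R (Q n) τ (U τ r z)⟫_𝕜) atTop
        (𝓝 (∫ τ in r..s, ⟪U τ r x, riccatiDefect S R P τ (U τ r z)⟫_𝕜)) := by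
      refine intervalIntegral.tendsto_integral_filter_of_dominated_convergence
        (fun _ => u * ‖x‖ * (p * (σ * p) + ς) * (u * ‖z‖))
        (.of_forall fun n => ((hUm x).inner ((hs.strMeas_riccatiDefect
          (hQ n).cont.strMeas).apply (hUm z))).aestronglyMeasurable)
        (.of_forall fun n => .of_forall fun τ hτ => ?_) intervalIntegrable_const
        (.of_forall fun τ _ => tendsto_const_nhds.inner (hdef τ _))
      rw [uIoc_of_le hrs] at hτ
      have hτ' : τ ∈ Icc a b := ⟨har.trans hτ.1.le, hτ.2.trans hsb⟩
      exact norm_inner_apply_le (((U τ r).le_opNorm x).trans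
        (mul_le_mul_of_nonneg_right (hu τ hτ' r hr) (norm_nonneg _)))
        (norm_riccatiDefect_le (hσ τ) (hς τ) (hp n τ hτ'))
        (((U τ r).le_opNorm z).trans
          (mul_le_mul_of_nonneg_right (hu τ hτ' r hr) (norm_nonneg _)))
    refine tendsto_nhds_unique (tendsto_const_nhds.inner (happ r z))
      (((tendsto_const_nhds.inner (happ s (U s r z))).sub hint).congr fun n => ?_)
    exact ((hQ n).lyap r s har hrs hsb x z).symm

/-- A periodic solution on one period is a solution on all of `[0, ∞)`. -/
theorem IsRiccati.of_periodic (hs : RiccatiSystem U S R) {θ : ℝ} (hθ : 0 < θ)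
    (hU : ∀ s t, 0 ≤ s → s ≤ t → U (t + θ) (s + θ) = U t s) (hS : Function.Periodic S θ)
    (hR : Function.Periodic R θ) (hP : IsRiccati U S R P 0 θ) (hper : Function.Periodic P θ)
    (T : ℝ) : IsRiccati U S R P 0 T := by
  have hn : ∀ n : ℕ, IsRiccati U S R P (n * θ) (n * θ + θ) := by
    intro n
    induction n with
    | zero => simpa using hP
    | succ n ih =>
      push_cast
      rw [add_mul, one_mul]
      have h1 : (fun t => P (t + θ)) = P := funext hper
      have h2 := (isRiccati_shift (P := P) (b := n * θ + θ) hU hS hR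
        (by positivity : 0 ≤ (n : ℝ) * θ)).2
      rw [h1] at h2
      exact h2 ih
  have hN : ∀ n : ℕ, IsRiccati U S R P 0 (n * θ + θ) := by
    intro n
    induction n with
    | zero => simpa using hn 0
    | succ n ih =>
      have h1 := hn (n + 1)
      push_cast at h1 ⊢
      rw [add_mul, one_mul] at h1 ⊢
      exact ih.trans hs (by positivity) (by linarith) h1
  obtain ⟨n, hT⟩ := exists_nat_gt (T / θ)
  rw [div_lt_iff₀ hθ] at hT
  exact (hN n).mono le_rfl (by linarith)

variable [NormedSpace ℝ H]

/-- Global solvability backwards from the final value zero: the a priori bound allows steps of a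
fixed length. -/
theorem RiccatiSystem.exists_final (hs : RiccatiSystem U S R) (hst : IsStabilizable U S)
    (hadj : ∀ x, Continuous fun p : ℝ × ℝ => adjoint (U p.1 p.2) x) {T : ℝ} (hT : 0 ≤ T) :
    ∃ P, IsRiccati U S R P 0 T ∧ P T = 0 := by
  obtain ⟨p, hp0, hp⟩ := hs.exists_norm_le_of_final hst
  obtain ⟨δ, hδ, hloc⟩ := hs.exists_local hadj T hp0.le
  have hstep : ∀ n : ℕ, ∃ P, IsRiccati U S R P (max 0 (T - n * δ)) T ∧ P T = 0 := by
    intro n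
    induction n with
    | zero =>
      obtain ⟨P, hP, hPT⟩ := hloc hT le_rfl le_rfl (by simpa using hδ.le)
        (ContinuousLinearMap.isPositive_zero (𝕜 := 𝕜) (E := H)) (by simpa using hp0.le)
      refine ⟨P, ?_, hPT⟩
      simpa [max_eq_right hT] using hP
    | succ n ih =>
      obtain ⟨P, hP, hPT⟩ := ih
      set c := max 0 (T - n * δ) with hc
      set d := max 0 (T - (n + 1 : ℕ) * δ) with hd
      have hd0 : 0 ≤ d := le_max_left _ _
      have hnδ : 0 ≤ n * δ := by positivity
      have hcT : c ≤ T := max_le hT (by linarith)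
      have hdc : d ≤ c := by
        refine max_le_max le_rfl ?_
        push_cast
        linarith
      have hcd : c - d ≤ δ := by
        rw [sub_le_iff_le_add]
        refine max_le (by linarith) ?_
        have : T - (n + 1 : ℕ) * δ ≤ d := le_max_right _ _
        push_cast at this
        linarith
      obtain ⟨P', hP', hPc⟩ := hloc hd0 hdc hcT hcd (hP.pos c ⟨le_rfl, hcT⟩)
        (hp (hd0.trans hdc) hP hPT c ⟨le_rfl, hcT⟩)
      set W : ℝ → H →L[𝕜] H := fun t => if t ≤ c then P' t else P t with hW
      have hWc : StronglyContinuous W := by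
        intro x
        have h1 : (fun t => W t x) = fun t => if t ≤ c then P' t x else P t x := by
          ext t
          simp only [hW]
          split_ifs <;> rfl
        rw [h1]
        refine Continuous.if_le (hP'.cont x) (hP.cont x) continuous_id continuous_const ?_
        rintro t rfl
        rw [hPc]
      have hW₁ : EqOn P' W (Icc d c) := fun t ht => by
        simp only [hW, if_pos ht.2]
      have hW₂ : EqOn P W (Icc c T) := fun t ht => by
        rcases ht.1.eq_or_lt with h | h
        · simp only [hW, ← h, le_refl, if_true, hPc]
        · simp only [hW, if_neg (not_le.2 h)]
      refine ⟨W, (hP'.congr hWc hW₁).trans hs hdc hcT (hP.congr hWc hW₂), ?_⟩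
      rw [← hW₂ ⟨hcT, le_rfl⟩, hPT]
  obtain ⟨n, hn⟩ := exists_nat_gt (T / δ)
  obtain ⟨P, hP, hPT⟩ := hstep n
  have h1 : T - n * δ ≤ 0 := by
    rw [div_lt_iff₀ hδ] at hn
    linarith
  rw [max_eq_left h1] at hP
  exact ⟨P, hP, hPT⟩

/-- A periodic solution is obtained as the limit of the solutions on `[0, n θ]` with final value
zero, which form a Cauchy sequence by the exponential comparison estimate. -/
theorem RiccatiSystem.exists_periodic (hs : RiccatiSystem U S R) (hst : IsStabilizable U S)
    (hdet : IsDetectable U R) (hadj : ∀ x, Continuous fun p : ℝ × ℝ => adjoint (U p.1 p.2) x)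
    {θ : ℝ} (hθ : 0 < θ) (hU : ∀ s t, 0 ≤ s → s ≤ t → U (t + θ) (s + θ) = U t s)
    (hS : Function.Periodic S θ) (hR : Function.Periodic R θ) :
    ∃ P, IsRiccati U S R P 0 θ ∧ P θ = P 0 := by
  obtain ⟨p, hp0, hp⟩ := hs.exists_norm_le_of_final hst
  obtain ⟨M, μ, hM, hμ, hcmp⟩ := hs.exists_norm_sub_le hdet hp0.le
  have hnθ : ∀ n : ℕ, 0 ≤ (n : ℝ) * θ := fun n => by positivity
  choose Q hQ hQ0 using fun n : ℕ => hs.exists_final hst hadj (hnθ (n + 1))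
  have hlen : ∀ n : ℕ, θ ≤ ((n + 1 : ℕ) : ℝ) * θ := fun n => by
    push_cast
    linarith [hnθ n]
  have hQp : ∀ n, ∀ t ∈ Icc 0 (((n + 1 : ℕ) : ℝ) * θ), ‖Q n t‖ ≤ p := fun n =>
    hp le_rfl (hQ n) (hQ0 n)
  set π : ℝ → ℝ := fun t => max 0 (min t θ) with hπ
  have hπm : ∀ t, π t ∈ Icc 0 θ := fun t => ⟨le_max_left _ _, max_le hθ.le (min_le_right _ _)⟩
  have hπc : Continuous π := continuous_const.max (continuous_id.min continuous_const)
  have hπid : ∀ t ∈ Icc 0 θ, π t = t := fun t ht => by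
    simp only [hπ]
    rw [min_eq_left ht.2, max_eq_right ht.1]
  set ε : ℕ → ℝ := fun n => M * p * Real.exp (-(μ * θ)) ^ n with hε
  have hε0 : Tendsto ε atTop (𝓝 0) := by
    have h1 : Real.exp (-(μ * θ)) < 1 := Real.exp_lt_one_iff.mpr (by nlinarith)
    simpa using (tendsto_pow_atTop_nhds_zero_of_lt_one (Real.exp_pos _).le h1).const_mul (M * p)
  have hcauchy : ∀ n m, n ≤ m → ∀ t ∈ Icc 0 θ, ‖Q m t - Q n t‖ ≤ ε n := by
    intro n m hnm t ht
    have htn : t ≤ ((n + 1 : ℕ) : ℝ) * θ := ht.2.trans (hlen n)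
    have hnm' : ((n + 1 : ℕ) : ℝ) * θ ≤ ((m + 1 : ℕ) : ℝ) * θ := by gcongr
    have h1 := hcmp ht.1 htn ((hQ m).mono ht.1 hnm')
      (fun s hs' => hQp m s ⟨ht.1.trans hs'.1, hs'.2.trans hnm'⟩)
      ((hQ n).mono ht.1 le_rfl) (fun s hs' => hQp n s ⟨ht.1.trans hs'.1, hs'.2⟩)
    rw [hQ0 n, sub_zero] at h1
    have h2 : ‖Q m (((n + 1 : ℕ) : ℝ) * θ)‖ ≤ p := hQp m _ ⟨hnθ _, hnm'⟩
    have h3 : Real.exp (-μ * (((n + 1 : ℕ) : ℝ) * θ - t)) ≤ Real.exp (-(μ * θ)) ^ n := by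
      rw [← Real.exp_nat_mul]
      apply Real.exp_le_exp.2
      push_cast
      nlinarith [ht.2]
    calc _ ≤ M * Real.exp (-μ * (((n + 1 : ℕ) : ℝ) * θ - t)) *
          ‖Q m (((n + 1 : ℕ) : ℝ) * θ)‖ := h1
      _ ≤ M * Real.exp (-(μ * θ)) ^ n * p := by gcongr
      _ = ε n := by rw [hε]; ring
  have hex : ∀ t, ∃ L, Tendsto (fun n => Q n (π t)) atTop (𝓝 L) := by
    intro t
    refine cauchySeq_tendsto_of_complete (cauchySeq_of_le_tendsto_0 (fun n => 2 * ε n) ?_ ?_)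
    · intro n m N hn hm
      have h1 := hcauchy N n hn _ (hπm t)
      have h2 := hcauchy N m hm _ (hπm t)
      rw [← dist_eq_norm] at h1 h2
      linarith [dist_triangle_right (Q n (π t)) (Q m (π t)) (Q N (π t))]
    · simpa using hε0.const_mul 2
  choose P hP using hex
  have hQR : ∀ n, IsRiccati U S R (fun t => Q n (π t)) 0 θ := fun n =>
    ((hQ n).mono le_rfl (hlen n)).congr (fun x => ((hQ n).cont x).comp hπc)
      fun t ht => by simp only [hπid t ht]
  refine ⟨P, hs.isRiccati_of_tendsto hQR (fun n t _ => hQp n _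
    ⟨(hπm t).1, (hπm t).2.trans (hlen n)⟩) hε0 fun n t => ?_, ?_⟩
  · refine le_of_tendsto ((hP t).sub_const _).norm ?_
    filter_upwards [eventually_ge_atTop n] with m hm
    exact hcauchy n m hm _ (hπm t)
  · -- by uniqueness, the next solution is the shift of the current one
    have hshift : ∀ n, Q (n + 1) θ = Q n 0 := by
      intro n
      have h1 : ((n + 1 + 1 : ℕ) : ℝ) * θ = ((n + 1 : ℕ) : ℝ) * θ + θ := by
        push_cast
        ring
      have h2 : IsRiccati U S R (Q (n + 1)) (0 + θ) (((n + 1 : ℕ) : ℝ) * θ + θ) :=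
        (hQ (n + 1)).mono (by linarith) h1.ge
      have h3 := hs.eqOn_of_eq_final hdet le_rfl ((isRiccati_shift hU hS hR le_rfl).1 h2) (hQ n)
        (by simp only [← h1, hQ0])
      simpa using h3 (left_mem_Icc.2 (hnθ (n + 1)))
    have h1 : Tendsto (fun n => Q (n + 1) θ) atTop (𝓝 (P θ)) := by
      have h2 := hP θ
      rw [hπid θ ⟨hθ.le, le_rfl⟩] at h2
      exact h2.comp (tendsto_add_atTop_nat 1)
    have h2 := hP 0
    rw [hπid 0 ⟨le_rfl, hθ.le⟩] at h2
    simp only [hshift] at h1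
    exact tendsto_nhds_unique h1 h2

/-- Uniqueness of the periodic solution: the distance of two of them at a given time is bounded by
their distance many periods later, times a small factor. -/
theorem RiccatiSystem.eq_of_periodic (hs : RiccatiSystem U S R) (hdet : IsDetectable U R)
    {θ : ℝ} (hθ : 0 < θ) (hU : ∀ s t, 0 ≤ s → s ≤ t → U (t + θ) (s + θ) = U t s)
    (hS : Function.Periodic S θ) (hR : Function.Periodic R θ) {P₁ P₂ : ℝ → H →L[𝕜] H}
    (h₁ : IsRiccati U S R P₁ 0 θ) (hper₁ : Function.Periodic P₁ θ)
    (h₂ : IsRiccati U S R P₂ 0 θ) (hper₂ : Function.Periodic P₂ θ) : P₁ = P₂ := by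
  obtain ⟨p₁, hp₁0, hp₁⟩ := h₁.cont.exists_norm_le_of_periodic hθ hper₁
  obtain ⟨p₂, hp₂0, hp₂⟩ := h₂.cont.exists_norm_le_of_periodic hθ hper₂
  obtain ⟨M, μ, hM, hμ, hcmp⟩ := hs.exists_norm_sub_le hdet (add_nonneg hp₁0 hp₂0)
  have hkey : ∀ t, 0 ≤ t → P₁ t = P₂ t := by
    intro t ht
    have hle : ∀ T, t ≤ T → ‖P₁ t - P₂ t‖ ≤ M * Real.exp (-μ * (T - t)) * (p₁ + p₂) := by
      intro T hT
      refine (hcmp ht hT ((h₁.of_periodic hs hθ hU hS hR hper₁ T).mono ht le_rfl)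
        (fun s _ => (hp₁ s).trans (by linarith))
        ((h₂.of_periodic hs hθ hU hS hR hper₂ T).mono ht le_rfl)
        (fun s _ => (hp₂ s).trans (by linarith))).trans ?_
      gcongr
      exact (norm_sub_le _ _).trans (add_le_add (hp₁ T) (hp₂ T))
    have hlim : Tendsto (fun T => M * Real.exp (-μ * (T - t)) * (p₁ + p₂)) atTop (𝓝 0) := by
      have h1 : Tendsto (fun T => -μ * (T - t)) atTop atBot :=
        (tendsto_atTop_add_const_right _ (-t) tendsto_id).const_mul_atTop_of_neg (by linarith)
      simpa using ((Real.tendsto_exp_atBot.comp h1).const_mul M).mul_const (p₁ + p₂)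
    have h0 : ‖P₁ t - P₂ t‖ ≤ 0 := ge_of_tendsto hlim (by
      filter_upwards [eventually_ge_atTop t] with T hT
      exact hle T hT)
    exact sub_eq_zero.1 (norm_le_zero_iff.1 h0)
  ext1 t
  have h3 : Function.Periodic (fun t => P₁ t - P₂ t) θ := hper₁.sub hper₂
  obtain ⟨s, hs', hst⟩ := h3.exists_mem_Ico₀ hθ t
  have h4 : P₁ t - P₂ t = P₁ s - P₂ s := hst
  rw [hkey s hs'.1, sub_self] at h4
  exact sub_eq_zero.1 h4

/-- The solutions with final value zero converge exponentially to the periodic solution. -/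
theorem RiccatiSystem.exists_norm_periodic_sub_le (hs : RiccatiSystem U S R)
    (hst : IsStabilizable U S) (hdet : IsDetectable U R) {θ : ℝ} (hθ : 0 < θ)
    (hU : ∀ s t, 0 ≤ s → s ≤ t → U (t + θ) (s + θ) = U t s)
    (hS : Function.Periodic S θ) (hR : Function.Periodic R θ)
    (hP : IsRiccati U S R P 0 θ) (hper : Function.Periodic P θ) :
    ∃ M μ, 0 < M ∧ 0 < μ ∧ ∀ {T : ℝ} {Q}, IsRiccati U S R Q 0 T → Q T = 0 →
      ∀ t ∈ Icc 0 T, ‖P t - Q t‖ ≤ M * Real.exp (-μ * (T - t)) := by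
  obtain ⟨p₁, hp₁0, hp₁⟩ := hP.cont.exists_norm_le_of_periodic hθ hper
  obtain ⟨p₂, hp₂0, hp₂⟩ := hs.exists_norm_le_of_final hst
  obtain ⟨M, μ, hM, hμ, hcmp⟩ := hs.exists_norm_sub_le hdet (add_nonneg hp₁0 hp₂0.le)
  refine ⟨M * (p₁ + p₂), μ, by positivity, hμ, ?_⟩
  intro T Q hQ hQT t ht
  have h1 := hcmp ht.1 ht.2 ((hP.of_periodic hs hθ hU hS hR hper T).mono ht.1 le_rfl)
    (fun s _ => (hp₁ s).trans (by linarith)) (hQ.mono ht.1 le_rfl)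
    (fun s hs' => (hp₂ le_rfl hQ hQT s ⟨ht.1.trans hs'.1, hs'.2⟩).trans (by linarith))
  rw [hQT, sub_zero] at h1
  calc _ ≤ M * Real.exp (-μ * (T - t)) * ‖P T‖ := h1
    _ ≤ M * Real.exp (-μ * (T - t)) * (p₁ + p₂) := by
      gcongr
      exact (hp₁ T).trans (by linarith)
    _ = _ := by ring

end GlobalExistence

/-! ### Evolution operators given on a triangle -/

section Triangle

open Filter Topology

variable {𝕜 : Type*} [RCLike 𝕜]
variable {H : Type*} [NormedAddCommGroup H] [InnerProductSpace 𝕜 H]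

/-- The extension of a family given for `0 ≤ s ≤ t` to all of the plane by projecting first `s` to
`[0, ∞)` and then `t` to `[s, ∞)`; it preserves joint strong continuity. -/
def extendTriangle (V : ℝ → ℝ → H →L[𝕜] H) (t s : ℝ) : H →L[𝕜] H :=
  V (max t (max s 0)) (max s 0)

theorem extendTriangle_of_le {V : ℝ → ℝ → H →L[𝕜] H} {s t : ℝ} (hst : s ≤ t) :
    extendTriangle V t s = V (max t 0) (max s 0) := by
  have h : max t (max s 0) = max t 0 := by rw [← max_assoc, max_eq_left hst]
  rw [extendTriangle, h]

theorem extendTriangle_eq {V : ℝ → ℝ → H →L[𝕜] H} {s t : ℝ} (hs : 0 ≤ s) (hst : s ≤ t) :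
    extendTriangle V t s = V t s := by
  rw [extendTriangle_of_le hst, max_eq_left hs, max_eq_left (hs.trans hst)]

theorem StronglyContinuousTriangle.continuous_extendTriangle {V : ℝ → ℝ → H →L[𝕜] H}
    (hV : StronglyContinuousTriangle V) (x : H) :
    Continuous fun p : ℝ × ℝ => extendTriangle V p.1 p.2 x :=
  (hV x).comp_continuous
    (f := fun p : ℝ × ℝ => (max p.1 (max p.2 0), max p.2 0)) (by fun_prop)
    fun _ => ⟨le_max_right _ _, le_max_right _ _⟩

theorem IsExpStable.extendTriangle {V : ℝ → ℝ → H →L[𝕜] H} {M ρ : ℝ} (hM : 0 < M) (hρ : 0 < ρ)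
    (h : ∀ s t, 0 ≤ s → s ≤ t → ‖V t s‖ ≤ M * Real.exp (-ρ * (t - s))) :
    IsExpStable (extendTriangle V) M ρ where
  pos := hM
  rate_pos := hρ
  le s t hs hst := by
    rw [extendTriangle_eq hs hst]
    exact h s t hs hst

variable [NormedSpace ℝ H]

theorem GeneratesEvolution.evolutionFamily {A : ℝ → H →ₗ.[𝕜] H} {UA : ℝ → ℝ → H →L[𝕜] H}
    (hA : GeneratesEvolution A UA) : EvolutionFamily (extendTriangle UA) where
  cont := hA.strong_cont.continuous_extendTriangle
  refl s x := by
    rw [extendTriangle_of_le le_rfl, hA.refl _ (le_max_right _ _)]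
    rfl
  comp s r t hsr hrt x := by
    rw [extendTriangle_of_le hsr, extendTriangle_of_le hrt, extendTriangle_of_le (hsr.trans hrt),
      ← hA.comp _ (max r 0) _ (le_max_right _ _) (max_le_max hsr le_rfl) (max_le_max hrt le_rfl)]
    rfl

theorem IsPerturbedEvolution.isPerturbation {UA V : ℝ → ℝ → H →L[𝕜] H} {F : ℝ → H →L[𝕜] H}
    (h : IsPerturbedEvolution UA F V) :
    IsPerturbation (extendTriangle UA) F (extendTriangle V) where
  cont := h.strong_cont.continuous_extendTriangle
  mild s t hs hst x := by
    rw [extendTriangle_eq hs hst, extendTriangle_eq hs hst, h.mild s t hs hst]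
    congr 1
    refine intervalIntegral.integral_congr fun r hr => ?_
    rw [uIcc_of_le hst] at hr
    simp only [extendTriangle_eq hs hr.1, extendTriangle_eq (hs.trans hr.1) hr.2]

/-- The evolution operators of a periodic family are periodic: for `x` in the domain of `A(s)`, the
function `τ ↦ U(t,τ) U(τ+θ,s+θ) x` has vanishing right derivative on `[s, t]`. -/
theorem GeneratesEvolution.periodic [CompleteSpace H] {A : ℝ → H →ₗ.[𝕜] H}
    {UA : ℝ → ℝ → H →L[𝕜] H} (hA : GeneratesEvolution A UA) {θ : ℝ} (hθ : 0 ≤ θ)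
    (hper : Function.Periodic A θ) {s t : ℝ} (hs : 0 ≤ s) (hst : s ≤ t) :
    UA (t + θ) (s + θ) = UA t s := by
  have hU := hA.evolutionFamily
  set W := extendTriangle UA with hW
  refine DFunLike.coe_injective (Continuous.ext_on (hA.dense_domain s hs)
    (UA (t + θ) (s + θ)).continuous (UA t s).continuous fun x hx => ?_)
  have hLeq : ∀ {L L' : H →ₗ.[𝕜] H} (_ : L = L') (y : L.domain) (y' : L'.domain)
      (_ : (y : H) = y'), L y = L' y' := by
    rintro L _ rfl y y' h
    rw [Subtype.ext h]
  set w : ℝ → H := fun τ => W (τ + θ) (s + θ) x with hw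
  set φ : ℝ → H := fun τ => W t τ (w τ) with hφ
  have hwc : Continuous w := (hU.cont x).comp (by fun_prop : Continuous fun τ => (τ + θ, s + θ))
  have hφc : Continuous φ :=
    continuous_apply_of_stronglyContinuous (stronglyContinuous_right hU.cont t) hwc
  have hderiv : ∀ τ ∈ Ico s t, HasDerivWithinAt φ 0 (Ici τ) τ := by
    intro τ hτ
    have hτ0 : 0 ≤ τ := hs.trans hτ.1
    have hx' : x ∈ (A (s + θ)).domain := by rwa [hper s]
    obtain ⟨y, hy, hdy⟩ := hA.deriv (s + θ) (τ + θ) (by linarith) (by linarith [hτ.1]) ⟨x, hx'⟩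
    have hwτ : w τ ∈ (A τ).domain := by
      have h1 := y.2
      rw [hy, ← extendTriangle_eq (V := UA) (by linarith : 0 ≤ s + θ)
        (by linarith [hτ.1] : s + θ ≤ τ + θ)] at h1
      rwa [← hper τ]
    obtain ⟨z, hz, hdz⟩ := hA.deriv τ τ hτ0 le_rfl ⟨w τ, hwτ⟩
    have hyz : A (τ + θ) y = A τ z := by
      refine hLeq (hper τ) y z ?_
      rw [hy, hz, hA.refl τ hτ0, ← extendTriangle_eq (V := UA) (by linarith : 0 ≤ s + θ)
        (by linarith [hτ.1] : s + θ ≤ τ + θ)]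
      rfl
    have h1 : HasDerivWithinAt w (A (τ + θ) y) (Ici τ) τ := by
      have h2 : HasDerivWithinAt (fun σ => UA (σ + θ) (s + θ) x) (A (τ + θ) y) (Ici τ) τ := by
        have h3 := hdy.scomp τ ((hasDerivWithinAt_id τ (Ici τ)).add_const θ)
          (fun σ hσ => by
            have : τ ≤ σ := hσ
            simp only [mem_Ici, id]
            linarith [hτ.1])
        rw [one_smul] at h3
        exact h3
      refine h2.congr (fun σ hσ => ?_) ?_
      · have : τ ≤ σ := hσ
        simp only [hw, hW]
        rw [extendTriangle_eq (by linarith) (by linarith [hτ.1])]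
      · simp only [hw, hW]
        rw [extendTriangle_eq (by linarith) (by linarith [hτ.1])]
    have h2 : HasDerivWithinAt (fun σ => W σ τ (w τ)) (A τ z) (Ici τ) τ := by
      refine hdz.congr (fun σ hσ => ?_) ?_
      · simp only [hW, extendTriangle_eq hτ0 hσ]
      · simp only [hW, extendTriangle_eq hτ0 le_rfl]
    have h3 := h1.sub h2
    rw [hyz, sub_self, hasDerivWithinAt_iff_isLittleO] at h3
    rw [hasDerivWithinAt_iff_isLittleO]
    obtain ⟨c, hc0, hc⟩ := (stronglyContinuous_right hU.cont t).exists_norm_le s t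
    refine Asymptotics.IsBigO.trans_isLittleO (.of_bound c ?_) h3
    have hlt : ∀ᶠ σ in 𝓝[Ici τ] τ, σ < t := nhdsWithin_le_nhds (gt_mem_nhds hτ.2)
    filter_upwards [hlt, self_mem_nhdsWithin] with σ hσt hστ
    have hστ' : τ ≤ σ := hστ
    have h4 : φ σ - φ τ = W t σ (w σ - W σ τ (w τ)) := by
      rw [map_sub, hU.comp τ σ t hστ' hσt.le]
    simp only [smul_zero, sub_zero, Pi.sub_apply, hU.refl, sub_self]
    rw [h4]
    exact ((W t σ).le_opNorm _).trans
      (mul_le_mul_of_nonneg_right (hc σ ⟨hτ.1.trans hστ', hσt.le⟩) (norm_nonneg _))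
  have h := constant_of_has_deriv_right_zero hφc.continuousOn hderiv t ⟨hst, le_rfl⟩
  have h' : UA (t + θ) (s + θ) x = UA t s x := by
    rw [← extendTriangle_eq (V := UA) hs hst,
      ← extendTriangle_eq (V := UA) (by linarith : 0 ≤ s + θ) (by linarith : s + θ ≤ t + θ)]
    simpa only [hφ, hw, hU.refl] using h
  exact h'

end Triangle

/-! ### The inverse of a coercive operator -/

section Coercive

open Filter Topology

variable {𝕜 : Type*} [RCLike 𝕜]
variable {U : Type*} [NormedAddCommGroup U] [InnerProductSpace 𝕜 U]

theorem norm_mul_le_of_coercive {T : U →L[𝕜] U} {ε : ℝ}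
    (h : ∀ u, ε * ‖u‖ ^ 2 ≤ RCLike.re ⟪T u, u⟫_𝕜) (u : U) : ε * ‖u‖ ≤ ‖T u‖ := by
  rcases (norm_nonneg u).eq_or_lt with h0 | h0
  · rw [← h0, mul_zero]
    exact norm_nonneg _
  · refine le_of_mul_le_mul_right ?_ h0
    calc ε * ‖u‖ * ‖u‖ = ε * ‖u‖ ^ 2 := by ring
      _ ≤ ‖T u‖ * ‖u‖ := (h u).trans ((RCLike.re_le_norm _).trans (norm_inner_le_norm _ _))

theorem ContinuousLinearMap.IsPositive.inverse {T : U →L[𝕜] U} (hT : T.IsPositive)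
    (hi : T.IsInvertible) : T.inverse.IsPositive := by
  have key : ∀ x z, ⟪T.inverse x, z⟫_𝕜 = ⟪x, T.inverse z⟫_𝕜 := fun x z => by
    have h1 := hT.inner_left_eq_inner_right (T.inverse x) (T.inverse z)
    rw [hi.self_apply_inverse, hi.self_apply_inverse] at h1
    exact h1.symm
  rw [ContinuousLinearMap.isPositive_def]
  refine ⟨key, fun x => ?_⟩
  have h1 := hT.re_inner_nonneg_right (T.inverse x)
  rwa [hi.self_apply_inverse] at h1

variable [CompleteSpace U]

theorem isInvertible_of_coercive {T : U →L[𝕜] U} {ε : ℝ} (hε : 0 < ε)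
    (h : ∀ u, ε * ‖u‖ ^ 2 ≤ RCLike.re ⟪T u, u⟫_𝕜) : T.IsInvertible := by
  have h1 := ContinuousLinearMap.isUnit_of_forall_le_norm_inner_map T (c := ⟨ε, hε.le⟩) hε
    fun x => by
      rw [mul_comm]
      exact (h x).trans (RCLike.re_le_norm _)
  obtain ⟨e, he⟩ := h1
  exact ⟨ContinuousLinearEquiv.unitsEquiv 𝕜 U e, he⟩

theorem norm_inverse_apply_le {T : U →L[𝕜] U} {ε : ℝ} (hε : 0 < ε)
    (h : ∀ u, ε * ‖u‖ ^ 2 ≤ RCLike.re ⟪T u, u⟫_𝕜) (v : U) : ‖T.inverse v‖ ≤ ε⁻¹ * ‖v‖ := by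
  have h1 := norm_mul_le_of_coercive h (T.inverse v)
  rw [(isInvertible_of_coercive hε h).self_apply_inverse] at h1
  rwa [inv_mul_eq_div, le_div_iff₀ hε, mul_comm]

/-- The inverse of a uniformly coercive strongly continuous family is strongly continuous, because
`T(t)⁻¹ x - T(t₀)⁻¹ x = T(t)⁻¹ (x - T(t) T(t₀)⁻¹ x)`. -/
theorem StronglyContinuous.inverse {T : ℝ → U →L[𝕜] U} (hT : StronglyContinuous T) {ε : ℝ}
    (hε : 0 < ε) (h : ∀ t u, ε * ‖u‖ ^ 2 ≤ RCLike.re ⟪T t u, u⟫_𝕜) :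
    StronglyContinuous fun t => (T t).inverse := by
  intro x
  refine continuous_iff_continuousAt.2 fun t₀ => ?_
  set w := (T t₀).inverse x with hw
  have hTw : T t₀ w = x := (isInvertible_of_coercive hε (h t₀)).self_apply_inverse x
  have h1 : Tendsto (fun t => ε⁻¹ * ‖x - T t w‖) (𝓝 t₀) (𝓝 0) := by
    have h2 : Continuous fun t => ε⁻¹ * ‖x - T t w‖ :=
      continuous_const.mul (continuous_const.sub (hT w)).norm
    simpa [hTw] using h2.tendsto t₀
  rw [ContinuousAt, tendsto_iff_norm_sub_tendsto_zero]
  refine squeeze_zero (fun _ => norm_nonneg _) (fun t => ?_) h1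
  have h3 : (T t).inverse x - w = (T t).inverse (x - T t w) := by
    rw [map_sub, (isInvertible_of_coercive hε (h t)).inverse_apply_self]
  rw [← hw, h3]
  exact norm_inverse_apply_le hε (h t) _

end Coercive

/-! ### The Riccati system of a control problem -/

section ControlSystem

variable {𝕜 : Type*} [RCLike 𝕜]
variable {H : Type*} [NormedAddCommGroup H] [InnerProductSpace 𝕜 H] [CompleteSpace H]
variable {U : Type*} [NormedAddCommGroup U] [InnerProductSpace 𝕜 U] [CompleteSpace U]
variable {B : ℝ → U →L[𝕜] H} {C : ℝ → H →L[𝕜] H} {Q : ℝ → U →L[𝕜] U}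
variable {UA : ℝ → ℝ → H →L[𝕜] H} {θ : ℝ}

/-- The coefficient `S = B Q⁻¹ B*` of the quadratic term of the Riccati equation. -/
noncomputable def controlWeight (B : ℝ → U →L[𝕜] H) (Q : ℝ → U →L[𝕜] U) (t : ℝ) : H →L[𝕜] H :=
  B t ∘L (Q t).inverse ∘L adjoint (B t)

/-- The constant term `R = C* C` of the Riccati equation. -/
noncomputable def observationWeight (C : ℝ → H →L[𝕜] H) (t : ℝ) : H →L[𝕜] H :=
  adjoint (C t) ∘L C t

theorem riccatiTerm_eq_riccatiDefect (P : ℝ → H →L[𝕜] H) (t : ℝ) :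
    riccatiTerm B C Q t (P t) =
      riccatiDefect (controlWeight B Q) (observationWeight C) P t := rfl

theorem controlWeight_periodic (hB : Function.Periodic B θ) (hQ : Function.Periodic Q θ) :
    Function.Periodic (controlWeight B Q) θ := fun t => by
  rw [controlWeight, hB, hQ, controlWeight]

theorem observationWeight_periodic (hC : Function.Periodic C θ) :
    Function.Periodic (observationWeight C) θ := fun t => by
  rw [observationWeight, hC, observationWeight]

theorem EvolutionFamily.riccatiSystem {W : ℝ → ℝ → H →L[𝕜] H} (hW : EvolutionFamily W)
    (hθ : 0 < θ) (hB : StronglyContinuous B) (hBper : Function.Periodic B θ)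
    (hC : StronglyContinuous C) (hCper : Function.Periodic C θ)
    (hQ : StronglyContinuous Q) (hQpos : ∀ t, (Q t).IsPositive) {ε : ℝ} (hε : 0 < ε)
    (hQε : ∀ t u, ε * ‖u‖ ^ 2 ≤ RCLike.re ⟪Q t u, u⟫_𝕜) :
    RiccatiSystem W (controlWeight B Q) (observationWeight C) where
  evol := hW
  S_meas := hB.strMeas.comp ((hQ.inverse hε hQε).strMeas.comp hB.adjoint_strMeas)
  R_meas := hC.adjoint_strMeas.comp hC.strMeas
  S_bdd := by
    obtain ⟨β, hβ0, hβ⟩ := hB.exists_norm_le_of_periodic hθ hBper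
    refine ⟨β * (ε⁻¹ * β), fun t => ?_⟩
    have h1 : ‖(Q t).inverse‖ ≤ ε⁻¹ :=
      ContinuousLinearMap.opNorm_le_bound _ (by positivity) (norm_inverse_apply_le hε (hQε t))
    refine (ContinuousLinearMap.opNorm_comp_le _ _).trans
      (mul_le_mul (hβ t) ?_ (norm_nonneg _) hβ0)
    refine (ContinuousLinearMap.opNorm_comp_le _ _).trans
      (mul_le_mul h1 ?_ (norm_nonneg _) (by positivity))
    rw [LinearIsometryEquiv.norm_map]
    exact hβ t
  R_bdd := by
    obtain ⟨γ, hγ0, hγ⟩ := hC.exists_norm_le_of_periodic hθ hCper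
    refine ⟨γ * γ, fun t => ?_⟩
    refine (ContinuousLinearMap.opNorm_comp_le _ _).trans
      (mul_le_mul ?_ (hγ t) (norm_nonneg _) hγ0)
    rw [LinearIsometryEquiv.norm_map]
    exact hγ t
  S_pos t := by
    have h1 := ((hQpos t).inverse (isInvertible_of_coercive hε (hQε t))).conj_adjoint (B t)
    exact h1
  R_pos t := ContinuousLinearMap.isPositive_adjoint_comp_self (C t)

variable [NormedSpace ℝ H]

theorem PeriodicStabilizable.isStabilizable (h : PeriodicStabilizable θ UA B) (hθ : 0 < θ)
    (hB : StronglyContinuous B) (hQ : StronglyContinuous Q) (hQper : Function.Periodic Q θ)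
    (hQpos : ∀ t, (Q t).IsPositive) {ε : ℝ} (hε : 0 < ε)
    (hQε : ∀ t u, ε * ‖u‖ ^ 2 ≤ RCLike.re ⟪Q t u, u⟫_𝕜) :
    IsStabilizable (extendTriangle UA) (controlWeight B Q) := by
  obtain ⟨K, hK, hKper, V, hV, M, hM, ρ, hρ, hle⟩ := h
  obtain ⟨κ, hκ0, hκ⟩ := hK.exists_norm_le_of_periodic hθ hKper
  obtain ⟨q, hq0, hq⟩ := hQ.exists_norm_le_of_periodic hθ hQper
  refine ⟨fun t => B t ∘L K t, extendTriangle V,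
    fun x => continuous_apply_of_stronglyContinuous hB (hK x), hV.isPerturbation,
    ⟨M, ρ, .extendTriangle hM hρ hle⟩, q * κ ^ 2, by positivity, fun t y p => ?_⟩
  -- Expand `0 ≤ ⟪Q (u + v), u + v⟫` for `u = K y` and `v = Q⁻¹ B* p`.
  set u := K t y
  set v := (Q t).inverse (adjoint (B t) p) with hv
  have hQv : Q t v = adjoint (B t) p :=
    (isInvertible_of_coercive hε (hQε t)).self_apply_inverse _
  have h1 := (hQpos t).re_inner_nonneg_left (u + v)
  have h2 : ⟪Q t u, v⟫_𝕜 = ⟪u, adjoint (B t) p⟫_𝕜 := by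
    rw [(hQpos t).inner_left_eq_inner_right, hQv]
  have h3 : RCLike.re ⟪Q t u, u⟫_𝕜 ≤ q * κ ^ 2 * ‖y‖ ^ 2 := by
    have h4 := re_inner_apply_le (hq t) u
    rw [← (hQpos t).inner_left_eq_inner_right] at h4
    have h5 : ‖u‖ ≤ κ * ‖y‖ :=
      ((K t).le_opNorm y).trans (mul_le_mul_of_nonneg_right (hκ t) (norm_nonneg _))
    calc _ ≤ q * ‖u‖ ^ 2 := h4
      _ ≤ q * (κ * ‖y‖) ^ 2 := by gcongr
      _ = _ := by ring
  have h6 : RCLike.re ⟪p, controlWeight B Q t p⟫_𝕜 = RCLike.re ⟪adjoint (B t) p, v⟫_𝕜 := by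
    rw [ContinuousLinearMap.adjoint_inner_left]
    rfl
  have h7 : RCLike.re ⟪(B t ∘L K t) y, p⟫_𝕜 = RCLike.re ⟪u, adjoint (B t) p⟫_𝕜 := by
    rw [ContinuousLinearMap.adjoint_inner_right]
    rfl
  rw [map_add, inner_add_left, inner_add_right, inner_add_right, h2, hQv,
    ← inner_conj_symm (adjoint (B t) p) u] at h1
  simp only [map_add, RCLike.conj_re] at h1
  rw [h6, h7]
  linarith

theorem PeriodicDetectable.isDetectable (h : PeriodicDetectable θ UA C) (hθ : 0 < θ)
    (hC : StronglyContinuous C) :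
    IsDetectable (extendTriangle UA) (observationWeight C) := by
  obtain ⟨K, hK, hKper, V, hV, M, hM, ρ, hρ, hle⟩ := h
  obtain ⟨κ, hκ0, hκ⟩ := hK.exists_norm_le_of_periodic hθ hKper
  refine ⟨fun t => K t ∘L C t, extendTriangle V,
    fun x => continuous_apply_of_stronglyContinuous hK (hC x), hV.isPerturbation,
    ⟨M, ρ, .extendTriangle hM hρ hle⟩, κ ^ 2, by positivity, fun t y => ?_⟩
  have h1 : RCLike.re ⟪y, observationWeight C t y⟫_𝕜 = ‖C t y‖ ^ 2 := by
    rw [← inner_self_eq_norm_sq (𝕜 := 𝕜), ← ContinuousLinearMap.adjoint_inner_right]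
    rfl
  have h2 : ‖(K t ∘L C t) y‖ ≤ κ * ‖C t y‖ :=
    ((K t).le_opNorm _).trans (mul_le_mul_of_nonneg_right (hκ t) (norm_nonneg _))
  rw [h1, ← mul_pow]
  exact pow_le_pow_left₀ (norm_nonneg _) h2 2

theorem IsMildRiccati.isRiccati (hs : RiccatiSystem (extendTriangle UA) (controlWeight B Q)
    (observationWeight C)) {T : ℝ} (hT : 0 ≤ T) {P P' : ℝ → H →L[𝕜] H}
    (h : IsMildRiccati UA B C Q T P) (hP' : StronglyContinuous P') (heq : EqOn P' P (Icc 0 T)) :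
    IsRiccati (extendTriangle UA) (controlWeight B Q) (observationWeight C) P' 0 T := by
  have hN := hs.strMeas_riccatiDefect hP'.strMeas
  have hNb := hs.exists_norm_riccatiDefect_le hP' 0 T
  refine ⟨hP', fun t ht => heq ht ▸ h.pos t ht, .of_final hs.evol hN hNb fun t ht x z => ?_⟩
  rw [← inner_lyapunovMap hs.evol hN hNb _ ht, heq ht, h.mild t ht, lyapunovMap,
    extendTriangle_eq ht.1 ht.2, heq ⟨hT, le_rfl⟩]
  congr 2
  refine intervalIntegral.integral_congr fun s hst => ?_
  rw [uIcc_of_le ht.2] at hst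
  simp only [← riccatiTerm_eq_riccatiDefect, extendTriangle_eq ht.1 hst.1,
    heq ⟨ht.1.trans hst.1, hst.2⟩]

theorem IsRiccati.isMildRiccati (hs : RiccatiSystem (extendTriangle UA) (controlWeight B Q)
    (observationWeight C)) {T : ℝ} (hT : 0 ≤ T) {P P' : ℝ → H →L[𝕜] H}
    (h : IsRiccati (extendTriangle UA) (controlWeight B Q) (observationWeight C) P 0 T)
    (heq : EqOn P' P (Icc 0 T)) : IsMildRiccati UA B C Q T P' where
  strong_cont x := (h.cont x).continuousOn.congr fun t ht => by rw [heq ht]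
  pos t ht := heq ht ▸ h.pos t ht
  mild t ht z := by
    have hN := hs.strMeas_riccatiDefect h.cont.strMeas
    have hNb := hs.exists_norm_riccatiDefect_le h.cont 0 T
    have h1 : P t z = lyapunovMap (extendTriangle UA)
        (riccatiDefect (controlWeight B Q) (observationWeight C) P) (P T) T t z :=
      ext_inner_left 𝕜 fun x => by
        rw [inner_lyapunovMap hs.evol hN hNb _ ht]
        exact h.lyap t T ht.1 ht.2 le_rfl x z
    rw [heq ht, h1, lyapunovMap, extendTriangle_eq ht.1 ht.2, heq ⟨hT, le_rfl⟩]
    congr 1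
    refine intervalIntegral.integral_congr fun s hst => ?_
    rw [uIcc_of_le ht.2] at hst
    simp only [← riccatiTerm_eq_riccatiDefect, extendTriangle_eq ht.1 hst.1,
      heq ⟨ht.1.trans hst.1, hst.2⟩]

end ControlSystem

/-! ### Periodic and final value solutions -/

section Periodic

variable {𝕜 : Type*} [RCLike 𝕜]
variable {H : Type*} [NormedAddCommGroup H] [InnerProductSpace 𝕜 H]

theorem Function.Periodic.continuous_of_continuousOn {E : Type*} [TopologicalSpace E] {f : ℝ → E}
    {θ : ℝ} (hθ : 0 < θ) (hf : Function.Periodic f θ) (hc : ContinuousOn f (Icc 0 θ)) :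
    Continuous f := by
  have : Fact (0 < θ) := ⟨hθ⟩
  have h1 : f 0 = f θ := by simpa using (hf 0).symm
  have h2 := (AddCircle.liftIco_zero_continuous h1 hc).comp (AddCircle.continuous_mk' θ)
  convert h2 using 1
  ext t
  have h3 : Function.Periodic (fun t : ℝ => (f t, (t : AddCircle θ))) θ := fun t => by
    simp only [hf t, AddCircle.coe_add_period]
  obtain ⟨s, hs, hst⟩ := h3.exists_mem_Ico₀ hθ t
  have h4 := Prod.mk.inj hst
  rw [Function.comp_apply, h4.1]
  have h5 : (QuotientAddGroup.mk' (AddSubgroup.zmultiples θ)) t = (s : AddCircle θ) := h4.2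
  rw [h5, AddCircle.liftIco_zero_coe_apply hs]

/-- The periodic extension of a function on `[0, θ]` whose values at the end points agree. -/
theorem exists_periodic_eqOn {E : Type*} {θ : ℝ} (hθ : 0 < θ) (f : ℝ → E) (h : f θ = f 0) :
    ∃ g : ℝ → E, Function.Periodic g θ ∧ EqOn g f (Icc 0 θ) := by
  refine ⟨fun t => f (toIcoMod hθ 0 t), fun t => by simp only [toIcoMod_add_right], fun t ht => ?_⟩
  rcases ht.2.eq_or_lt with rfl | hlt
  · have h1 : toIcoMod hθ 0 t = 0 := by
      simpa using toIcoMod_apply_right hθ (0 : ℝ)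
    simp only [h1, h]
  · have h1 : toIcoMod hθ 0 t = t := (toIcoMod_eq_self hθ).2 ⟨ht.1, by simpa using hlt⟩
    simp only [h1]

variable [CompleteSpace H] [NormedSpace ℝ H]
variable {U : Type*} [NormedAddCommGroup U] [InnerProductSpace 𝕜 U] [CompleteSpace U]
variable {B : ℝ → U →L[𝕜] H} {C : ℝ → H →L[𝕜] H} {Q : ℝ → U →L[𝕜] U}
variable {UA : ℝ → ℝ → H →L[𝕜] H} {θ : ℝ} {P : ℝ → H →L[𝕜] H}

theorem IsPeriodicRiccati.isRiccati (hs : RiccatiSystem (extendTriangle UA) (controlWeight B Q)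
    (observationWeight C)) (hθ : 0 < θ) (h : IsPeriodicRiccati UA B C Q θ P) :
    IsRiccati (extendTriangle UA) (controlWeight B Q) (observationWeight C) P 0 θ := by
  refine h.sol.isRiccati hs hθ.le (fun x => ?_) fun _ _ => rfl
  refine Function.Periodic.continuous_of_continuousOn hθ (fun t => ?_) (h.sol.strong_cont x)
  rw [h.periodic]

/-- A solution with final value zero, extended constantly to all of `ℝ`. -/
theorem IsFinalRiccati.exists_isRiccati
    (hs : RiccatiSystem (extendTriangle UA) (controlWeight B Q) (observationWeight C)) {T : ℝ}
    (hT : 0 ≤ T) (h : IsFinalRiccati UA B C Q T P) :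
    ∃ P', IsRiccati (extendTriangle UA) (controlWeight B Q) (observationWeight C) P' 0 T ∧
      P' T = 0 ∧ EqOn P' P (Icc 0 T) := by
  have heq : EqOn (fun t => P (projIcc 0 T hT t)) P (Icc 0 T) := fun t ht => by
    simp only [projIcc_of_mem hT ht]
  refine ⟨_, h.sol.isRiccati hs hT (fun x => ?_) heq, (heq ⟨hT, le_rfl⟩).trans h.final, heq⟩
  exact (h.sol.strong_cont x).comp_continuous
    (continuous_subtype_val.comp continuous_projIcc) fun t => (projIcc 0 T hT t).2

end Periodic

theorem proposition3p1 {𝕜 : Type*} [RCLike 𝕜]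
    {H : Type*} [NormedAddCommGroup H] [InnerProductSpace 𝕜 H] [CompleteSpace H]
    [NormedSpace ℝ H] [IsScalarTower ℝ 𝕜 H]
    {U : Type*} [NormedAddCommGroup U] [InnerProductSpace 𝕜 U] [CompleteSpace U]
    (θ : ℝ) (hθ : 0 < θ)
    (A : ℝ → H →ₗ.[𝕜] H) (UA : ℝ → ℝ → H →L[𝕜] H)
    (B : ℝ → U →L[𝕜] H) (C : ℝ → H →L[𝕜] H) (Q : ℝ → U →L[𝕜] U)
    (hA : GeneratesEvolution A UA) (hAper : Function.Periodic A θ)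
    (hB : StronglyContinuous B) (hBper : Function.Periodic B θ)
    (hC : StronglyContinuous C) (hCper : Function.Periodic C θ) (hCpos : ∀ t, (C t).IsPositive)
    (hQ : StronglyContinuous Q) (hQper : Function.Periodic Q θ) (hQpos : ∀ t, (Q t).IsPositive)
    (hQε : ∃ ε : ℝ, 0 < ε ∧ ∀ t u, ε * ‖u‖ ^ 2 ≤ RCLike.re ⟪Q t u, u⟫_𝕜)
    (hstab : PeriodicStabilizable θ UA B) (hdet : PeriodicDetectable θ UA C) :
    -- the exponential estimate, and uniqueness of the solutions that it compares
    (∀ Pθ : ℝ → H →L[𝕜] H, IsPeriodicRiccati UA B C Q θ Pθ →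
      (∀ P : ℝ → H →L[𝕜] H, IsPeriodicRiccati UA B C Q θ P → P = Pθ) ∧
      ∃ M > 0, ∃ μ > 0, ∀ T > 0, ∀ PT : ℝ → H →L[𝕜] H, IsFinalRiccati UA B C Q T PT →
        (∀ P : ℝ → H →L[𝕜] H, IsFinalRiccati UA B C Q T P → EqOn P PT (Icc 0 T)) ∧
        ∀ t ∈ Icc 0 T, ‖Pθ t - PT t‖ ≤ M * Real.exp (-μ * (T - t))) ∧
    -- existence of both solutions, when the adjoint evolution operator is strongly continuous
    (StronglyContinuousTriangle (fun t s => ContinuousLinearMap.adjoint (UA t s)) →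
      (∃ Pθ : ℝ → H →L[𝕜] H, IsPeriodicRiccati UA B C Q θ Pθ) ∧
      ∀ T > 0, ∃ PT : ℝ → H →L[𝕜] H, IsFinalRiccati UA B C Q T PT) := by
  obtain ⟨ε, hε, hQε⟩ := hQε
  have hs := hA.evolutionFamily.riccatiSystem hθ hB hBper hC hCper hQ hQpos hε hQε
  have hst := hstab.isStabilizable hθ hB hQ hQper hQpos hε hQε
  have hd := hdet.isDetectable hθ hC
  have hS := controlWeight_periodic hBper hQper
  have hR := observationWeight_periodic hCper
  have hU : ∀ s t, 0 ≤ s → s ≤ t →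
      extendTriangle UA (t + θ) (s + θ) = extendTriangle UA t s := fun s t h0 h1 => by
    rw [extendTriangle_eq h0 h1, extendTriangle_eq (by linarith) (by linarith),
      hA.periodic hθ.le hAper h0 h1]
  refine ⟨fun Pθ hPθ => ⟨fun P hP => ?_, ?_⟩, fun hadj => ?_⟩
  · exact hs.eq_of_periodic hd hθ hU hS hR (hP.isRiccati hs hθ) hP.periodic
      (hPθ.isRiccati hs hθ) hPθ.periodic
  · obtain ⟨M, μ, hM, hμ, hle⟩ := hs.exists_norm_periodic_sub_le hst hd hθ hU hS hR
      (hPθ.isRiccati hs hθ) hPθ.periodic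
    refine ⟨M, hM, μ, hμ, fun T hT PT hPT => ?_⟩
    obtain ⟨P₁, hP₁, hP₁T, h₁⟩ := hPT.exists_isRiccati hs hT.le
    refine ⟨fun P hP => ?_, fun t ht => ?_⟩
    · obtain ⟨P₂, hP₂, hP₂T, h₂⟩ := hP.exists_isRiccati hs hT.le
      intro t ht
      rw [← h₁ ht, ← h₂ ht]
      exact hs.eqOn_of_eq_final hd le_rfl hP₂ hP₁ (hP₂T.trans hP₁T.symm) ht
    · rw [← h₁ ht]
      exact hle hP₁ hP₁T t ht
  · have hadj' : ∀ x, Continuous fun p : ℝ × ℝ => adjoint (extendTriangle UA p.1 p.2) x :=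
      hadj.continuous_extendTriangle
    refine ⟨?_, fun T hT => ?_⟩
    · obtain ⟨P, hP, hPθ⟩ := hs.exists_periodic hst hd hadj' hθ hU hS hR
      obtain ⟨P', hper, heq⟩ := exists_periodic_eqOn hθ P hPθ
      exact ⟨P', hP.isMildRiccati hs hθ.le heq, hper⟩
    · obtain ⟨P, hP, hPT⟩ := hs.exists_final hst hadj' hT.le
      exact ⟨P, hP.isMildRiccati hs hT.le fun _ _ => rfl, hPT⟩
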